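/- Let $\Sigma$ be the triangular complex obtained by tessellating the Euclidean plane by equilateral triangles. A building of type $\widetilde A_2$ is a non-empty simplicial complex $X$ such that, calling apartments all the subcomplexes of $X$ isomorphic to $\Sigma$, (i) any two simplices of $X$ lie in a common apartment, and (ii) for any two apartments $F, F'$ there is a simplicial isomorphism $F \to F'$ fixing $F \cap F'$ pointwise. It is thick if every edge lies in more than two triangles. A singular ray (line) is a geodesic ray (line) contained in a wall of an apartment; rays are taken to start at vertices. The vertices at infinity of $X$ are the endpoints of singular rays, i.e. the classes of singular rays modulo being at bounded distance. They form a graph $\Delta$, in which two of them are adjacent if they are the two vertices of the ideal boundary of a sector of $X$ (of angle $\pi/3$); two vertices of $\Delta$ are opposite if they are at distance $3$ in $\Delta$. For a vertex $v$ of $\Delta$, the panel tree $T_v$ is the tree whose vertices are the singular rays with endpoint $v$, modulo having a common subray, two classes being adjacent if they are represented by rays on two consecutive parallel walls of an apartment. If $v, w$ are opposite, there is a canonical isomorphism $T_v \to T_w$, which sends the class of the end at $v$ of a singular line joining $v$ and $w$ to the class of its end at $w$. The projectivity group $\Pi(v) \leq \mathrm{Aut}(T_v)$ is the group of all composites of canonical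 isomorphisms $T_{v_0} \to T_{v_1} \to \cdots \to T_{v_k}$, where $v_0 = v_k = v$ and $v_{i}$ is opposite $v_{i+1}$ for $0 \le i < k$. An automorphism of a tree is called horocyclic if it fixes pointwise a horosphere, i.e. a level set of the Busemann function of an end, within the vertex set. **Proposition.** Let $X$ be a thick building of type $\widetilde A_2$. Then $X$ has vertices at infinity, and for every vertex at infinity $v$ the projectivity group $\Pi(v)$ contains a non-trivial horocyclic automorphism of the panel tree $T_v$. -/

import Mathlib

namespace TriangularBuilding

/-! ### The model apartment -/

/-- The model apartment `Σ`: the tessellation of the Euclidean plane by equilateral triangles, as an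
abstract simplicial complex. The pair `(a, b)` stands for the point `a e₁ + b e₂`, where `e₁`, `e₂`
are unit vectors at angle `π / 3`; the triangles are `p, p + e₁, p + e₂` and
`p + e₁, p + e₂, p + e₁ + e₂`. -/
def model : AbstractSimplicialComplex (ℤ × ℤ) where
  faces := {s | s.Nonempty ∧ ∃ p : ℤ × ℤ,
    s ⊆ {p, p + (1, 0), p + (0, 1)} ∨ s ⊆ {p + (1, 0), p + (0, 1), p + (1, 1)}}
  isRelLowerSet_faces := by
    rintro s ⟨hs, p, hp⟩
    refine ⟨hs, fun t hts ht => ⟨ht, p, ?_⟩⟩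
    exact hp.imp (fun h => subset_trans hts h) (fun h => subset_trans hts h)
  singleton_mem := fun v => ⟨Finset.singleton_nonempty v, v, Or.inl (by simp)⟩

variable {V : Type*}

/-! ### Apartments and buildings -/

/-- A parametrized apartment of a simplicial complex `X`: an isomorphism from the model apartment
onto a subcomplex of `X`. The vertices of the apartment are the `φ.emb p`, and its simplices are the
images of the simplices of the model. -/
structure Chart (X : AbstractSimplicialComplex V) where
  /-- the map on vertices -/
  emb : ℤ × ℤ ↪ V
  map_mem : ∀ s ∈ model, s.map emb ∈ X

/-- The simplex `t` belongs to the apartment parametrized by `φ`. -/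
def Chart.Contains {X : AbstractSimplicialComplex V} (φ : Chart X) (t : Finset V) : Prop :=
  ∃ s ∈ model, s.map φ.emb = t

/-- `X` is a building of type `Ã₂`. Apartments are all the subcomplexes isomorphic to the model
apartment. The simplicial isomorphism between the apartments of `φ` and `ψ` in the second axiom is
`φ p ↦ ψ (α p)`, with `α` a simplicial automorphism of the model. -/
structure IsBuilding (X : AbstractSimplicialComplex V) : Prop where
  nonempty : Nonempty V
  exists_apartment : ∀ s ∈ X, ∀ t ∈ X, ∃ φ : Chart X, φ.Contains s ∧ φ.Contains t
  exists_iso : ∀ φ ψ : Chart X, ∃ α : ℤ × ℤ ≃ ℤ × ℤ,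
    (∀ s : Finset (ℤ × ℤ), s.map α.toEmbedding ∈ model ↔ s ∈ model) ∧
      ∀ p q, φ.emb p = ψ.emb q → ψ.emb (α p) = φ.emb p

/-- Every edge lies in more than two triangles. -/
def IsThick (X : AbstractSimplicialComplex V) : Prop :=
  ∀ e ∈ X, e.card = 2 → 2 < {c : Finset V | c ∈ X ∧ c.card = 3 ∧ e ⊆ c}.encard

/-- The 1-skeleton of `X`. -/
def skeleton (X : AbstractSimplicialComplex V) : SimpleGraph V :=
  SimpleGraph.fromRel fun x y => ∃ s ∈ X, x ∈ s ∧ y ∈ s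

/-! ### Singular rays and lines -/

/-- The singular geodesic rays of `X` issuing from a vertex, given by the sequence of their vertices.
They are the geodesic rays along walls of apartments; as the automorphisms of the model act
transitively on the rays of walls issuing from vertices, the direction `e₁` in all charts yields all
of them. -/
structure Ray (X : AbstractSimplicialComplex V) where
  /-- the sequence of vertices -/
  toFun : ℕ → V
  exists_chart : ∃ φ : Chart X, ∀ n : ℕ, toFun n = φ.emb ((n : ℤ), 0)

/-- The walls of apartments of `X` (the singular geodesic lines through vertices), parametrized by
their vertices. -/
structure Line (X : AbstractSimplicialComplex V) where
  /-- the bi-infinite sequence of vertices -/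
  toFun : ℤ → V
  exists_chart : ∃ φ : Chart X, ∀ n : ℤ, toFun n = φ.emb (n, 0)

variable {X : AbstractSimplicialComplex V}

/-- The ray `φ 0, φ e₁, φ (2 e₁), …`. -/
def Chart.rayOne (φ : Chart X) : Ray X := ⟨fun n => φ.emb ((n : ℤ), 0), φ, fun _ => rfl⟩

theorem map_equiv_mem_model (α : ℤ × ℤ ≃ ℤ × ℤ) (h : ∀ p : ℤ × ℤ,
      (({p, p + (1, 0), p + (0, 1)} : Finset (ℤ × ℤ)).map α.toEmbedding ∈ model) ∧
      (({p + (1, 0), p + (0, 1), p + (1, 1)} : Finset (ℤ × ℤ)).map α.toEmbedding ∈ model))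
    (s : Finset (ℤ × ℤ)) (hs : s ∈ model) : s.map α.toEmbedding ∈ model := by
  obtain ⟨hne, p, hp | hp⟩ := hs
  · exact (model.isRelLowerSet_faces (h p).1).2 (Finset.map_subset_map.2 hp) (by simpa using hne)
  · exact (model.isRelLowerSet_faces (h p).2).2 (Finset.map_subset_map.2 hp) (by simpa using hne)

/-- A chart precomposed with the symmetry exchanging `e₁` and `e₂`. -/
def Chart.swap (φ : Chart X) : Chart X where
  emb := (Equiv.prodComm ℤ ℤ).toEmbedding.trans φ.emb
  map_mem := fun s hs => by
    rw [← Finset.map_map]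
    refine φ.map_mem _ (map_equiv_mem_model _ (fun p => ⟨⟨by simp, p.swap, Or.inl ?_⟩,
      ⟨by simp, p.swap, Or.inr ?_⟩⟩) s hs)
    · intro q hq
      simp only [Finset.map_insert, Finset.map_singleton, Finset.mem_insert,
        Finset.mem_singleton] at hq ⊢
      rcases hq with rfl | rfl | rfl <;> simp [Prod.ext_iff]
    · intro q hq
      simp only [Finset.map_insert, Finset.map_singleton, Finset.mem_insert,
        Finset.mem_singleton] at hq ⊢
      rcases hq with rfl | rfl | rfl <;> simp [Prod.ext_iff]

/-- A chart precomposed with the central symmetry at the origin. -/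
def Chart.neg (φ : Chart X) : Chart X where
  emb := (Equiv.neg (ℤ × ℤ)).toEmbedding.trans φ.emb
  map_mem := fun s hs => by
    rw [← Finset.map_map]
    refine φ.map_mem _ (map_equiv_mem_model _ (fun p => ⟨⟨by simp, -p - (1, 1), Or.inr ?_⟩,
      ⟨by simp, -p - (1, 1), Or.inl ?_⟩⟩) s hs)
    · intro q hq
      simp only [Finset.map_insert, Finset.map_singleton, Finset.mem_insert,
        Finset.mem_singleton] at hq ⊢
      rcases hq with rfl | rfl | rfl <;> simp [Prod.ext_iff] <;> omega
    · intro q hq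
      simp only [Finset.map_insert, Finset.map_singleton, Finset.mem_insert,
        Finset.mem_singleton] at hq ⊢
      rcases hq with rfl | rfl | rfl <;> simp [Prod.ext_iff] <;> omega

/-- The ray `φ 0, φ e₂, φ (2 e₂), …`; with `φ.rayOne` it bounds the sector
`{φ (a, b) | 0 ≤ a, 0 ≤ b}` of angle `π / 3`. -/
def Chart.rayTwo (φ : Chart X) : Ray X := φ.swap.rayOne

/-- The line traversed backwards. -/
def Line.reverse (l : Line X) : Line X where
  toFun := fun n => l.toFun (-n)
  exists_chart := by
    obtain ⟨φ, hφ⟩ := l.exists_chart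
    refine ⟨φ.neg, fun n => ?_⟩
    rw [hφ]
    show φ.emb _ = φ.emb (-(n, 0))
    simp

/-- The positive half of a line. -/
def Line.forward (l : Line X) : Ray X where
  toFun := fun n => l.toFun n
  exists_chart := by
    obtain ⟨φ, hφ⟩ := l.exists_chart
    exact ⟨φ, fun n => hφ n⟩

/-- The negative half of a line. -/
def Line.backward (l : Line X) : Ray X := l.reverse.forward

/-! ### The building at infinity -/

/-- Two singular rays have the same endpoint in the ideal boundary of `X` if they stay at bounded
distance from each other. (The distance in the 1-skeleton is bi-Lipschitz to the distance of `X`.) -/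
def raySetoid (X : AbstractSimplicialComplex V) : Setoid (Ray X) where
  r := fun r r' => ∃ C : ℕ, ∀ n, (skeleton X).edist (r.toFun n) (r'.toFun n) ≤ C
  iseqv :=
    { refl := fun r => ⟨0, fun n => by simp⟩
      symm := fun ⟨C, h⟩ => ⟨C, fun n => by rw [SimpleGraph.edist_comm]; exact h n⟩
      trans := fun ⟨C, h⟩ ⟨D, h'⟩ => ⟨C + D, fun n => by
        push_cast
        exact SimpleGraph.edist_triangle.trans (add_le_add (h n) (h' n))⟩ }

/-- The vertices at infinity of `X`: the endpoints of the singular rays. -/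
def InfVertex (X : AbstractSimplicialComplex V) : Type _ := Quotient (raySetoid X)

/-- The endpoint at infinity of a singular ray. -/
def Ray.endpoint (r : Ray X) : InfVertex X := Quotient.mk (raySetoid X) r

/-- The building at infinity `Δ` as a graph: two vertices at infinity are adjacent if they are the
two vertices of a Weyl chamber, that is, of the ideal boundary of a sector. -/
def infBuilding (X : AbstractSimplicialComplex V) : SimpleGraph (InfVertex X) :=
  SimpleGraph.fromRel fun v w => ∃ φ : Chart X, φ.rayOne.endpoint = v ∧ φ.rayTwo.endpoint = w

/-- Vertices at infinity are opposite if they are at distance three, the maximal distance, in `Δ`. -/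
def IsOpposite (v w : InfVertex X) : Prop := (infBuilding X).dist v w = 3

/-! ### Panel trees -/

/-- Rays towards `v` are asymptotic if their intersection contains a ray. -/
def asymptoticSetoid (v : InfVertex X) : Setoid {r : Ray X // r.endpoint = v} where
  r := fun r r' => ∃ a b : ℕ, ∀ n, r.1.toFun (a + n) = r'.1.toFun (b + n)
  iseqv :=
    { refl := fun r => ⟨0, 0, fun n => rfl⟩
      symm := fun ⟨a, b, h⟩ => ⟨b, a, fun n => (h n).symm⟩
      trans := fun {x y z} ⟨a, b, h⟩ ⟨c, d, h'⟩ => ⟨a + c, d + b, fun n => by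
        have h1 := h (c + n)
        have h2 := h' (b + n)
        rw [show a + c + n = a + (c + n) by ring, h1, show b + (c + n) = c + (b + n) by ring, h2,
          show d + b + n = d + (b + n) by ring]⟩ }

/-- The vertices of the panel tree at `v`: asymptotic classes of singular rays towards `v`. -/
def PanelVertex (v : InfVertex X) : Type _ := Quotient (asymptoticSetoid v)

/-- The asymptotic class of a ray towards `v`. -/
def Ray.germ (r : Ray X) (v : InfVertex X) (h : r.endpoint = v) : PanelVertex v :=
  Quotient.mk (asymptoticSetoid v) ⟨r, h⟩

/-- The panel tree `T_v`. Two distinct classes are adjacent if they are represented by two rays on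
consecutive parallel walls of an apartment, that is, if their distance (the Euclidean distance
between eventually parallel representatives in an apartment) is the smallest possible one,
`√3 / 2`. -/
def panelTree (v : InfVertex X) : SimpleGraph (PanelVertex v) :=
  SimpleGraph.fromRel fun x y => ∃ (r r' : Ray X) (h : r.endpoint = v) (h' : r'.endpoint = v),
    r.germ v h = x ∧ r'.germ v h' = y ∧
      ∃ φ : Chart X, ∀ n : ℕ, r.toFun n = φ.emb ((n : ℤ), 0) ∧ r'.toFun n = φ.emb ((n : ℤ), 1)

/-! ### The projectivity group -/

/-- The points `x ∈ T_v` and `x' ∈ T_w` are the classes of the two ends of one singular line joining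
`v` and `w`. For opposite `v` and `w` this is the graph of the canonical isomorphism `T_v ≅ T_w`,
obtained from the tree of all (mutually parallel) singular lines joining `v` and `w`. -/
def Joined {v w : InfVertex X} (x : PanelVertex v) (x' : PanelVertex w) : Prop :=
  ∃ (l : Line X) (h : l.backward.endpoint = v) (h' : l.forward.endpoint = w),
    l.backward.germ v h = x ∧ l.forward.germ w h' = x'

/-- The perspectivities `[v₀; v₁; …; v_k]`, acting on panel trees: the composites of the canonical
isomorphisms `T_{v_i} ≅ T_{v_{i+1}}` along sequences in which `v_i` is opposite `v_{i+1}`. -/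
inductive IsPerspectivity (v : InfVertex X) :
    ∀ {w : InfVertex X}, (panelTree v ≃g panelTree w) → Prop
  | refl : IsPerspectivity v (SimpleGraph.Iso.refl : panelTree v ≃g panelTree v)
  | step {w w' : InfVertex X} (f : panelTree v ≃g panelTree w) (g : panelTree w ≃g panelTree w') :
      IsPerspectivity v f → IsOpposite w w' → (∀ x, Joined x (g x)) →
        IsPerspectivity v (f.trans g)

theorem Line.reverse_reverse (l : Line X) : l.reverse.reverse = l := by
  cases l
  simp [Line.reverse]

theorem Joined.symm {v w : InfVertex X} {x : PanelVertex v} {x' : PanelVertex w}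
    (h : Joined x x') : Joined x' x := by
  obtain ⟨l, h, h', hx, hx'⟩ := h
  refine ⟨l.reverse, ?_, h, ?_, hx⟩
  · rw [Line.backward, Line.reverse_reverse]; exact h'
  · simp only [Line.backward, Line.reverse_reverse]; exact hx'

theorem IsPerspectivity.trans {u v w : InfVertex X} {f : panelTree u ≃g panelTree v}
    {g : panelTree v ≃g panelTree w} (hf : IsPerspectivity u f) (hg : IsPerspectivity v g) :
    IsPerspectivity u (f.trans g) := by
  induction hg with
  | refl => exact hf
  | step g g' _ ho hj ih => exact IsPerspectivity.step (f.trans g) g' ih ho hj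

theorem IsPerspectivity.symm {v w : InfVertex X} {f : panelTree v ≃g panelTree w}
    (hf : IsPerspectivity v f) : IsPerspectivity w (RelIso.symm f) := by
  induction hf with
  | refl => exact IsPerspectivity.refl
  | @step w w' f g _ ho hj ih =>
    have hg : IsPerspectivity w' (SimpleGraph.Iso.refl.trans (RelIso.symm g)) := by
      refine IsPerspectivity.step _ _ IsPerspectivity.refl ?_ fun x => ?_
      · rw [IsOpposite, SimpleGraph.dist_comm]; exact ho
      · have := (hj (RelIso.symm g x)).symm
        rwa [RelIso.apply_symm_apply] at this
    exact IsPerspectivity.trans hg ih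

/-- The projectivity group `Π(v)` of `X` at `v`, as a group of automorphisms of the panel tree
`T_v`: the perspectivities `[v₀; …; v_k]` with `v₀ = v_k = v`. -/
def projectivityGroup (v : InfVertex X) : Subgroup (panelTree v ≃g panelTree v) where
  carrier := {g | IsPerspectivity v g}
  one_mem' := IsPerspectivity.refl
  mul_mem' := fun {_ _} ha hb => IsPerspectivity.trans hb ha
  inv_mem' := fun {_} ha => IsPerspectivity.symm ha

/-! ### Horocyclic automorphisms -/

/-- The horosphere of the tree `T` through `r 0` centred at the end of the geodesic ray `r`: the zero
level set of the Busemann function `x ↦ lim (dist x (r n) - n)`. -/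
def horosphere {W : Type*} (T : SimpleGraph W) (r : ℕ → W) : Set W :=
  {x | ∃ N : ℕ, ∀ n ≥ N, T.dist x (r n) = n}

/-- An automorphism of the tree `T` is horocyclic if it fixes some horosphere pointwise. -/
def IsHorocyclic {W : Type*} (T : SimpleGraph W) (g : T ≃g T) : Prop :=
  ∃ r : ℕ → W, (∀ m n : ℕ, m ≤ n → T.dist (r m) (r n) = n - m) ∧ ∀ x ∈ horosphere T r, g x = x

end TriangularBuilding

/-!
The type function orients the edges of the building so that types increase by one. In the link of a
vertex, a projective plane, the out-neighbours are the points and the in-neighbours are the lines. A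
singular line is then the same thing as a bi-infinite directed path which is nowhere bent, that is,
in which the predecessor and the successor of each vertex are non-incident in the link
(`StraightLine`). The directed distance from a fixed vertex changes along the edges at a vertex as
in an apartment (`ArrowGeometry`); this is seen by retractions onto apartments. It follows that a
map of the model plane into the building which is locally an embedding is an apartment
(`ArrowGeometry.flat_injective`, `Flat.exists_chart`), and all further apartments are constructed
row by row. A triangle on an edge of a singular line extends uniquely to a strip along the line, and
the vertices of a panel tree adjacent to the end of a line are the ends of the strips along it. So
the canonical isomorphism between the panel trees at the two ends of a line is followed by moving
strips along lines, and it exists since panel trees are connected (`AreJoined.exists_iso`).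

Let `v` and `w` be the two ends of the rows of an apartment `φ`. By thickness there is an apartment
`φ₁` which branches off from `φ` on the right of the wall `a = 0`, and an apartment `φ₃` which
branches off on the left of the wall `a + b = 0`. The left half of a row of `φ₃` above the origin
continues the right half of the corresponding row of `φ₁` to a straight line. With the ends `v'` of
the rows of `φ₁` and `w'` of the rows of `φ₃`, this gives a projectivity `g` through `v, w, v', w',
v`. For `b ≥ 0`, the four lines involved in the image of the end of the row `b` coincide in the
segment `-b ≤ a ≤ 0`. Strips along them coincide in a segment shorter by one, so by induction `g`
fixes the ball of radius `b` around the end of the row `b` in the panel tree (`Quad.apply_eq`). The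
union of these balls contains a horosphere centred at the end of the tree to which the rows
converge. For `b = 0` the common segment is reduced to a vertex, and incidences in its link show
that the end of the row `-1` is moved (`Branches.strip_ne`).
-/

namespace TriangularBuilding

/-! ### Combinatorics of the model apartment -/

/-- Two vertices of the model apartment are equal or adjacent. -/
def Hex (p q : ℤ × ℤ) : Prop :=
  p.1 - q.1 ≤ 1 ∧ q.1 - p.1 ≤ 1 ∧ p.2 - q.2 ≤ 1 ∧ q.2 - p.2 ≤ 1 ∧
    p.1 + p.2 - q.1 - q.2 ≤ 1 ∧ q.1 + q.2 - p.1 - p.2 ≤ 1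

theorem hex_of_mem_model {s : Finset (ℤ × ℤ)} (hs : s ∈ model) {p q : ℤ × ℤ} (hp : p ∈ s)
    (hq : q ∈ s) : Hex p q := by
  obtain ⟨-, ⟨a, b⟩, h | h⟩ := hs <;>
  · have h1 := h hp
    have h2 := h hq
    obtain ⟨p1, p2⟩ := p
    obtain ⟨q1, q2⟩ := q
    simp only [Finset.mem_insert, Finset.mem_singleton, Prod.mk_add_mk, Prod.mk.injEq] at h1 h2
    simp only [Hex]
    omega

theorem exists_mem_model_of_hex {p q r : ℤ × ℤ} (hpq : Hex p q) (hpr : Hex p r) (hqr : Hex q r) :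
    ∃ s ∈ model, p ∈ s ∧ q ∈ s ∧ r ∈ s := by
  refine ⟨{p, q, r}, ⟨by simp, (min p.1 (min q.1 r.1), min p.2 (min q.2 r.2)), ?_⟩, by simp⟩
  obtain ⟨p1, p2⟩ := p
  obtain ⟨q1, q2⟩ := q
  obtain ⟨r1, r2⟩ := r
  simp only [Hex] at hpq hpr hqr
  simp only [Finset.insert_subset_iff, Finset.singleton_subset_iff, Finset.mem_insert,
    Finset.mem_singleton, Prod.mk_add_mk, Prod.mk.injEq]
  omega

theorem mem_model_of_hex {t : Finset (ℤ × ℤ)} (hc : t.card = 3)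
    (h : ∀ p ∈ t, ∀ q ∈ t, Hex p q) : t ∈ model := by
  obtain ⟨x, y, z, -, -, -, rfl⟩ := Finset.card_eq_three.1 hc
  obtain ⟨s, hs, hx, hy, hz⟩ := exists_mem_model_of_hex (h x (by simp) y (by simp))
    (h x (by simp) z (by simp)) (h y (by simp) z (by simp))
  refine (model.isRelLowerSet_faces hs).2 ?_ (by simp)
  simp [Finset.insert_subset_iff, *]

theorem eq_or_eq_of_hex {A B C : ℤ × ℤ} (hAB : Hex A B) (hAC : Hex A C) (hBC : Hex B C)
    (nAB : A ≠ B) (nAC : A ≠ C) (nBC : B ≠ C) :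
    C = (A.1 - (B.2 - A.2), A.2 + (B.1 - A.1) + (B.2 - A.2)) ∨
      C = (A.1 + (B.1 - A.1) + (B.2 - A.2), A.2 - (B.1 - A.1)) := by
  obtain ⟨a, a'⟩ := A
  obtain ⟨b, b'⟩ := B
  obtain ⟨c, c'⟩ := C
  simp only [Hex, ne_eq, Prod.mk.injEq] at *
  omega

/-- Besides `A B C`, at most one triangle of the model contains the edge `A B`. -/
theorem eq_of_hex {A B C D D' : ℤ × ℤ} (hAB : Hex A B) (hAC : Hex A C) (hBC : Hex B C)
    (nAB : A ≠ B) (nAC : A ≠ C) (nBC : B ≠ C)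
    (hDA : Hex A D) (hDB : Hex B D) (nDA : A ≠ D) (nDB : B ≠ D) (nDC : C ≠ D)
    (hDA' : Hex A D') (hDB' : Hex B D') (nDA' : A ≠ D') (nDB' : B ≠ D') (nDC' : C ≠ D') :
    D = D' := by
  rcases eq_or_eq_of_hex hAB hAC hBC nAB nAC nBC with h | h <;>
  rcases eq_or_eq_of_hex hAB hDA hDB nAB nDA nDB with h' | h' <;>
  rcases eq_or_eq_of_hex hAB hDA' hDB' nAB nDA' nDB' with h'' | h'' <;> simp_all

/-- A morphism of the model apartment: an injective map preserving adjacency. -/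
structure IsModelMap (f : ℤ × ℤ → ℤ × ℤ) : Prop where
  inj : Function.Injective f
  hex : ∀ {p q}, Hex p q → Hex (f p) (f q)

theorem IsModelMap.comp {f g : ℤ × ℤ → ℤ × ℤ} (hf : IsModelMap f) (hg : IsModelMap g) :
    IsModelMap (f ∘ g) :=
  ⟨hf.inj.comp hg.inj, fun h => hf.hex (hg.hex h)⟩

/-- Two morphisms of the model which agree on a triangle `A B C` agree on the triangle `A B D` on
the other side of the edge `A B`. -/
theorem IsModelMap.eq_reflection {f g : ℤ × ℤ → ℤ × ℤ} (hf : IsModelMap f) (hg : IsModelMap g)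
    {A B C D : ℤ × ℤ} (hAB : Hex A B) (hAC : Hex A C) (hBC : Hex B C) (hDA : Hex A D)
    (hDB : Hex B D) (nAB : A ≠ B) (nAC : A ≠ C) (nBC : B ≠ C) (nDA : A ≠ D) (nDB : B ≠ D)
    (nDC : C ≠ D) (hA : f A = g A) (hB : f B = g B) (hC : f C = g C) : f D = g D := by
  refine eq_of_hex (hf.hex hAB) (hf.hex hAC) (hf.hex hBC) (hf.inj.ne nAB) (hf.inj.ne nAC)
    (hf.inj.ne nBC) (hf.hex hDA) (hf.hex hDB) (hf.inj.ne nDA) (hf.inj.ne nDB) (hf.inj.ne nDC)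
    ?_ ?_ ?_ ?_ ?_
  · rw [hA]; exact hg.hex hDA
  · rw [hB]; exact hg.hex hDB
  · rw [hA]; exact hg.inj.ne nDA
  · rw [hB]; exact hg.inj.ne nDB
  · rw [hC]; exact hg.inj.ne nDC

/-- A property of the vertices of the model which holds for a triangle and passes through edges
to the opposite vertex holds everywhere. -/
theorem model_induction (P : ℤ × ℤ → Prop)
    (step : ∀ A B C D, Hex A B → Hex A C → Hex B C → Hex A D → Hex B D → A ≠ B → A ≠ C → B ≠ C →
      A ≠ D → B ≠ D → C ≠ D → P A → P B → P C → P D)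
    {t : Finset (ℤ × ℤ)} (ht : t ∈ model) (hc : t.card = 3) (hP : ∀ p ∈ t, P p) (p : ℤ × ℤ) :
    P p := by
  have key : ∀ a b c d : ℤ × ℤ, P a → P b → P c →
      (Hex a b ∧ Hex a c ∧ Hex b c ∧ Hex a d ∧ Hex b d ∧ a ≠ b ∧ a ≠ c ∧ b ≠ c ∧
      a ≠ d ∧ b ≠ d ∧ c ≠ d) → P d := fun a b c d ha hb hc h =>
    step a b c d h.1 h.2.1 h.2.2.1 h.2.2.2.1 h.2.2.2.2.1 h.2.2.2.2.2.1 h.2.2.2.2.2.2.1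
      h.2.2.2.2.2.2.2.1 h.2.2.2.2.2.2.2.2.1 h.2.2.2.2.2.2.2.2.2.1 h.2.2.2.2.2.2.2.2.2.2 ha hb hc
  let Q : ℤ → ℤ → Prop := fun a b => P (a, b) ∧ P (a + 1, b) ∧ P (a, b + 1) ∧ P (a + 1, b + 1)
  have right : ∀ a b, Q a b → Q (a + 1) b := by
    rintro a b ⟨h0, h1, h2, h3⟩
    have h4 : P (a + 1 + 1, b) := key (a + 1, b) (a + 1, b + 1) (a, b + 1) _ h1 h3 h2
      (by simp only [Hex, ne_eq, Prod.mk.injEq]; omega)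
    have h5 : P (a + 1 + 1, b + 1) := key (a + 1 + 1, b) (a + 1, b + 1) (a + 1, b) _ h4 h3 h1
      (by simp only [Hex, ne_eq, Prod.mk.injEq]; omega)
    exact ⟨h1, h4, h3, h5⟩
  have up : ∀ a b, Q a b → Q a (b + 1) := by
    rintro a b ⟨h0, h1, h2, h3⟩
    have h4 : P (a, b + 1 + 1) := key (a, b + 1) (a + 1, b + 1) (a + 1, b) _ h2 h3 h1
      (by simp only [Hex, ne_eq, Prod.mk.injEq]; omega)
    have h5 : P (a + 1, b + 1 + 1) := key (a, b + 1 + 1) (a + 1, b + 1) (a, b + 1) _ h4 h3 h2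
      (by simp only [Hex, ne_eq, Prod.mk.injEq]; omega)
    exact ⟨h2, h3, h4, h5⟩
  have left : ∀ a b, Q a b → Q (a - 1) b := by
    rintro a b ⟨h0, h1, h2, h3⟩
    have h4 : P (a - 1, b + 1) := key (a, b) (a, b + 1) (a + 1, b) _ h0 h2 h1
      (by simp only [Hex, ne_eq, Prod.mk.injEq]; omega)
    have h5 : P (a - 1, b) := key (a, b) (a - 1, b + 1) (a, b + 1) _ h0 h4 h2
      (by simp only [Hex, ne_eq, Prod.mk.injEq]; omega)
    simpa only [Q, sub_add_cancel] using ⟨h5, h0, h4, h2⟩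
  have down : ∀ a b, Q a b → Q a (b - 1) := by
    rintro a b ⟨h0, h1, h2, h3⟩
    have h4 : P (a + 1, b - 1) := key (a, b) (a + 1, b) (a, b + 1) _ h0 h1 h2
      (by simp only [Hex, ne_eq, Prod.mk.injEq]; omega)
    have h5 : P (a, b - 1) := key (a, b) (a + 1, b - 1) (a + 1, b) _ h0 h4 h1
      (by simp only [Hex, ne_eq, Prod.mk.injEq]; omega)
    simpa only [Q, sub_add_cancel] using ⟨h5, h4, h0, h1⟩
  have start : ∃ a b, Q a b := by
    obtain ⟨-, ⟨a, b⟩, h | h⟩ := ht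
    · have h' := Finset.eq_of_subset_of_card_le h
        (by rw [hc]; exact Finset.card_le_three)
      rw [h'] at hP
      have h0 := hP (a, b) (by simp)
      have h1 := hP (a + 1, b) (by simp)
      have h2 := hP (a, b + 1) (by simp)
      exact ⟨a, b, h0, h1, h2, key (a + 1, b) (a, b + 1) (a, b) _ h1 h2 h0
        (by simp only [Hex, ne_eq, Prod.mk.injEq]; omega)⟩
    · have h' := Finset.eq_of_subset_of_card_le h
        (by rw [hc]; exact Finset.card_le_three)
      rw [h'] at hP
      have h1 := hP (a + 1, b) (by simp)
      have h2 := hP (a, b + 1) (by simp)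
      have h3 := hP (a + 1, b + 1) (by simp)
      exact ⟨a, b, key (a + 1, b) (a, b + 1) (a + 1, b + 1) _ h1 h2 h3
        (by simp only [Hex, ne_eq, Prod.mk.injEq]; omega), h1, h2, h3⟩
  obtain ⟨a₀, b₀, h⟩ := start
  have hrow : ∀ a, Q a b₀ := fun a =>
    Int.inductionOn' (motive := fun a => Q a b₀) a a₀ h (fun k _ ih => right _ _ ih)
      (fun k _ ih => left _ _ ih)
  have hall : ∀ b, Q p.1 b := fun b =>
    Int.inductionOn' (motive := fun b => Q p.1 b) b b₀ (hrow _) (fun k _ ih => up _ _ ih)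
      (fun k _ ih => down _ _ ih)
  exact (hall p.2).1

/-- Rigidity: a morphism of the model is determined by its values on a triangle. -/
theorem IsModelMap.eq_of_eqOn {f g : ℤ × ℤ → ℤ × ℤ} (hf : IsModelMap f) (hg : IsModelMap g)
    {t : Finset (ℤ × ℤ)} (ht : t ∈ model) (hc : t.card = 3) (h : ∀ p ∈ t, f p = g p) : f = g :=
  funext fun p => model_induction (fun p => f p = g p)
    (fun _ _ _ _ h1 h2 h3 h4 h5 h6 h7 h8 h9 h10 h11 hA hB hC =>
      hf.eq_reflection hg h1 h2 h3 h4 h5 h6 h7 h8 h9 h10 h11 hA hB hC) ht hc h p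

/-- The colour of a vertex of the model; the three vertices of a triangle have different colours. -/
def modelColor (p : ℤ × ℤ) : ZMod 3 := ((p.1 - p.2 : ℤ) : ZMod 3)

/-- Two colourings of the model for which adjacent vertices have different colours agree as soon as
they agree on a triangle. -/
theorem coloring_eq_of_eqOn {k k' : ℤ × ℤ → ZMod 3} (hk : ∀ p q, Hex p q → p ≠ q → k p ≠ k q)
    (hk' : ∀ p q, Hex p q → p ≠ q → k' p ≠ k' q) {t : Finset (ℤ × ℤ)} (ht : t ∈ model)
    (hc : t.card = 3) (h : ∀ p ∈ t, k p = k' p) (p : ℤ × ℤ) : k p = k' p := by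
  refine model_induction (fun p => k p = k' p) ?_ ht hc h p
  intro A B C D h1 h2 h3 h4 h5 h6 h7 h8 h9 h10 h11 hA hB hC
  have a1 := hk _ _ h1 h6
  have a2 := hk _ _ h4 h9
  have a3 := hk _ _ h5 h10
  have a5 := hk' _ _ h4 h9
  have a6 := hk' _ _ h5 h10
  rw [← hA] at a5
  rw [← hB] at a6
  generalize k A = x at *
  generalize k B = y at *
  generalize k D = z at *
  generalize k' D = w at *
  clear hA hB hC
  revert x y z w
  decide

theorem modelColor_eq_add_iff (p q : ℤ × ℤ) (k : ℤ) :
    modelColor q = modelColor p + k ↔ (3 : ℤ) ∣ (q.1 - q.2) - (p.1 - p.2 + k) := by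
  rw [modelColor, modelColor, ← Int.cast_add, eq_comm, ZMod.intCast_eq_intCast_iff_dvd_sub]
  rfl

theorem modelColor_ne {p q : ℤ × ℤ} (h : Hex p q) (hn : p ≠ q) : modelColor p ≠ modelColor q := by
  intro e
  have := (modelColor_eq_add_iff p q 0).1 (by simp [e])
  obtain ⟨p1, p2⟩ := p
  obtain ⟨q1, q2⟩ := q
  simp only [Hex, ne_eq, Prod.mk.injEq] at *
  omega

/-! ### Charts and retractions -/

variable {V : Type*} {X : AbstractSimplicialComplex V}

theorem exists_mem_of_map_subset {φ : Chart X} {p q r : ℤ × ℤ} (hpq : Hex p q) (hpr : Hex p r)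
    (hqr : Hex q r) : ∃ s ∈ X, φ.emb p ∈ s ∧ φ.emb q ∈ s ∧ φ.emb r ∈ s := by
  obtain ⟨s, hs, h1, h2, h3⟩ := exists_mem_model_of_hex hpq hpr hqr
  exact ⟨s.map φ.emb, φ.map_mem s hs, Finset.mem_map_of_mem _ h1, Finset.mem_map_of_mem _ h2,
    Finset.mem_map_of_mem _ h3⟩

theorem hex_refl (p : ℤ × ℤ) : Hex p p := by simp [Hex]

theorem Hex.symm {p q : ℤ × ℤ} (h : Hex p q) : Hex q p := by
  simp only [Hex] at *; omega

/-- The second building axiom: two charts differ by a morphism of the model on the intersection of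
their apartments. -/
theorem IsBuilding.exists_transition (hX : IsBuilding X) (φ ψ : Chart X) :
    ∃ α : ℤ × ℤ → ℤ × ℤ, IsModelMap α ∧ (∀ p q, Hex (α p) (α q) → Hex p q) ∧
      ∀ p q, φ.emb p = ψ.emb q → α p = q := by
  obtain ⟨α, hα, h⟩ := hX.exists_iso φ ψ
  refine ⟨α, ⟨α.injective, fun {p q} hpq => ?_⟩, fun p q hpq => ?_, fun p q hpq => ?_⟩
  · obtain ⟨s, hs, h1, h2, -⟩ := exists_mem_model_of_hex hpq hpq (hex_refl q)
    exact hex_of_mem_model ((hα s).2 hs) (Finset.mem_map_of_mem _ h1) (Finset.mem_map_of_mem _ h2)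
  · obtain ⟨s, hs, h1, h2, -⟩ := exists_mem_model_of_hex hpq hpq (hex_refl _)
    have hs' : s.map α.symm.toEmbedding ∈ model := by
      rw [← hα, Finset.map_map]
      convert hs
      ext x
      simp
    refine hex_of_mem_model hs' ?_ ?_
    · simpa using h1
    · simpa using h2
  · exact ψ.emb.injective ((h p q hpq).trans hpq)

/-- Apartments are full subcomplexes. -/
theorem IsBuilding.hex_of_mem (hX : IsBuilding X) (φ : Chart X) {p q : ℤ × ℤ} {s : Finset V}
    (hs : s ∈ X) (hp : φ.emb p ∈ s) (hq : φ.emb q ∈ s) : Hex p q := by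
  obtain ⟨ψ, ⟨t, ht, rfl⟩, -⟩ := hX.exists_apartment s hs s hs
  obtain ⟨α, -, hα, h⟩ := hX.exists_transition φ ψ
  obtain ⟨p', hp', ep⟩ := Finset.mem_map.1 hp
  obtain ⟨q', hq', eq⟩ := Finset.mem_map.1 hq
  apply hα
  rw [h p p' ep.symm, h q q' eq.symm]
  exact hex_of_mem_model ht hp' hq'

theorem IsBuilding.exists_chart (hX : IsBuilding X) {s t : Finset V} (hs : s ∈ X) (ht : t ∈ X) :
    ∃ φ : Chart X, (∀ x ∈ s, ∃ p, φ.emb p = x) ∧ ∀ x ∈ t, ∃ p, φ.emb p = x := by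
  obtain ⟨φ, ⟨a, -, rfl⟩, ⟨b, -, rfl⟩⟩ := hX.exists_apartment s hs t ht
  refine ⟨φ, fun x hx => ?_, fun x hx => ?_⟩ <;>
  · obtain ⟨p, -, h⟩ := Finset.mem_map.1 hx
    exact ⟨p, h⟩

/-- A triangle of `φ` whose vertices belong to the apartment of `ψ` is a triangle of `ψ`. -/
theorem IsBuilding.exists_triangle_preimage (hX : IsBuilding X) {φ ψ : Chart X}
    {t : Finset (ℤ × ℤ)} (ht : t ∈ model) (hc : t.card = 3)
    (h : ∀ c ∈ t, ∃ p, ψ.emb p = φ.emb c) :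
    ∃ t' ∈ model, t'.card = 3 ∧ ∀ p ∈ t', ∃ c ∈ t, ψ.emb p = φ.emb c := by
  choose! g hg using h
  have hcard : (t.image g).card = 3 := by
    rw [Finset.card_image_of_injOn, hc]
    intro a ha b hb hab
    apply φ.emb.injective
    rw [← hg a ha, ← hg b hb, hab]
  refine ⟨t.image g, mem_model_of_hex hcard fun p hp q hq => ?_, hcard, fun p hp => ?_⟩
  · obtain ⟨a, ha, rfl⟩ := Finset.mem_image.1 hp
    obtain ⟨b, hb, rfl⟩ := Finset.mem_image.1 hq
    refine hX.hex_of_mem ψ (φ.map_mem t ht) ?_ ?_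
    · rw [hg a ha]; exact Finset.mem_map_of_mem _ ha
    · rw [hg b hb]; exact Finset.mem_map_of_mem _ hb
  · obtain ⟨a, ha, rfl⟩ := Finset.mem_image.1 hp
    exact ⟨a, ha, hg a ha⟩

/-- Retraction of a building onto the apartment of a chart `φ`, centred at the triangle `t`. On
every apartment containing the triangle, it is a morphism of the model apartment. -/
theorem IsBuilding.exists_retraction (hX : IsBuilding X) (φ : Chart X) {t : Finset (ℤ × ℤ)}
    (ht : t ∈ model) (hc : t.card = 3) :
    ∃ ρ : V → ℤ × ℤ, ∀ ψ : Chart X, (∀ c ∈ t, ∃ p, ψ.emb p = φ.emb c) →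
      ∃ α, IsModelMap α ∧ (∀ p, ρ (ψ.emb p) = α p) ∧ ∀ p q, ψ.emb p = φ.emb q → α p = q := by
  have h1 : ∀ y : V, ∃ ψ : Chart X, (∀ c ∈ t, ∃ p, ψ.emb p = φ.emb c) ∧ ∃ p, ψ.emb p = y := by
    intro y
    obtain ⟨ψ, hψ, hy⟩ := hX.exists_chart (φ.map_mem t ht) (X.singleton_mem y)
    exact ⟨ψ, fun c hc => hψ _ (Finset.mem_map_of_mem _ hc), hy y (by simp)⟩
  choose ψ hψ r hr using h1
  choose α hα hα' h using fun y => hX.exists_transition (ψ y) φ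
  refine ⟨fun y => α y (r y), fun χ hχ => ?_⟩
  obtain ⟨β, hβ, -, hβ'⟩ := hX.exists_transition χ φ
  refine ⟨β, hβ, fun p => ?_, hβ'⟩
  obtain ⟨γ, hγ, -, hγ'⟩ := hX.exists_transition χ (ψ (χ.emb p))
  show α (χ.emb p) (r (χ.emb p)) = β p
  rw [← hγ' p _ (hr (χ.emb p)).symm]
  obtain ⟨t', ht', hc', h'⟩ := hX.exists_triangle_preimage ht hc hχ
  refine congrFun (IsModelMap.eq_of_eqOn ((hα (χ.emb p)).comp hγ) hβ ht' hc' fun c hc => ?_) p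
  obtain ⟨d, hd, hcd⟩ := h' c hc
  obtain ⟨p', hp'⟩ := hψ (χ.emb p) d hd
  simp only [Function.comp]
  rw [hβ' _ _ hcd, hγ' c p' (by rw [hcd, hp'])]
  exact h _ _ _ hp'

/-! ### Types of vertices and oriented edges -/

/-- A colouring of the vertices by types: the vertices of a simplex have different colours. -/
def IsColoring (X : AbstractSimplicialComplex V) (κ : V → ZMod 3) : Prop :=
  ∀ s ∈ X, ∀ x ∈ s, ∀ y ∈ s, x ≠ y → κ x ≠ κ y

theorem IsColoring.neg {κ : V → ZMod 3} (h : IsColoring X κ) : IsColoring X (-κ) :=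
  fun s hs x hx y hy hn e => h s hs x hx y hy hn (neg_injective e)

theorem hex_zero : Hex (0, 0) (1, 0) ∧ Hex (0, 0) (0, 1) ∧ Hex (1, 0) (0, 1) := by simp [Hex]

theorem base_mem_model : ({(0, 0), (1, 0), (0, 1)} : Finset (ℤ × ℤ)) ∈ model :=
  ⟨by simp, (0, 0), Or.inl (by simp)⟩

theorem IsBuilding.nonempty_chart (hX : IsBuilding X) : Nonempty (Chart X) := by
  obtain ⟨x⟩ := hX.nonempty
  obtain ⟨φ, -⟩ := hX.exists_chart (X.singleton_mem x) (X.singleton_mem x)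
  exact ⟨φ⟩

/-- The types are pulled back from the model by a retraction. -/
theorem IsBuilding.exists_coloring (hX : IsBuilding X) : ∃ κ, IsColoring X κ := by
  obtain ⟨φ⟩ := hX.nonempty_chart
  obtain ⟨ρ, hρ⟩ := hX.exists_retraction φ base_mem_model (by decide)
  refine ⟨fun x => modelColor (ρ x), fun s hs x hx y hy hn => ?_⟩
  obtain ⟨ψ, h1, h2⟩ := hX.exists_chart (φ.map_mem _ base_mem_model) hs
  obtain ⟨α, hα, hα', -⟩ := hρ ψ fun c hc => h1 _ (Finset.mem_map_of_mem _ hc)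
  obtain ⟨p, rfl⟩ := h2 x hx
  obtain ⟨q, rfl⟩ := h2 y hy
  simp only [hα']
  refine modelColor_ne (hα.hex (hX.hex_of_mem ψ hs hx hy)) (hα.inj.ne ?_)
  rintro rfl
  exact hn rfl

/-- The edges of `X`, oriented such that the type increases by one along an edge. The out-neighbours
and the in-neighbours of a vertex are the points and the lines of its link, a projective plane; the
point `p` lies on the line `L` if `Arrow X κ p L`. -/
def Arrow (X : AbstractSimplicialComplex V) (κ : V → ZMod 3) (x y : V) : Prop :=
  (∃ s ∈ X, x ∈ s ∧ y ∈ s) ∧ κ y = κ x + 1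

theorem arrow_neg {κ : V → ZMod 3} {x y : V} : Arrow X (-κ) x y ↔ Arrow X κ y x := by
  simp only [Arrow, Pi.neg_apply]
  refine and_congr ⟨fun ⟨s, hs, h1, h2⟩ => ⟨s, hs, h2, h1⟩, fun ⟨s, hs, h1, h2⟩ => ⟨s, hs, h2, h1⟩⟩
    ⟨fun h => by linear_combination h, fun h => by linear_combination h⟩

/-- The oriented edges of the model apartment. -/
def ModelArrow (p q : ℤ × ℤ) : Prop :=
  q.1 = p.1 + 1 ∧ q.2 = p.2 ∨ q.1 = p.1 - 1 ∧ q.2 = p.2 + 1 ∨ q.1 = p.1 ∧ q.2 = p.2 - 1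

theorem modelArrow_iff {p q : ℤ × ℤ} :
    ModelArrow p q ↔ Hex p q ∧ modelColor q = modelColor p + 1 := by
  have := modelColor_eq_add_iff p q 1
  rw [Int.cast_one] at this
  rw [this]
  simp only [ModelArrow, Hex]
  omega

/-- A chart which preserves types up to a constant; equivalently, it maps oriented edges to oriented
edges, see `Chart.IsOriented.arrow_iff`. -/
def Chart.IsOriented (φ : Chart X) (κ : V → ZMod 3) : Prop :=
  ∀ p, κ (φ.emb p) = κ (φ.emb (0, 0)) + modelColor p

theorem IsColoring.chart_ne {κ : V → ZMod 3} (hκ : IsColoring X κ) (φ : Chart X) (p q : ℤ × ℤ)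
    (h : Hex p q) (hn : p ≠ q) : κ (φ.emb p) ≠ κ (φ.emb q) := by
  obtain ⟨s, hs, h1, h2, -⟩ := exists_mem_of_map_subset (φ := φ) h h (hex_refl q)
  exact hκ s hs _ h1 _ h2 (φ.emb.injective.ne hn)

theorem IsColoring.isOriented {κ : V → ZMod 3} (hκ : IsColoring X κ) {φ : Chart X}
    (h : κ (φ.emb (1, 0)) = κ (φ.emb (0, 0)) + 1) : φ.IsOriented κ := by
  refine coloring_eq_of_eqOn (k := fun p => κ (φ.emb p)) (hκ.chart_ne φ) (fun p q hpq hn => ?_)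
    base_mem_model (by decide) fun p hp => ?_
  · simpa using modelColor_ne hpq hn
  · simp only [Finset.mem_insert, Finset.mem_singleton] at hp
    rcases hp with rfl | rfl | rfl
    · simp [modelColor]
    · simp [modelColor, h]
    · have h1 := hκ.chart_ne φ _ _ hex_zero.2.1 (by simp)
      have h2 := hκ.chart_ne φ _ _ hex_zero.2.2 (by simp)
      rw [h] at h2
      simp only [modelColor]
      generalize κ (φ.emb (0, 0)) = x at *
      generalize κ (φ.emb (0, 1)) = y at *
      clear h
      revert x y
      decide

theorem IsColoring.isOriented_or {κ : V → ZMod 3} (hκ : IsColoring X κ) (φ : Chart X) :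
    φ.IsOriented κ ∨ φ.IsOriented (-κ) := by
  by_cases h : κ (φ.emb (1, 0)) = κ (φ.emb (0, 0)) + 1
  · exact Or.inl (hκ.isOriented h)
  · refine Or.inr (hκ.neg.isOriented ?_)
    have h1 := hκ.chart_ne φ _ _ hex_zero.1 (by simp)
    simp only [Pi.neg_apply]
    generalize κ (φ.emb (0, 0)) = x at *
    generalize κ (φ.emb (1, 0)) = y at *
    revert x y
    decide

theorem Chart.IsOriented.swap {κ : V → ZMod 3} {φ : Chart X} (h : φ.IsOriented (-κ)) :
    φ.swap.IsOriented κ := by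
  intro p
  have h1 := h p.swap
  have h2 : modelColor p.swap = - modelColor p := by
    simp [modelColor]
  simp only [Pi.neg_apply, h2] at h1
  simp only [Chart.swap, Function.Embedding.trans_apply, Equiv.toEmbedding_apply,
    Equiv.prodComm_apply, Prod.swap_prod_mk]
  linear_combination -h1

theorem Chart.IsOriented.arrow_iff {κ : V → ZMod 3} {φ : Chart X} (hX : IsBuilding X)
    (h : φ.IsOriented κ) {p q : ℤ × ℤ} :
    Arrow X κ (φ.emb p) (φ.emb q) ↔ ModelArrow p q := by
  rw [modelArrow_iff, Arrow, h p, h q, add_assoc, add_right_inj]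
  refine and_congr_left' ⟨fun ⟨s, hs, h1, h2⟩ => hX.hex_of_mem φ hs h1 h2, fun h => ?_⟩
  obtain ⟨s, hs, h1, h2, -⟩ := exists_mem_of_map_subset (φ := φ) h h (hex_refl q)
  exact ⟨s, hs, h1, h2⟩

theorem exists_triangle {p q : ℤ × ℤ} (h : ModelArrow p q) :
    ∃ t ∈ model, t.card = 3 ∧ p ∈ t ∧ q ∈ t := by
  have h' : ∃ r, ModelArrow q r ∧ ModelArrow r p := by
    obtain ⟨a, b⟩ := p
    obtain ⟨c, d⟩ := q
    rcases h with h | h | h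
    · refine ⟨(c - 1, d + 1), ?_, ?_⟩ <;> simp only [ModelArrow, and_self, or_true, true_or] at h ⊢
      omega
    · refine ⟨(c, d - 1), ?_, ?_⟩ <;> simp only [ModelArrow, and_self, or_true] at h ⊢
      omega
    · refine ⟨(c + 1, d), ?_, ?_⟩ <;> simp only [ModelArrow, and_self, true_or] at h ⊢
      omega
  obtain ⟨r, h1, h2⟩ := h'
  obtain ⟨a, b⟩ := p
  obtain ⟨c, d⟩ := q
  obtain ⟨e, f⟩ := r
  have hc : ({(a, b), (c, d), (e, f)} : Finset (ℤ × ℤ)).card = 3 := by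
    rw [Finset.card_eq_three]
    refine ⟨_, _, _, ?_, ?_, ?_, rfl⟩ <;> simp only [ModelArrow, ne_eq, Prod.mk.injEq] at * <;>
      omega
  refine ⟨_, mem_model_of_hex hc ?_, hc, by simp, by simp⟩
  simp only [Finset.mem_insert, Finset.mem_singleton]
  simp only [ModelArrow] at *
  rintro x (rfl | rfl | rfl) y (rfl | rfl | rfl) <;> simp only [Hex] <;> omega

/-- The retraction onto the apartment of an oriented chart `φ`, centred at a triangle containing the
edge from `p` to `q`. It preserves oriented edges, and the vertices of the edge are their own only
preimages. -/
theorem IsColoring.exists_retraction {κ : V → ZMod 3} (hκ : IsColoring X κ) (hX : IsBuilding X)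
    {φ : Chart X} (hφ : φ.IsOriented κ) {p q : ℤ × ℤ} (hpq : ModelArrow p q) :
    ∃ ρ : V → ℤ × ℤ, (∀ r, ρ (φ.emb r) = r) ∧
      (∀ y z, Arrow X κ y z → ModelArrow (ρ y) (ρ z)) ∧
      (∀ z, ρ z = p → z = φ.emb p) ∧ ∀ z, ρ z = q → z = φ.emb q := by
  obtain ⟨t, ht, hc, hp, hq⟩ := exists_triangle hpq
  obtain ⟨ρ, hρ⟩ := hX.exists_retraction φ ht hc
  have hid : ∀ r, ρ (φ.emb r) = r := by
    obtain ⟨α, -, h1, h2⟩ := hρ φ fun c _ => ⟨c, rfl⟩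
    intro r
    rw [h1, h2 r r rfl]
  -- the retraction is injective on an apartment which contains both `z` and the triangle
  have hfix : ∀ c ∈ t, ∀ z, ρ z = c → z = φ.emb c := by
    intro c hct z hz
    obtain ⟨ψ, h1, h2⟩ := hX.exists_chart (φ.map_mem _ ht) (X.singleton_mem z)
    obtain ⟨α, hα, hα', h'⟩ := hρ ψ fun c hc => h1 _ (Finset.mem_map_of_mem _ hc)
    obtain ⟨a, ha⟩ := h2 z (by simp)
    obtain ⟨b, hb⟩ := h1 _ (Finset.mem_map_of_mem _ hct)
    rw [← ha, ← hb]
    refine congrArg _ (hα.inj ?_)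
    rw [← hα', ha, hz, h' b c hb]
  refine ⟨ρ, hid, fun y z ⟨⟨s, hs, hy, hz⟩, hyz⟩ => ?_, hfix p hp, hfix q hq⟩
  obtain ⟨ψ, h1, h2⟩ := hX.exists_chart (φ.map_mem _ ht) hs
  have h3 : ∀ c ∈ t, ∃ p, ψ.emb p = φ.emb c := fun c hc => h1 _ (Finset.mem_map_of_mem _ hc)
  obtain ⟨α, hα, hα', h'⟩ := hρ ψ h3
  obtain ⟨a, rfl⟩ := h2 y hy
  obtain ⟨b, rfl⟩ := h2 z hz
  obtain ⟨t', ht', hc', h4⟩ := hX.exists_triangle_preimage ht hc h3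
  -- the types of `X` and the types pulled back by `ρ` agree on the triangle, so everywhere
  have key := coloring_eq_of_eqOn (k := fun p => κ (ψ.emb p))
    (k' := fun p => κ (φ.emb (0, 0)) + modelColor (α p)) (hκ.chart_ne ψ)
    (fun p q hpq hn => by simpa using modelColor_ne (hα.hex hpq) (hα.inj.ne hn)) ht' hc'
    (fun p hp => by
      obtain ⟨c, hc, hpc⟩ := h4 p hp
      rw [hpc, hφ c, h' p c hpc])
  rw [hα', hα', modelArrow_iff]
  refine ⟨hα.hex (hX.hex_of_mem ψ hs hy hz), ?_⟩
  have ka := key a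
  have kb := key b
  rw [ka, kb] at hyz
  linear_combination hyz

/-! ### Directed distances -/

/-- There is a path of length `n` from `x` to `y` following the relation `A`. -/
inductive DirectedPath {W : Type*} (A : W → W → Prop) (x : W) : ℕ → W → Prop
  | refl : DirectedPath A x 0 x
  | step {n : ℕ} {y z : W} : DirectedPath A x n y → A y z → DirectedPath A x (n + 1) z

/-- The length of a shortest path from `x` to `y` following the relation `A`; it is zero if there is
no such path, which does not happen in a building. -/
noncomputable def directedDist {W : Type*} (A : W → W → Prop) (x y : W) : ℕ :=
  sInf {n | DirectedPath A x n y}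

theorem DirectedPath.directedDist_le {W : Type*} {A : W → W → Prop} {x y : W} {n : ℕ}
    (h : DirectedPath A x n y) : directedDist A x y ≤ n :=
  Nat.sInf_le h

theorem directedDist_self {W : Type*} (A : W → W → Prop) (x : W) : directedDist A x x = 0 :=
  Nat.le_zero.1 (DirectedPath.refl : DirectedPath A x 0 x).directedDist_le

theorem DirectedPath.map {W W' : Type*} {A : W → W → Prop} {B : W' → W' → Prop} {f : W → W'}
    (hf : ∀ x y, A x y → B (f x) (f y)) {x y : W} {n : ℕ} (h : DirectedPath A x n y) :
    DirectedPath B (f x) n (f y) := by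
  induction h with
  | refl => exact .refl
  | step _ h ih => exact .step ih (hf _ _ h)

/-- The directed distance in the model apartment. If `q - p = c₁ u₁ + c₂ u₂ + c₃ u₃` for the
three directions `u₁ = (1, 0)`, `u₂ = (-1, 1)`, `u₃ = (0, -1)` of oriented edges, with
nonnegative coefficients one of which vanishes, then it is `c₁ + c₂ + c₃`. -/
def modelDist (p q : ℤ × ℤ) : ℤ :=
  (q.1 - p.1) - (q.2 - p.2) + 3 * max (max (p.1 - q.1) 0) (q.2 - p.2)

/-- The value of `modelDist` without maxima, in a form suited to linear arithmetic. -/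
theorem modelDist_spec (p q : ℤ × ℤ) :
    (q.1 - p.1) - (q.2 - p.2) ≤ modelDist p q ∧
      3 * (p.1 - q.1) + (q.1 - p.1) - (q.2 - p.2) ≤ modelDist p q ∧
      3 * (q.2 - p.2) + (q.1 - p.1) - (q.2 - p.2) ≤ modelDist p q ∧
      (modelDist p q = (q.1 - p.1) - (q.2 - p.2) ∨
        modelDist p q = 3 * (p.1 - q.1) + (q.1 - p.1) - (q.2 - p.2) ∨
        modelDist p q = 3 * (q.2 - p.2) + (q.1 - p.1) - (q.2 - p.2)) := by
  simp only [modelDist]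
  rcases max_choice (p.1 - q.1) 0 with h | h <;> rw [h] <;> omega

theorem modelDist_nonneg (p q : ℤ × ℤ) : 0 ≤ modelDist p q := by
  have := modelDist_spec p q
  omega

theorem eq_of_modelDist_eq_zero {p q : ℤ × ℤ} (h : modelDist p q = 0) : p = q := by
  have := modelDist_spec p q
  obtain ⟨a, b⟩ := p
  obtain ⟨c, d⟩ := q
  simp only [Prod.mk.injEq] at *
  omega

theorem modelDist_step {p q r : ℤ × ℤ} (h : ModelArrow q r) :
    modelDist p r = modelDist p q + 1 ∨ modelDist p q = modelDist p r + 2 := by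
  have := modelDist_spec p q
  have := modelDist_spec p r
  rcases h with h | h | h <;> omega

theorem exists_pred_of_modelDist_pos {p q : ℤ × ℤ} (h : 0 < modelDist p q) :
    ∃ r, ModelArrow r q ∧ modelDist p q = modelDist p r + 1 := by
  obtain ⟨a, b⟩ := p
  obtain ⟨c, d⟩ := q
  have h0 := modelDist_spec (a, b) (c, d)
  by_cases h1 : a < c ∧ d ≤ b
  · have h2 := modelDist_spec (a, b) (c - 1, d)
    refine ⟨(c - 1, d), Or.inl ⟨by ring, rfl⟩, ?_⟩
    simp only at *
    omega
  by_cases h1' : a ≤ c ∧ d < b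
  · have h2 := modelDist_spec (a, b) (c, d + 1)
    refine ⟨(c, d + 1), Or.inr (Or.inr ⟨rfl, by ring⟩), ?_⟩
    simp only at *
    omega
  · have h2 := modelDist_spec (a, b) (c + 1, d - 1)
    refine ⟨(c + 1, d - 1), Or.inr (Or.inl ⟨by ring, by ring⟩), ?_⟩
    simp only at *
    omega

theorem directedPath_model {p : ℤ × ℤ} (n : ℕ) :
    ∀ q, modelDist p q = n → DirectedPath ModelArrow p n q := by
  induction n with
  | zero =>
    intro q h
    obtain rfl := eq_of_modelDist_eq_zero h
    exact .refl
  | succ n ih =>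
    intro q h
    obtain ⟨r, hr, h'⟩ := exists_pred_of_modelDist_pos (p := p) (q := q) (by omega)
    exact .step (ih r (by omega)) hr

theorem DirectedPath.modelDist_le {p q : ℤ × ℤ} {n : ℕ} (h : DirectedPath ModelArrow p n q) :
    modelDist p q ≤ n := by
  induction h with
  | refl => simp [modelDist]
  | step _ h ih =>
    have := modelDist_step (p := p) h
    push_cast
    omega

section
variable {p q r r' : ℤ × ℤ}

theorem modelArrow_near_unique (h : ModelArrow q r) (h' : ModelArrow q r')
    (hr : modelDist p r ≤ modelDist p q - 2) (hr' : modelDist p r' ≤ modelDist p q - 2) :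
    r = r' := by
  have h0 := modelDist_spec p q
  have h1 := modelDist_spec p r
  have h2 := modelDist_spec p r'
  apply Prod.ext <;> rcases h with h | h | h <;> rcases h' with h' | h' | h' <;> omega

theorem modelArrow_near_incident (h : ModelArrow r q) (h' : ModelArrow q r')
    (hr : modelDist p q = modelDist p r + 1) (hr' : modelDist p r' ≤ modelDist p q - 2) :
    ModelArrow r' r := by
  have h0 := modelDist_spec p q
  have h1 := modelDist_spec p r
  have h2 := modelDist_spec p r'
  rcases h with h | h | h <;> rcases h' with h' | h' | h' <;>
    first
    | (exfalso; omega)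
    | exact Or.inl (by omega)
    | exact Or.inr (Or.inl (by omega))
    | exact Or.inr (Or.inr (by omega))

theorem modelArrow_third (h : ModelArrow q r) (h' : ModelArrow q r') (hn : r ≠ r') :
    ModelArrow (r.1 + r'.1 - q.1, r.2 + r'.2 - q.2) q ∧
      ModelArrow r (r.1 + r'.1 - q.1, r.2 + r'.2 - q.2) ∧
      ModelArrow r' (r.1 + r'.1 - q.1, r.2 + r'.2 - q.2) := by
  rw [ne_eq, Prod.ext_iff] at hn
  simp only [ModelArrow]
  rcases h with h | h | h <;> rcases h' with h' | h' | h' <;> refine ⟨?_, ?_, ?_⟩ <;> omega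

theorem modelArrow_third' (h : ModelArrow r q) (h' : ModelArrow r' q) (hn : r ≠ r') :
    ModelArrow q (r.1 + r'.1 - q.1, r.2 + r'.2 - q.2) ∧
      ModelArrow (r.1 + r'.1 - q.1, r.2 + r'.2 - q.2) r ∧
      ModelArrow (r.1 + r'.1 - q.1, r.2 + r'.2 - q.2) r' := by
  rw [ne_eq, Prod.ext_iff] at hn
  simp only [ModelArrow]
  rcases h with h | h | h <;> rcases h' with h' | h' | h' <;> refine ⟨?_, ?_, ?_⟩ <;> omega

theorem modelArrow_exists_near (h : ModelArrow r q) (h' : ModelArrow r' q) (hn : r ≠ r')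
    (hr : modelDist p r ≤ modelDist p q - 1) (hr' : modelDist p r' ≤ modelDist p q - 1) :
    ∃ s, ModelArrow q s ∧ modelDist p q = modelDist p s + 2 := by
  have hs := (modelArrow_third' h h' hn).1
  refine ⟨_, hs, (modelDist_step hs).resolve_left fun hd => ?_⟩
  obtain ⟨a0, b0, c0, h0⟩ := modelDist_spec p q
  obtain ⟨a1, b1, c1, -⟩ := modelDist_spec p r
  obtain ⟨a2, b2, c2, -⟩ := modelDist_spec p r'
  obtain ⟨a3, b3, c3, h3⟩ := modelDist_spec p (r.1 + r'.1 - q.1, r.2 + r'.2 - q.2)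
  rw [ne_eq, Prod.ext_iff] at hn
  clear hs
  simp only at *
  rcases h with h | h | h <;> rcases h' with h' | h' | h' <;> rcases h0 with h0 | h0 | h0 <;>
    rcases h3 with h3 | h3 | h3 <;> omega

theorem modelArrow_join_unique {s s' : ℤ × ℤ} (h : ModelArrow q r) (h' : ModelArrow q r')
    (hn : r ≠ r') (h1 : ModelArrow s q) (h2 : ModelArrow r s) (h3 : ModelArrow r' s)
    (h1' : ModelArrow s' q) (h2' : ModelArrow r s') (h3' : ModelArrow r' s') : s = s' := by
  have key : ∀ s : ℤ × ℤ, ModelArrow s q → ModelArrow r s → ModelArrow r' s →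
      s.1 = r.1 + r'.1 - q.1 ∧ s.2 = r.2 + r'.2 - q.2 := by
    intro s h1 h2 h3
    rw [ne_eq, Prod.ext_iff] at hn
    rcases h with h | h | h <;> rcases h' with h' | h' | h' <;> rcases h1 with h1 | h1 | h1 <;>
      simp only [ModelArrow] at h2 h3 <;> omega
  have a := key s h1 h2 h3
  have b := key s' h1' h2' h3'
  apply Prod.ext <;> omega

end

/-! ### The local geometry of oriented edges -/

/-- The properties of the oriented edges of a thick building of type `Ã₂` on which the argument
rests: the links of vertices are thick projective planes, with the out-neighbours of `x` as points
and the in-neighbours of `x` as lines, and the directed distance from a vertex `x`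
changes along the edges at `y` in the same way as in an apartment. A point `z` of the link of `y` is
*near* if `d x y = d x z + 2`, and a line `L` is near if `d x y = d x L + 1`. -/
structure ArrowGeometry (A : V → V → Prop) : Prop where
  join : ∀ {x p q}, A x p → A x q → p ≠ q → ∃ L, A L x ∧ A p L ∧ A q L
  meet : ∀ {x L M}, A L x → A M x → L ≠ M → ∃ p, A x p ∧ A p L ∧ A p M
  join_unique : ∀ {x p q L M}, A x p → A x q → p ≠ q → A L x → A p L → A q L → A M x → A p M →
    A q M → L = M
  thick : ∀ {x y}, A x y → ∀ z₁ z₂, ∃ z, A y z ∧ A z x ∧ z ≠ z₁ ∧ z ≠ z₂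
  connected : ∀ x y, ∃ n, DirectedPath A x n y
  step : ∀ x {y z}, A y z →
    directedDist A x z = directedDist A x y + 1 ∨ directedDist A x y = directedDist A x z + 2
  near_incident : ∀ {x y z L}, A y z → A L y → directedDist A x y = directedDist A x z + 2 →
    directedDist A x y = directedDist A x L + 1 → A z L
  near_line_unique : ∀ {x y L M}, (∀ z, A y z → directedDist A x y ≠ directedDist A x z + 2) →
    A L y → A M y → directedDist A x y = directedDist A x L + 1 →
    directedDist A x y = directedDist A x M + 1 → L = M

section
variable {κ : V → ZMod 3}

theorem IsColoring.exists_chart (hκ : IsColoring X κ) (hX : IsBuilding X) {s t : Finset V}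
    (hs : s ∈ X) (ht : t ∈ X) : ∃ φ : Chart X, φ.IsOriented κ ∧ (∀ x ∈ s, ∃ p, φ.emb p = x) ∧
      ∀ x ∈ t, ∃ p, φ.emb p = x := by
  obtain ⟨φ, h1, h2⟩ := hX.exists_chart hs ht
  rcases hκ.isOriented_or φ with h | h
  · exact ⟨φ, h, h1, h2⟩
  · refine ⟨φ.swap, h.swap, fun x hx => ?_, fun x hx => ?_⟩
    · obtain ⟨p, hp⟩ := h1 x hx
      exact ⟨p.swap, by simpa [Chart.swap] using hp⟩
    · obtain ⟨p, hp⟩ := h2 x hx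
      exact ⟨p.swap, by simpa [Chart.swap] using hp⟩

theorem IsColoring.exists_chart_of_arrow (hκ : IsColoring X κ) (hX : IsBuilding X) (x : V) {y z : V}
    (h : Arrow X κ y z) : ∃ φ : Chart X, φ.IsOriented κ ∧ ∃ p q r, ModelArrow q r ∧
      φ.emb p = x ∧ φ.emb q = y ∧ φ.emb r = z := by
  obtain ⟨s, hs, hy, hz⟩ := h.1
  obtain ⟨φ, hφ, h1, h2⟩ := hκ.exists_chart hX (X.singleton_mem x) hs
  obtain ⟨p, rfl⟩ := h1 x (by simp)
  obtain ⟨q, rfl⟩ := h2 y hy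
  obtain ⟨r, rfl⟩ := h2 z hz
  exact ⟨φ, hφ, p, q, r, (hφ.arrow_iff hX).1 h, rfl, rfl, rfl⟩

theorem IsColoring.exists_directedPath (hκ : IsColoring X κ) (hX : IsBuilding X) (x y : V) :
    ∃ n, DirectedPath (Arrow X κ) x n y := by
  obtain ⟨φ, hφ, h1, h2⟩ := hκ.exists_chart hX (X.singleton_mem x) (X.singleton_mem y)
  obtain ⟨p, rfl⟩ := h1 x (by simp)
  obtain ⟨q, rfl⟩ := h2 y (by simp)
  refine ⟨(modelDist p q).toNat, DirectedPath.map (f := φ.emb)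
    (fun _ _ h => (hφ.arrow_iff hX).2 h) (directedPath_model _ q ?_)⟩
  have := modelDist_nonneg p q
  omega

theorem IsColoring.modelDist_le (hκ : IsColoring X κ) (hX : IsBuilding X) {ρ : V → ℤ × ℤ}
    (hρ : ∀ y z, Arrow X κ y z → ModelArrow (ρ y) (ρ z)) (x y : V) :
    modelDist (ρ x) (ρ y) ≤ directedDist (Arrow X κ) x y := by
  have h : DirectedPath (Arrow X κ) x (directedDist (Arrow X κ) x y) y :=
    Nat.sInf_mem (hκ.exists_directedPath hX x y)
  exact (h.map hρ).modelDist_le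

/-- Apartments are isometrically embedded for the directed distance. -/
theorem Chart.IsOriented.directedDist_eq {φ : Chart X} (hφ : φ.IsOriented κ)
    (hκ : IsColoring X κ) (hX : IsBuilding X) (p q : ℤ × ℤ) :
    (directedDist (Arrow X κ) (φ.emb p) (φ.emb q) : ℤ) = modelDist p q := by
  apply le_antisymm
  · have h0 := modelDist_nonneg p q
    have := (DirectedPath.map (f := φ.emb) (fun _ _ h => (hφ.arrow_iff hX).2 h)
      (directedPath_model (p := p) (modelDist p q).toNat q (by omega))).directedDist_le
    omega
  · obtain ⟨ρ, h1, h2, -⟩ := hκ.exists_retraction hX hφ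
      (show ModelArrow (0, 0) (1, 0) from Or.inl (by simp))
    have := hκ.modelDist_le hX h2 (φ.emb p) (φ.emb q)
    rwa [h1, h1] at this

theorem IsColoring.exists_triangle (hκ : IsColoring X κ) (hX : IsBuilding X) {x y z : V}
    (h1 : Arrow X κ x y) (h2 : Arrow X κ y z) (h3 : Arrow X κ z x) :
    ∃ s ∈ X, x ∈ s ∧ y ∈ s ∧ z ∈ s := by
  obtain ⟨φ, hφ, p, q, r, -, rfl, rfl, rfl⟩ := hκ.exists_chart_of_arrow hX x h2
  rw [hφ.arrow_iff hX, modelArrow_iff] at h1 h2 h3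
  exact exists_mem_of_map_subset h1.1 h3.1.symm h2.1

theorem IsColoring.arrow_thick (hκ : IsColoring X κ) (hT : IsThick X) {x y : V}
    (h : Arrow X κ x y) (z₁ z₂ : V) : ∃ z, Arrow X κ y z ∧ Arrow X κ z x ∧ z ≠ z₁ ∧ z ≠ z₂ := by
  classical
  have hxy : x ≠ y := by
    rintro rfl
    have := h.2
    simp at this
  obtain ⟨⟨s, hs, hx, hy⟩, hc⟩ := h
  have he : ({x, y} : Finset V) ∈ X :=
    (X.isRelLowerSet_faces hs).2 (by simp [Finset.insert_subset_iff, hx, hy]) (by simp)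
  have h2 := hT _ he (Finset.card_pair hxy)
  by_contra! hcon
  refine absurd h2 (not_lt.2 ?_)
  refine (Set.encard_le_encard (t := {insert z₁ {x, y}, insert z₂ {x, y}}) ?_).trans
    ((Set.encard_insert_le _ _).trans (by rw [Set.encard_singleton]; norm_num))
  rintro c ⟨hcX, hc3, hec⟩
  obtain ⟨z, hz⟩ : ∃ z, insert z {x, y} = c ∧ z ∉ ({x, y} : Finset V) := by
    have : (c \ {x, y}).card = 1 := by
      rw [Finset.card_sdiff_of_subset hec, hc3, Finset.card_pair hxy]
    obtain ⟨z, hz⟩ := Finset.card_eq_one.1 this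
    have hz' : z ∈ c \ {x, y} := by rw [hz]; simp
    refine ⟨z, Finset.eq_of_subset_of_card_le ?_ ?_, (Finset.mem_sdiff.1 hz').2⟩
    · exact Finset.insert_subset (Finset.mem_sdiff.1 hz').1 hec
    · rw [hc3, Finset.card_insert_of_notMem (Finset.mem_sdiff.1 hz').2, Finset.card_pair hxy]
  obtain ⟨rfl, hz⟩ := hz
  simp only [Finset.mem_insert, Finset.mem_singleton, not_or] at hz
  have k1 := hκ _ hcX x (by simp) z (by simp) (Ne.symm hz.1)
  have k2 := hκ _ hcX y (by simp) z (by simp) (Ne.symm hz.2)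
  have hk : κ z = κ y + 1 ∧ κ x = κ z + 1 := by
    rw [hc] at k2 ⊢
    generalize κ x = a at *
    generalize κ z = b at *
    clear hc
    revert a b
    decide
  have := hcon z ⟨⟨_, hcX, by simp, by simp⟩, hk.1⟩ ⟨⟨_, hcX, by simp, by simp⟩, hk.2⟩
  by_cases hz1 : z = z₁
  · simp [hz1]
  · simp [this hz1]

theorem IsColoring.near_point_unique (hκ : IsColoring X κ) (hX : IsBuilding X) {x y z z' : V}
    (h : Arrow X κ y z) (h' : Arrow X κ y z')
    (hz : directedDist (Arrow X κ) x y = directedDist (Arrow X κ) x z + 2)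
    (hz' : directedDist (Arrow X κ) x y = directedDist (Arrow X κ) x z' + 2) : z = z' := by
  obtain ⟨φ, hφ, p, q, r, hqr, rfl, rfl, rfl⟩ := hκ.exists_chart_of_arrow hX x h
  obtain ⟨ρ, hid, hρ, -, hr⟩ := hκ.exists_retraction hX hφ hqr
  have h1 := hφ.directedDist_eq hκ hX p q
  have h2 := hφ.directedDist_eq hκ hX p r
  have h3 := hκ.modelDist_le hX hρ (φ.emb p) z'
  have h4 := hρ _ _ h'
  rw [hid] at h3 h4
  exact (hr z' (modelArrow_near_unique (p := p) h4 hqr (by omega) (by omega))).symm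

theorem IsColoring.arrowGeometry (hκ : IsColoring X κ) (hX : IsBuilding X) (hT : IsThick X) :
    ArrowGeometry (Arrow X κ) where
  join := by
    intro x p q hp hq hn
    obtain ⟨s, hs, hxs, hps⟩ := hp.1
    obtain ⟨t, ht, hxt, hqt⟩ := hq.1
    obtain ⟨φ, hφ, h1, h2⟩ := hκ.exists_chart hX hs ht
    obtain ⟨x, rfl⟩ := h1 x hxs
    obtain ⟨p, rfl⟩ := h1 p hps
    obtain ⟨q, rfl⟩ := h2 q hqt
    rw [hφ.arrow_iff hX] at hp hq
    have := modelArrow_third hp hq fun h => hn (by rw [h])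
    exact ⟨φ.emb _, (hφ.arrow_iff hX).2 this.1, (hφ.arrow_iff hX).2 this.2.1,
      (hφ.arrow_iff hX).2 this.2.2⟩
  meet := by
    intro x p q hp hq hn
    obtain ⟨s, hs, hps, hxs⟩ := hp.1
    obtain ⟨t, ht, hqt, hxt⟩ := hq.1
    obtain ⟨φ, hφ, h1, h2⟩ := hκ.exists_chart hX hs ht
    obtain ⟨x, rfl⟩ := h1 x hxs
    obtain ⟨p, rfl⟩ := h1 p hps
    obtain ⟨q, rfl⟩ := h2 q hqt
    rw [hφ.arrow_iff hX] at hp hq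
    have := modelArrow_third' hp hq fun h => hn (by rw [h])
    exact ⟨φ.emb _, (hφ.arrow_iff hX).2 this.1, (hφ.arrow_iff hX).2 this.2.1,
      (hφ.arrow_iff hX).2 this.2.2⟩
  join_unique := by
    intro x p q L M hp hq hn hL hpL hqL hM hpM hqM
    obtain ⟨s, hs, hxs, hps, hLs⟩ := hκ.exists_triangle hX hp hpL hL
    obtain ⟨t, ht, hxt, hqt, hMt⟩ := hκ.exists_triangle hX hq hqM hM
    obtain ⟨φ, hφ, h1, h2⟩ := hκ.exists_chart hX hs ht
    obtain ⟨x, rfl⟩ := h1 x hxs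
    obtain ⟨p, rfl⟩ := h1 p hps
    obtain ⟨q, rfl⟩ := h2 q hqt
    obtain ⟨L, rfl⟩ := h1 L hLs
    obtain ⟨M, rfl⟩ := h2 M hMt
    rw [hφ.arrow_iff hX] at *
    exact congrArg _ (modelArrow_join_unique hp hq (fun h => hn (by rw [h])) hL hpL hqL hM hpM hqM)
  thick := fun h z₁ z₂ => hκ.arrow_thick hT h z₁ z₂
  connected := hκ.exists_directedPath hX
  step := by
    intro x y z h
    obtain ⟨φ, hφ, p, q, r, hqr, rfl, rfl, rfl⟩ := hκ.exists_chart_of_arrow hX x h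
    have h1 := hφ.directedDist_eq hκ hX p q
    have h2 := hφ.directedDist_eq hκ hX p r
    have h3 := modelDist_step (p := p) hqr
    omega
  near_incident := by
    intro x y z L hz hL hz' hL'
    obtain ⟨φ, hφ, p, l, q, hlq, rfl, rfl, rfl⟩ := hκ.exists_chart_of_arrow hX x hL
    obtain ⟨ρ, hid, hρ, -⟩ := hκ.exists_retraction hX hφ hlq
    have h1 := hφ.directedDist_eq hκ hX p q
    have h2 := hφ.directedDist_eq hκ hX p l
    have h3 := hκ.modelDist_le hX hρ (φ.emb p) z
    have h4 := hρ _ _ hz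
    rw [hid] at h3 h4
    -- the image `ρ z` is also near to `x`, so it is `z`, which therefore belongs to the apartment
    have h5 := hφ.directedDist_eq hκ hX p (ρ z)
    have h6 := modelDist_step (p := p) h4
    rw [hκ.near_point_unique hX hz ((hφ.arrow_iff hX).2 h4) hz' (by omega)]
    exact (hφ.arrow_iff hX).2 (modelArrow_near_incident (p := p) hlq h4 (by omega) (by omega))
  near_line_unique := by
    intro x y L M hfar hL hM hL' hM'
    obtain ⟨φ, hφ, p, l, q, hlq, rfl, rfl, rfl⟩ := hκ.exists_chart_of_arrow hX x hL
    obtain ⟨ρ, hid, hρ, hl, -⟩ := hκ.exists_retraction hX hφ hlq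
    have h1 := hφ.directedDist_eq hκ hX p q
    have h2 := hφ.directedDist_eq hκ hX p l
    have h3 := hκ.modelDist_le hX hρ (φ.emb p) M
    have h4 := hρ _ _ hM
    rw [hid] at h3 h4
    by_contra hn
    -- the images of two different near lines would meet in a near point
    obtain ⟨s, hs, hs'⟩ := modelArrow_exists_near (p := p) hlq h4
      (fun e => hn (hl _ e.symm).symm) (by omega) (by omega)
    refine hfar (φ.emb s) ((hφ.arrow_iff hX).2 hs) ?_
    have h5 := hφ.directedDist_eq hκ hX p s
    omega

end

/-! ### Straight lines, strips and flats -/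

section
variable {A : V → V → Prop}

/-- A sequence of vertices following the oriented edges such that the predecessor and the successor
of each vertex are opposite in its link. -/
structure StraightLine (A : V → V → Prop) (l : ℤ → V) : Prop where
  arrow : ∀ n, A (l n) (l (n + 1))
  straight : ∀ n, ¬ A (l (n + 2)) (l n)

theorem StraightLine.shift {l : ℤ → V} (hl : StraightLine A l) (k : ℤ) :
    StraightLine A fun n => l (n + k) := by
  refine ⟨fun n => ?_, fun n => ?_⟩
  · have := hl.arrow (n + k)
    rwa [add_right_comm] at this
  · have := hl.straight (n + k)
    rwa [add_right_comm] at this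

/-- A straight line which moves away from `x` by one step continues to do so. -/
theorem ArrowGeometry.far_of_near (hA : ArrowGeometry A) {x L y z : V} (hL : A L y) (hz : A y z)
    (hn : ¬ A z L) (h : directedDist A x y = directedDist A x L + 1) :
    directedDist A x z = directedDist A x y + 1 :=
  (hA.step x hz).resolve_right fun h' => hn (hA.near_incident hz hL h' h)

theorem ArrowGeometry.dist_of_increasing (hA : ArrowGeometry A) {l : ℤ → V}
    (hl : StraightLine A l) {x : V} (h : directedDist A x (l 1) = directedDist A x (l 0) + 1)
    (n : ℕ) : directedDist A x (l n) = directedDist A x (l 0) + n := by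
  have key : ∀ n : ℕ, directedDist A x (l (n + 1)) = directedDist A x (l n) + 1 := by
    intro n
    induction n with
    | zero => simpa using h
    | succ n ih =>
      push_cast
      exact hA.far_of_near (hl.arrow n) (hl.arrow (n + 1))
        (by have := hl.straight n; rwa [show (n : ℤ) + 1 + 1 = n + 2 by ring]) ih
  induction n with
  | zero => simp
  | succ n ih => push_cast; rw [key, ih, add_assoc]

/-- Along a straight line issuing from `x`, the distance to `x` grows by one in each step and no
vertex has a near point: a near point at `l (n + 2)` would be a near line at `l (n + 1)`, so it
would be equal to `l n`, which is excluded by straightness. -/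
theorem ArrowGeometry.dist_of_straight (hA : ArrowGeometry A) {l : ℤ → V}
    (hl : StraightLine A l) (n : ℕ) :
    directedDist A (l 0) (l n) = n ∧
      ∀ z, A (l n) z → directedDist A (l 0) (l n) ≠ directedDist A (l 0) z + 2 := by
  have h0 : directedDist A (l 0) (l 0) = 0 := directedDist_self A _
  have h1 : directedDist A (l 0) (l 1) = directedDist A (l 0) (l 0) + 1 := by
    have := hA.step (l 0) (hl.arrow 0)
    rw [zero_add] at this
    omega
  have hd : ∀ n : ℕ, directedDist A (l 0) (l n) = n := fun n => by
    rw [hA.dist_of_increasing hl h1, h0, zero_add]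
  refine ⟨hd n, ?_⟩
  induction n with
  | zero => intro z _; simp [h0]
  | succ n ih =>
    intro z hz h
    have hs := hl.arrow n
    push_cast at hz h
    have hn := hd n
    have hn1 : directedDist A (l 0) (l (n + 1)) = n + 1 := by exact_mod_cast hd (n + 1)
    have hz' := hA.near_incident hz hs h (by omega)
    obtain _ | n := n
    · omega
    · have e := hA.near_line_unique ih hz' (hl.arrow n) (by omega) (by
        have := hd n
        push_cast at *
        omega)
      rw [e] at hz
      refine hl.straight n ?_
      push_cast at hz
      rwa [show (n : ℤ) + 1 + 1 = n + 2 by ring] at hz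

/-- A map from the vertices of the model which preserves the oriented edges, and for which opposite
neighbours of a vertex are mapped to opposite vertices of the link. -/
structure Flat (A : V → V → Prop) (f : ℤ × ℤ → V) : Prop where
  arrow : ∀ {p q}, ModelArrow p q → A (f p) (f q)
  straight : ∀ {p q r}, ModelArrow p q → ModelArrow q r → p + r = q + q → ¬ A (f r) (f p)

theorem Flat.straightLine {f : ℤ × ℤ → V} (hf : Flat A f) (p u : ℤ × ℤ)
    (hu : ModelArrow (0, 0) u) : StraightLine A fun n => f (p.1 + n * u.1, p.2 + n * u.2) := by
  have h : ∀ n : ℤ, ModelArrow (p.1 + n * u.1, p.2 + n * u.2)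
      (p.1 + (n + 1) * u.1, p.2 + (n + 1) * u.2) := by
    intro n
    simp only [add_mul, one_mul]
    simp only [ModelArrow] at *
    omega
  refine ⟨fun n => hf.arrow (h n), fun n => hf.straight (h n) ?_ ?_⟩
  · have := h (n + 1)
    rwa [add_assoc] at this
  · simp only [Prod.mk_add_mk, Prod.mk.injEq]
    constructor <;> ring

/-- In a flat, a path which makes a single turn, between two of the directions of oriented edges, is
a shortest path: there is no near point at the turn. -/
theorem ArrowGeometry.dist_flat (hA : ArrowGeometry A) {f : ℤ × ℤ → V} (hf : Flat A f)
    (p : ℤ × ℤ) {u v : ℤ × ℤ} (hu : ModelArrow (0, 0) u) (hv : ModelArrow (0, 0) v) (a b : ℕ) :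
    directedDist A (f p) (f (p.1 + b * v.1 + a * u.1, p.2 + b * v.2 + a * u.2)) = b + a := by
  have h1 := hA.dist_of_straight (hf.straightLine p v hv) b
  have hl := hf.straightLine (p.1 + b * v.1, p.2 + b * v.2) u hu
  have h2 := hA.step (f p) (hl.arrow 0)
  have h3 := hA.dist_of_increasing hl (x := f p)
  have h4 := h1.2 _ (by simpa using hl.arrow 0)
  have h5 := h1.1
  simp only [zero_mul, add_zero, zero_add, one_mul, Prod.mk.eta] at h1 h2 h3 h4 h5
  rw [h3 (h2.resolve_right h4) a, h5]

/-- Flats are injective: it suffices to verify locally that a map is an apartment. -/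
theorem ArrowGeometry.flat_injective (hA : ArrowGeometry A) {f : ℤ × ℤ → V} (hf : Flat A f) :
    Function.Injective f := by
  intro p q h
  -- every vertex of the model is reached from `p` by a directed path with at most one turn
  have key : ∀ (a b : ℕ) (u v : ℤ × ℤ), ModelArrow (0, 0) u → ModelArrow (0, 0) v →
      (p.1 + b * v.1 + a * u.1, p.2 + b * v.2 + a * u.2) = q → p = q := by
    intro a b u v hu hv e
    have := hA.dist_flat hf p hu hv a b
    rw [e, ← h, directedDist_self] at this
    obtain rfl : a = 0 := by omega
    obtain rfl : b = 0 := by omega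
    simpa using e
  obtain ⟨a, b⟩ := p
  obtain ⟨c, d⟩ := q
  have h1 : ModelArrow (0, 0) (1, 0) := Or.inl (by simp)
  have h2 : ModelArrow (0, 0) (-1, 1) := Or.inr (Or.inl (by simp))
  have h3 : ModelArrow (0, 0) (0, -1) := Or.inr (Or.inr (by simp))
  by_cases c1 : a ≤ c ∧ d ≤ b
  · refine key (c - a).toNat (b - d).toNat _ _ h1 h3 ?_
    simp only [Prod.mk.injEq]
    omega
  by_cases c2 : a - c ≤ d - b ∧ 0 ≤ d - b
  · refine key (c - a + (d - b)).toNat (d - b).toNat _ _ h1 h2 ?_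
    simp only [Prod.mk.injEq]
    omega
  · refine key (a - c).toNat (a - c - (d - b)).toNat _ _ h2 h3 ?_
    simp only [Prod.mk.injEq]
    omega

/-- The strip between the parallel lines `l` and `m`: the triangles `l n, l (n + 1), m n` and
`l (n + 1), m n, m (n + 1)`. -/
structure Strip (A : V → V → Prop) (l m : ℤ → V) : Prop where
  down : ∀ n, A (m n) (l n)
  up : ∀ n, A (l (n + 1)) (m n)
  arrow : ∀ n, A (m n) (m (n + 1))

section
variable {l l' m m' : ℤ → V}

theorem Strip.symm (h : Strip A l m) (hl : StraightLine A l) :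
    Strip A m fun n => l (n + 1) :=
  ⟨h.up, fun n => h.down (n + 1), fun n => hl.arrow (n + 1)⟩

/-- If `m n` and `m (n + 2)` were incident, then `m n` and `l (n + 2)` would both be the line
through `m (n + 2)` and `l (n + 1)` in the link of `m (n + 1)`. -/
theorem ArrowGeometry.strip_straight (hA : ArrowGeometry A) (hl : StraightLine A l)
    (h : Strip A l m) : StraightLine A m := by
  refine ⟨h.arrow, fun n hn => ?_⟩
  have e1 : n + 1 + 1 = n + 2 := by ring
  have h1 := h.arrow (n + 1)
  have h2 := h.down (n + 1)
  have h3 := h.up (n + 1)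
  have h4 := h.down (n + 2)
  have h5 := hl.arrow (n + 1)
  have h6 := h.up (n + 2)
  rw [e1] at h1 h3 h5
  have hne : m (n + 2) ≠ l (n + 1) := by
    intro e
    rw [e] at h6
    have := hl.straight (n + 1)
    rw [show n + 1 + 2 = n + 2 + 1 by ring] at this
    exact this h6
  have := hA.join_unique h1 h2 hne (h.arrow n) hn (h.up n) h3 h4 h5
  have h7 := h.down n
  rw [this] at h7
  exact hl.straight n h7

/-- In the link of `l (n + 1)`, the next vertex of a strip is the line through two points. -/
theorem ArrowGeometry.strip_next (hA : ArrowGeometry A) (hl : StraightLine A l) {n : ℤ} {y : V}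
    (h1 : A y (l n)) (h2 : A (l (n + 1)) y) :
    ∃ z, (A z (l (n + 1)) ∧ A (l (n + 2)) z) ∧ A y z := by
  have h3 := hl.arrow (n + 1)
  rw [show n + 1 + 1 = n + 2 by ring] at h3
  obtain ⟨z, hz1, hz2, hz3⟩ := hA.join h2 h3 fun e => hl.straight n (by rwa [e] at h1)
  exact ⟨z, ⟨hz1, hz3⟩, hz2⟩

/-- In the link of `l (n + 1)`, the preceding vertex of a strip is the common point of two lines. -/
theorem ArrowGeometry.strip_prev (hA : ArrowGeometry A) (hl : StraightLine A l) {n : ℤ} {y : V}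
    (h1 : A y (l (n + 1))) (h2 : A (l (n + 2)) y) :
    ∃ z, (A z (l n) ∧ A (l (n + 1)) z) ∧ A z y := by
  obtain ⟨z, hz1, hz2, hz3⟩ := hA.meet h1 (hl.arrow n) fun e => hl.straight n (by rwa [e] at h2)
  exact ⟨z, ⟨hz3, hz1⟩, hz2⟩

/-- Strips which share a vertex agree as long as their base lines agree. This is a step to the
right, and `strip_eq_pred` is a step to the left. -/
theorem ArrowGeometry.strip_eq_succ (hA : ArrowGeometry A) (hl : StraightLine A l)
    (h : Strip A l m) (h' : Strip A l' m') {n : ℤ} (e1 : l (n + 1) = l' (n + 1))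
    (e2 : l (n + 2) = l' (n + 2)) (e : m n = m' n) : m (n + 1) = m' (n + 1) := by
  have en : n + 1 + 1 = n + 2 := by ring
  have h3 := hl.arrow (n + 1)
  have h4 := h.up (n + 1)
  have h5 := h'.up (n + 1)
  have h6 := h'.down (n + 1)
  have h7 := h'.arrow n
  rw [en] at h3 h4 h5
  rw [← e2] at h5
  rw [← e1] at h6
  rw [← e] at h7
  refine hA.join_unique (h.up n) h3 (fun e => hl.straight n ?_) (h.down _) (h.arrow n) h4 h6 h7 h5
  rw [← e]
  exact h.down n

theorem ArrowGeometry.strip_eq_pred (hA : ArrowGeometry A) (hl : StraightLine A l)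
    (h : Strip A l m) (h' : Strip A l' m') {n : ℤ} (e0 : l n = l' n) (e1 : l (n + 1) = l' (n + 1))
    (e : m (n + 1) = m' (n + 1)) : m n = m' n := by
  have en : n + 1 + 1 = n + 2 := by ring
  have h4 := h.up (n + 1)
  have h5 := h'.up n
  have h6 := h'.down n
  have h7 := h'.arrow n
  rw [en] at h4
  rw [← e1] at h5
  rw [← e0] at h6
  rw [← e] at h7
  by_contra hne
  have := hA.join_unique (h.up n) h5 hne (h.down (n + 1)) (h.arrow n) h7 (hl.arrow n)
    (h.down n) h6
  rw [this] at h4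
  exact hl.straight n h4

theorem ArrowGeometry.strip_eq_right (hA : ArrowGeometry A) (hl : StraightLine A l)
    (h : Strip A l m) (h' : Strip A l' m') {N : ℤ} (e : ∀ n, N ≤ n → l n = l' n)
    (eN : m N = m' N) (n : ℤ) (hn : N ≤ n) : m n = m' n := by
  induction n, hn using Int.leInduction with
  | base => exact eN
  | succ n hn ih =>
    exact hA.strip_eq_succ hl h h' (e _ (by omega)) (e _ (by omega)) ih

theorem ArrowGeometry.strip_eq_left (hA : ArrowGeometry A) (hl : StraightLine A l)
    (h : Strip A l m) (h' : Strip A l' m') {N : ℤ} (e : ∀ n, n ≤ N + 1 → l n = l' n)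
    (eN : m N = m' N) (n : ℤ) (hn : n ≤ N) : m n = m' n := by
  induction n, hn using Int.leInductionDown with
  | base => exact eN
  | pred n hn ih =>
    refine hA.strip_eq_pred hl h h' (e _ (by omega)) (e _ (by omega)) ?_
    rwa [sub_add_cancel]

theorem ArrowGeometry.strip_eq (hA : ArrowGeometry A) (hl : StraightLine A l)
    (h : Strip A l m) (h' : Strip A l m') {N : ℤ} (eN : m N = m' N) : m = m' := by
  funext n
  rcases le_total N n with hn | hn
  · exact hA.strip_eq_right hl h h' (fun _ _ => rfl) eN n hn
  · exact hA.strip_eq_left hl h h' (fun _ _ => rfl) eN n hn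

/-- A triangle on an edge of a straight line extends to a strip along the line. -/
theorem ArrowGeometry.exists_strip (hA : ArrowGeometry A) (hl : StraightLine A l) {N : ℤ} {y : V}
    (h1 : A y (l N)) (h2 : A (l (N + 1)) y) : ∃ m, Strip A l m ∧ m N = y := by
  have hnext : ∀ n (y : {y // A y (l n) ∧ A (l (n + 1)) y}),
      ∃ z : {y // A y (l (n + 1)) ∧ A (l (n + 1 + 1)) y}, A y.1 z.1 := by
    rintro n ⟨y, h1, h2⟩
    obtain ⟨z, hz, hyz⟩ := hA.strip_next hl h1 h2
    exact ⟨⟨z, by rwa [add_assoc]⟩, hyz⟩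
  have hprev : ∀ n (y : {y // A y (l n) ∧ A (l (n + 1)) y}),
      ∃ z : {y // A y (l (n - 1)) ∧ A (l (n - 1 + 1)) y}, A z.1 y.1 := by
    rintro n ⟨y, h1, h2⟩
    obtain ⟨z, hz, hyz⟩ := hA.strip_prev hl (n := n - 1) (by rwa [sub_add_cancel])
      (by rwa [show n - 1 + 2 = n + 1 by ring])
    exact ⟨⟨z, hz⟩, hyz⟩
  choose next hnext using hnext
  choose prev hprev using hprev
  let m : ∀ n, {y // A y (l n) ∧ A (l (n + 1)) y} := fun n =>
    Int.inductionOn' n N ⟨y, h1, h2⟩ (fun k _ y => next k y) (fun k _ y => prev k y)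
  refine ⟨fun n => (m n).1, ⟨fun n => (m n).2.1, fun n => (m n).2.2, fun n => ?_⟩, ?_⟩
  · rcases le_or_gt N n with hn | hn
    · have : m (n + 1) = next n (m n) := Int.inductionOn'_add_one hn
      rw [this]
      exact hnext n _
    · have : m (n + 1 - 1) = prev (n + 1) (m (n + 1)) := Int.inductionOn'_sub_one (by omega)
      have h := hprev (n + 1) (m (n + 1))
      rw [← this] at h
      have e : ∀ k, k = n → A (m k).1 (m (n + 1)).1 → A (m n).1 (m (n + 1)).1 := by
        rintro k rfl h
        exact h
      exact e _ (by ring) h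
  · show (m N).1 = y
    simp only [m, Int.inductionOn'_self]

/-- A line is on the boundary of at least three strips. -/
theorem ArrowGeometry.exists_strip_ne (hA : ArrowGeometry A) (hl : StraightLine A l) {m₁ m₂ : ℤ → V}
    (h₁ : Strip A l m₁) (h₂ : Strip A l m₂) :
    ∃ m, Strip A l m ∧ (∀ n, m n ≠ m₁ n) ∧ ∀ n, m n ≠ m₂ n := by
  obtain ⟨z, hz1, hz2, hn1, hn2⟩ := hA.thick (hl.arrow 0) (m₁ 0) (m₂ 0)
  obtain ⟨m, hm, rfl⟩ := hA.exists_strip hl hz2 hz1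
  refine ⟨m, hm, fun n e => hn1 ?_, fun n e => hn2 ?_⟩
  · rw [hA.strip_eq hl hm h₁ e]
  · rw [hA.strip_eq hl hm h₂ e]

end

/-- The rows of a half-plane: consecutive rows bound a strip, and no row is folded back onto the
last row but one. -/
structure Stack (A : V → V → Prop) (u : ℕ → ℤ → V) : Prop where
  straight : ∀ k, StraightLine A (u k)
  strip : ∀ k, Strip A (u k) (u (k + 1))
  ne : ∀ k n, u (k + 2) n ≠ u k (n + 1)

/-- A half-plane with boundary line `l` whose first strip differs from two given ones. -/
theorem ArrowGeometry.exists_stack (hA : ArrowGeometry A) {l m₁ m₂ : ℤ → V}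
    (hl : StraightLine A l) (h₁ : Strip A l m₁) (h₂ : Strip A l m₂) :
    ∃ u, Stack A u ∧ u 0 = l ∧ (∀ n, u 1 n ≠ m₁ n) ∧ ∀ n, u 1 n ≠ m₂ n := by
  obtain ⟨l₁, hl₁, hn₁, hn₂⟩ := hA.exists_strip_ne hl h₁ h₂
  -- a state consists of a row and the shifted preceding row
  have hnext : ∀ s : {p : (ℤ → V) × (ℤ → V) // StraightLine A p.1 ∧ Strip A p.1 p.2},
      ∃ t : {p : (ℤ → V) × (ℤ → V) // StraightLine A p.1 ∧ Strip A p.1 p.2},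
        Strip A s.1.1 t.1.1 ∧ (∀ n, t.1.1 n ≠ s.1.2 n) ∧ ∀ n, t.1.2 n = s.1.1 (n + 1) := by
    rintro ⟨⟨l, m⟩, hl, hm⟩
    obtain ⟨m', hm', hne, -⟩ := hA.exists_strip_ne hl hm hm
    exact ⟨⟨(m', fun n => l (n + 1)), hA.strip_straight hl hm', hm'.symm hl⟩, hm', hne,
      fun n => rfl⟩
  choose next hnext using hnext
  let s : ℕ → {p : (ℤ → V) × (ℤ → V) // StraightLine A p.1 ∧ Strip A p.1 p.2} := fun k =>
    Nat.rec ⟨(l₁, fun n => l (n + 1)), hA.strip_straight hl hl₁, hl₁.symm hl⟩ (fun _ => next) k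
  have hs : ∀ k, s (k + 1) = next (s k) := fun k => rfl
  refine ⟨fun k => Nat.casesOn k l fun k => (s k).1.1, ⟨?_, ?_, ?_⟩, rfl, hn₁, hn₂⟩
  · rintro (_ | k)
    · exact hl
    · exact (s k).2.1
  · rintro (_ | k)
    · exact hl₁
    · exact (hnext (s k)).1
  · rintro (_ | k) n
    · exact (hnext (s 0)).2.1 n
    · show (next (s (k + 1))).1.1 n ≠ (s k).1.1 (n + 1)
      rw [← (hnext (s k)).2.2 n]
      exact (hnext (s (k + 1))).2.1 n

/-- A family of lines in which consecutive ones bound strips is a flat, unless it is folded. -/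
theorem ArrowGeometry.flat_of_rows (hA : ArrowGeometry A) {r : ℤ → ℤ → V}
    (hr : ∀ b, StraightLine A (r b)) (hs : ∀ b, Strip A (r b) (r (b + 1)))
    (hn : ∀ b n, r (b + 1) n ≠ r (b - 1) (n + 1)) : Flat A fun p => r p.2 p.1 := by
  have hs' : ∀ b, Strip A (r (b - 1)) (r b) := fun b => by
    have := hs (b - 1)
    rwa [sub_add_cancel] at this
  refine ⟨?_, ?_⟩
  · rintro ⟨a, b⟩ ⟨c, d⟩ h
    simp only [ModelArrow] at h
    rcases h with ⟨rfl, rfl⟩ | ⟨rfl, rfl⟩ | ⟨rfl, rfl⟩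
    · exact (hr _).arrow a
    · have := (hs b).up (a - 1)
      rwa [sub_add_cancel] at this
    · exact (hs' b).down c
  · rintro ⟨a', b'⟩ ⟨a, b⟩ ⟨c, d⟩ h1 h2 h3
    simp only [Prod.mk_add_mk, Prod.mk.injEq] at h3
    -- the link of the central vertex: three points and three lines of a projective plane
    have p1 := (hr b).arrow a
    have p2 := (hs b).up (a - 1)
    have p3 := (hs' b).down a
    have q1 := (hr b).arrow (a - 1)
    have q2 := (hs' b).up a
    have q3 := (hs b).down a
    have i12 := (hs' b).down (a + 1)
    have i13 := (hs b).up a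
    have i21 := (hs b).down (a - 1)
    have i23 := (hs b).arrow (a - 1)
    have i31 := (hs' b).up (a - 1)
    have i32 := (hr (b - 1)).arrow a
    have o1 := (hr b).straight (a - 1)
    rw [sub_add_cancel] at p2 q1 i23 i31
    rw [show a - 1 + 2 = a + 1 by ring] at o1
    have ne23 := hn b a
    simp only [ModelArrow] at h1 h2
    rcases h1 with ⟨h1, h1'⟩ | ⟨h1, h1'⟩ | ⟨h1, h1'⟩
    · obtain rfl : c = a + 1 := by omega
      obtain rfl : a' = a - 1 := by omega
      obtain rfl : b' = b := by omega
      obtain rfl : d = b' := by omega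
      exact o1
    · obtain rfl : c = a - 1 := by omega
      obtain rfl : d = b + 1 := by omega
      obtain rfl : a' = a + 1 := by omega
      obtain rfl : b' = b - 1 := by omega
      intro hcon
      have hne : r b (a + 1) ≠ r (b + 1) (a - 1) := fun e => o1 (by rw [e]; exact i21)
      exact ne23 (hA.join_unique p1 p2 hne q3 i13 i23 q2 i12 hcon)
    · obtain rfl : a' = a := by omega
      obtain rfl : c = a' := by omega
      obtain rfl : d = b - 1 := by omega
      obtain rfl : b' = b + 1 := by omega
      intro hcon
      have hne : r b (c + 1) ≠ r (b - 1) c := fun e => o1 (by rw [e]; exact i31)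
      exact ne23 (hA.join_unique p1 p3 hne q3 i13 hcon q2 i12 i32)

/-- Two half-planes with the same boundary line, glued along this line; the rows of the lower one
are enumerated downwards, and shifted. -/
theorem ArrowGeometry.exists_flat_of_stacks (hA : ArrowGeometry A) {u d : ℕ → ℤ → V}
    (hu : Stack A u) (hd : Stack A d) (h0 : u 0 = d 0) (h1 : ∀ n, u 1 n ≠ d 1 n) :
    ∃ f, Flat A f ∧ (∀ (k : ℕ) a, f (a, k) = u k a) ∧ ∀ (k : ℕ) a, f (a, -k) = d k (a - k) := by
  let r : ℤ → ℤ → V := fun b a => if 0 ≤ b then u b.toNat a else d (-b).toNat (a + b)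
  have ru : ∀ (k : ℕ) a, r k a = u k a := by
    intro k a
    simp [r]
  have rd : ∀ (k : ℕ) a, r (-k) a = d k (a - k) := by
    intro k a
    obtain _ | k := k
    · simp [r, h0]
    · have : ¬ (0 : ℤ) ≤ -((k + 1 : ℕ) : ℤ) := by omega
      simp only [r, this, if_false, neg_neg, Int.toNat_natCast]
      rfl
  refine ⟨fun p => r p.2 p.1, hA.flat_of_rows ?_ ?_ ?_, ru, rd⟩
  · intro b
    obtain ⟨k, rfl | rfl⟩ := b.eq_nat_or_neg
    · rw [show r k = u k from funext (ru k)]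
      exact hu.straight k
    · rw [show r (-k) = fun a => d k (a + -k) from funext (rd k)]
      exact (hd.straight k).shift _
  · intro b
    rcases le_or_gt 0 b with hb | hb
    · lift b to ℕ using hb
      have e : r (b + 1) = u (b + 1) := by
        funext a
        exact_mod_cast ru (b + 1) a
      rw [e, show r b = u b from funext (ru b)]
      exact hu.strip b
    · obtain ⟨k, rfl⟩ : ∃ k : ℕ, b = -((k + 1 : ℕ) : ℤ) := ⟨(-b - 1).toNat, by omega⟩
      rw [show (-((k + 1 : ℕ) : ℤ) + 1) = -(k : ℤ) by push_cast; ring]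
      have hk := (hd.strip k).symm (hd.straight k)
      refine ⟨fun n => ?_, fun n => ?_, fun n => ?_⟩ <;> simp only [rd]
      · have := (hd.strip k).up (n - k - 1)
        rw [sub_add_cancel] at this
        push_cast
        rwa [← sub_sub]
      · have := (hd.strip k).down (n - k)
        push_cast
        rwa [show n + 1 - ((k : ℤ) + 1) = n - k by ring]
      · have := (hd.straight k).arrow (n - k)
        rwa [show n + 1 - (k : ℤ) = n - k + 1 by ring]
  · intro b n
    rcases lt_trichotomy b 0 with hb | rfl | hb
    · obtain ⟨k, rfl⟩ : ∃ k : ℕ, b = -((k + 1 : ℕ) : ℤ) := ⟨(-b - 1).toNat, by omega⟩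
      rw [show (-((k + 1 : ℕ) : ℤ) + 1) = -(k : ℤ) by push_cast; ring,
        show (-((k + 1 : ℕ) : ℤ) - 1) = -((k + 2 : ℕ) : ℤ) by push_cast; ring, rd, rd]
      have := (hd.ne k (n - k - 1)).symm
      rw [sub_add_cancel] at this
      push_cast
      rwa [show n + 1 - ((k : ℤ) + 2) = n - k - 1 by ring]
    · have := h1 n
      have e1 := ru 1 n
      have e2 := rd 1 (n + 1)
      push_cast at e1 e2
      rw [zero_add, zero_sub, e1, e2]
      simpa using this
    · obtain ⟨k, rfl⟩ : ∃ k : ℕ, b = (k + 1 : ℕ) := ⟨(b - 1).toNat, by omega⟩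
      have := hu.ne k n
      have e1 := ru (k + 2) n
      have e2 := ru k (n + 1)
      push_cast at *
      rw [add_sub_cancel_right, e2, show (k : ℤ) + 1 + 1 = k + 2 by ring, e1]
      exact this

end

section
variable {κ : V → ZMod 3}

/-- A flat is an apartment. -/
theorem Flat.exists_chart {f : ℤ × ℤ → V} (hf : Flat (Arrow X κ) f) (hκ : IsColoring X κ)
    (hX : IsBuilding X) (hT : IsThick X) : ∃ φ : Chart X, φ.IsOriented κ ∧ ∀ p, φ.emb p = f p := by
  let e : ℤ × ℤ ↪ V := ⟨f, (hκ.arrowGeometry hX hT).flat_injective hf⟩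
  have htri : ∀ p q r, ModelArrow p q → ModelArrow q r → ModelArrow r p →
      ∀ s : Finset (ℤ × ℤ), s.Nonempty → s ⊆ {p, q, r} → s.map e ∈ X := by
    intro p q r h1 h2 h3 s hne hs
    obtain ⟨t, ht, hp, hq, hr⟩ := hκ.exists_triangle hX (hf.arrow h1) (hf.arrow h2) (hf.arrow h3)
    refine (X.isRelLowerSet_faces ht).2 (fun x hx => ?_) (by simpa using hne)
    obtain ⟨y, hy, rfl⟩ := Finset.mem_map.1 hx
    have := hs hy
    simp only [Finset.mem_insert, Finset.mem_singleton] at this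
    rcases this with rfl | rfl | rfl
    exacts [hp, hq, hr]
  refine ⟨⟨e, ?_⟩, hκ.isOriented (hf.arrow (show ModelArrow (0, 0) (1, 0) from Or.inl (by simp))).2,
    fun p => rfl⟩
  rintro s ⟨hne, ⟨a, b⟩, hs | hs⟩
  · refine htri (a, b) (a + 1, b) (a, b + 1) ?_ ?_ ?_ s hne (by simpa using hs)
    · exact Or.inl (by simp)
    · exact Or.inr (Or.inl (by simp))
    · exact Or.inr (Or.inr (by simp))
  · refine htri (a, b + 1) (a + 1, b + 1) (a + 1, b) ?_ ?_ ?_ s hne ?_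
    · exact Or.inl (by simp)
    · exact Or.inr (Or.inr (by simp))
    · exact Or.inr (Or.inl (by simp))
    · refine hs.trans fun x hx => ?_
      simp only [Prod.mk_add_mk, add_zero, Finset.mem_insert, Finset.mem_singleton] at hx ⊢
      tauto

variable {φ : Chart X}

theorem Chart.IsOriented.flat (hφ : φ.IsOriented κ) (hX : IsBuilding X) :
    Flat (Arrow X κ) φ.emb := by
  refine ⟨fun h => (hφ.arrow_iff hX).2 h, fun {p q r} h1 h2 h3 h => ?_⟩
  rw [hφ.arrow_iff hX] at h
  rw [Prod.ext_iff] at h3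
  simp only [Prod.fst_add, Prod.snd_add] at h3
  rcases h1 with h1 | h1 | h1 <;> simp only [ModelArrow] at h <;> omega

theorem Chart.IsOriented.row_straight (hφ : φ.IsOriented κ) (hX : IsBuilding X) (b : ℤ) :
    StraightLine (Arrow X κ) fun a => φ.emb (a, b) := by
  refine ⟨fun n => (hφ.arrow_iff hX).2 (Or.inl (by simp)), fun n h => ?_⟩
  have := (hφ.arrow_iff hX).1 h
  simp only [ModelArrow] at this
  omega

theorem Chart.IsOriented.row_strip (hφ : φ.IsOriented κ) (hX : IsBuilding X) (b : ℤ) :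
    Strip (Arrow X κ) (fun a => φ.emb (a, b)) fun a => φ.emb (a, b + 1) :=
  ⟨fun n => (hφ.arrow_iff hX).2 (Or.inr (Or.inr (by simp))),
    fun n => (hφ.arrow_iff hX).2 (Or.inr (Or.inl (by simp))),
    fun n => (hφ.arrow_iff hX).2 (Or.inl (by simp))⟩

/-- The strip below a row of an apartment. -/
theorem Chart.IsOriented.row_strip' (hφ : φ.IsOriented κ) (hX : IsBuilding X) (b : ℤ) :
    Strip (Arrow X κ) (fun a => φ.emb (a, b)) fun a => φ.emb (a + 1, b - 1) := by
  have := (hφ.row_strip hX (b - 1)).symm (hφ.row_straight hX (b - 1))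
  rwa [sub_add_cancel] at this

/-- Charts may be precomposed with orientation-preserving symmetries of the model. -/
theorem Chart.IsOriented.exists_comp (hφ : φ.IsOriented κ) (hκ : IsColoring X κ)
    (hX : IsBuilding X) (hT : IsThick X) (g : ℤ × ℤ → ℤ × ℤ)
    (hg : ∀ p q, ModelArrow p q → ModelArrow (g p) (g q))
    (hg' : ∀ p q r, p + r = q + q → g p + g r = g q + g q) :
    ∃ ψ : Chart X, ψ.IsOriented κ ∧ ∀ p, ψ.emb p = φ.emb (g p) :=
  Flat.exists_chart (f := fun p => φ.emb (g p)) ⟨fun h => (hφ.flat hX).arrow (hg _ _ h),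
    fun h1 h2 h3 => (hφ.flat hX).straight (hg _ _ h1) (hg _ _ h2) (hg' _ _ _ h3)⟩ hκ hX hT

/-- Charts may be precomposed with orientation-reversing symmetries of the model. -/
theorem Chart.IsOriented.exists_comp_neg (hφ : φ.IsOriented κ) (hκ : IsColoring X κ)
    (hX : IsBuilding X) (hT : IsThick X) (g : ℤ × ℤ → ℤ × ℤ)
    (hg : ∀ p q, ModelArrow p q → ModelArrow (g q) (g p))
    (hg' : ∀ p q r, p + r = q + q → g p + g r = g q + g q) :
    ∃ ψ : Chart X, ψ.IsOriented (-κ) ∧ ∀ p, ψ.emb p = φ.emb (g p) :=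
  Flat.exists_chart (f := fun p => φ.emb (g p))
    ⟨fun h => arrow_neg.2 ((hφ.flat hX).arrow (hg _ _ h)),
    fun {p q r} h1 h2 h3 h => (hφ.flat hX).straight (hg _ _ h2) (hg _ _ h1)
      (by rw [add_comm]; exact hg' _ _ _ h3) (arrow_neg.1 h)⟩ hκ.neg hX hT

/-- Every strip is contained in an apartment. -/
theorem Strip.exists_chart {l m : ℤ → V} (h : Strip (Arrow X κ) l m)
    (hl : StraightLine (Arrow X κ) l) (hκ : IsColoring X κ) (hX : IsBuilding X) (hT : IsThick X) :
    ∃ φ : Chart X, φ.IsOriented κ ∧ (∀ n, φ.emb (n, 0) = l n) ∧ ∀ n, φ.emb (n, 1) = m n := by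
  have hA := hκ.arrowGeometry hX hT
  obtain ⟨d, hd, hd0, hd1, -⟩ := hA.exists_stack hl h h
  obtain ⟨u, hu, rfl, hu1, -⟩ := hA.exists_stack (hA.strip_straight hl h) (h.symm hl) (h.symm hl)
  let u' : ℕ → ℤ → V := fun k => Nat.casesOn k l u
  have hu' : Stack (Arrow X κ) u' := by
    refine ⟨?_, ?_, ?_⟩ <;> rintro (_ | k)
    exacts [hl, hu.straight k, h, hu.strip k, hu1, hu.ne k]
  obtain ⟨f, hf, hf1, -⟩ := hA.exists_flat_of_stacks hu' hd hd0.symm fun n => (hd1 n).symm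
  obtain ⟨φ, hφ, hφf⟩ := hf.exists_chart hκ hX hT
  refine ⟨φ, hφ, fun n => ?_, fun n => ?_⟩
  · rw [hφf]; exact hf1 0 n
  · rw [hφf]; exact hf1 1 n

theorem StraightLine.exists_chart {l : ℤ → V} (hl : StraightLine (Arrow X κ) l)
    (hκ : IsColoring X κ) (hX : IsBuilding X) (hT : IsThick X) :
    ∃ φ : Chart X, φ.IsOriented κ ∧ ∀ n, φ.emb (n, 0) = l n := by
  have hA := hκ.arrowGeometry hX hT
  obtain ⟨z, hz1, hz2, -⟩ := hA.thick (hl.arrow 0) (l 0) (l 0)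
  obtain ⟨m, hm, -⟩ := hA.exists_strip hl hz2 hz1
  obtain ⟨φ, hφ, h, -⟩ := hm.exists_chart hl hκ hX hT
  exact ⟨φ, hφ, h⟩

/-- In a thick building, there is a third half-apartment on the boundary line of two
complementary half-apartments. -/
theorem Chart.IsOriented.exists_branch (hφ : φ.IsOriented κ) (hκ : IsColoring X κ)
    (hX : IsBuilding X) (hT : IsThick X) :
    ∃ ψ : Chart X, ψ.IsOriented κ ∧ (∀ a b, b ≤ 0 → ψ.emb (a, b) = φ.emb (a, b)) ∧
      ∀ a, ψ.emb (a, 1) ≠ φ.emb (a, 1) := by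
  have hA := hκ.arrowGeometry hX hT
  -- the rows of the lower half of `φ`, shifted such that they form a stack
  let d : ℕ → ℤ → V := fun k n => φ.emb (n + k, -k)
  have hd : Stack (Arrow X κ) d := by
    refine ⟨fun k => (hφ.row_straight hX _).shift _, fun k => ?_, fun k n h => ?_⟩
    · exact ⟨fun n => (hφ.arrow_iff hX).2 (Or.inr (Or.inl (by constructor <;> push_cast <;> ring))),
        fun n => (hφ.arrow_iff hX).2 (Or.inr (Or.inr (by constructor <;> push_cast <;> ring))),
        fun n => (hφ.arrow_iff hX).2 (Or.inl (by constructor <;> push_cast <;> ring))⟩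
    · have := φ.emb.injective h
      simp only [Prod.mk.injEq] at this
      omega
  have h1 : Strip (Arrow X κ) (d 0) fun a => φ.emb (a, 1) := by
    simpa [d] using hφ.row_strip hX 0
  obtain ⟨u, hu, hu0, hu1, hu2⟩ := hA.exists_stack (hd.straight 0) (hd.strip 0) h1
  obtain ⟨f, hf, hfu, hfd⟩ := hA.exists_flat_of_stacks hu hd hu0 hu1
  obtain ⟨ψ, hψ, hψf⟩ := hf.exists_chart hκ hX hT
  refine ⟨ψ, hψ, fun a b hb => ?_, fun a => ?_⟩
  · obtain ⟨k, rfl⟩ : ∃ k : ℕ, b = -k := ⟨(-b).toNat, by omega⟩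
    rw [hψf, hfd]
    simp [d]
  · rw [hψf]
    have := hfu 1 a
    push_cast at this
    rw [this]
    exact hu2 a

end

/-! ### Rays and their endpoints -/

/-- A thick building of type `Ã₂` together with a type function. Replacing `κ` by `-κ` reverses the
oriented edges and exchanges points and lines. -/
structure TypedBuilding (X : AbstractSimplicialComplex V) (κ : V → ZMod 3) : Prop where
  building : IsBuilding X
  thick : IsThick X
  coloring : IsColoring X κ

section
variable {κ : V → ZMod 3}

theorem TypedBuilding.neg (h : TypedBuilding X κ) : TypedBuilding X (-κ) :=
  ⟨h.building, h.thick, h.coloring.neg⟩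

theorem TypedBuilding.geometry (h : TypedBuilding X κ) : ArrowGeometry (Arrow X κ) :=
  h.coloring.arrowGeometry h.building h.thick

theorem Arrow.asymm {x y : V} (h : Arrow X κ x y) : ¬ Arrow X κ y x := by
  intro h'
  have h1 := h.2
  have h2 := h'.2
  generalize κ x = a at *
  generalize κ y = b at *
  clear h h'
  revert a b
  decide

theorem Arrow.ne {x y : V} (h : Arrow X κ x y) : x ≠ y := by
  rintro rfl
  exact h.asymm h

theorem Arrow.adj {x y : V} (h : Arrow X κ x y) : (skeleton X).Adj x y := by
  rw [skeleton, SimpleGraph.fromRel_adj]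
  exact ⟨h.ne, Or.inl h.1⟩

theorem Arrow.edist_le {x y : V} (h : Arrow X κ x y) : (skeleton X).edist x y ≤ 1 := by
  rw [SimpleGraph.edist_eq_one_iff_adj.2 h.adj]

theorem TypedBuilding.arrow_or (h : TypedBuilding X κ) {x y : V} (hxy : (skeleton X).Adj x y) :
    Arrow X κ x y ∨ Arrow X κ y x := by
  rw [skeleton, SimpleGraph.fromRel_adj] at hxy
  obtain ⟨hn, hs⟩ := hxy
  have hs' : ∃ s ∈ X, x ∈ s ∧ y ∈ s := by
    rcases hs with hs | ⟨s, hs, h1, h2⟩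
    exacts [hs, ⟨s, hs, h2, h1⟩]
  obtain ⟨s, hs, hx, hy⟩ := hs'
  have hc := h.coloring s hs x hx y hy hn
  have : κ y = κ x + 1 ∨ κ x = κ y + 1 := by
    generalize κ x = a at *
    generalize κ y = b at *
    revert a b
    decide
  exact this.imp (fun h => ⟨⟨s, hs, hx, hy⟩, h⟩) fun h => ⟨⟨s, hs, hy, hx⟩, h⟩

/-- Along an edge, in either direction, the directed distance grows by at most two. -/
theorem TypedBuilding.directedDist_le (h : TypedBuilding X κ) (x : V) {y z : V} {C : ℕ}
    (hC : (skeleton X).edist y z ≤ C) :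
    directedDist (Arrow X κ) x z ≤ directedDist (Arrow X κ) x y + 2 * C := by
  have key : ∀ (y z : V) (p : (skeleton X).Walk y z),
      directedDist (Arrow X κ) x z ≤ directedDist (Arrow X κ) x y + 2 * p.length := by
    intro y z p
    induction p with
    | nil => simp
    | cons hadj p ih =>
      rw [SimpleGraph.Walk.length_cons]
      rcases h.arrow_or hadj with h' | h' <;> have := h.geometry.step x h' <;> omega
  have hne : (skeleton X).edist y z ≠ ⊤ := fun e => by simp [e] at hC
  obtain ⟨p, hp⟩ := SimpleGraph.exists_walk_of_edist_ne_top hne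
  rw [← hp] at hC
  have := key y z p
  have hC' : p.length ≤ C := by exact_mod_cast hC
  omega

theorem StraightLine.reverse {l : ℤ → V} (hl : StraightLine (Arrow X κ) l) (k : ℤ) :
    StraightLine (Arrow X (-κ)) fun n => l (k - n) := by
  refine ⟨fun n => arrow_neg.2 ?_, fun n hn => hl.straight (k - (n + 2)) ?_⟩
  · have := hl.arrow (k - (n + 1))
    rwa [show k - (n + 1) + 1 = k - n by ring] at this
  · have := arrow_neg.1 hn
    rwa [show k - (n + 2) + 2 = k - n by ring]

/-- Two straight lines through a vertex which leave it in different directions of the same type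
diverge: they form an angle of `2π / 3`. -/
theorem TypedBuilding.diverge (h : TypedBuilding X κ) {s s' : ℤ → V}
    (hs : StraightLine (Arrow X κ) s) (hs' : StraightLine (Arrow X κ) s') (h0 : s 0 = s' 0)
    (h1 : s 1 ≠ s' 1) {C : ℕ} (hC : ∀ n : ℕ, (skeleton X).edist (s n) (s' n) ≤ C) : False := by
  have hB := h.neg.geometry
  -- seen from `s' (C + 1)` against the orientation, the vertex `s' 0` has no near point, so `s' 1`
  -- is its only near line, and the distance grows by two in each step along `s`
  set d := directedDist (Arrow X (-κ)) (s' (C + 1 : ℕ)) with hd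
  have hr := hB.dist_of_straight (hs'.reverse (C + 1 : ℕ))
  obtain ⟨d0, hnear⟩ := hr (C + 1)
  obtain ⟨d1, -⟩ := hr C
  simp only [sub_zero, sub_self, ← hd] at d0 d1 hnear
  rw [show ((C + 1 : ℕ) : ℤ) - (C : ℤ) = 1 by push_cast; ring] at d1
  have a0 : Arrow X (-κ) (s 1) (s' 0) := arrow_neg.2 (by rw [← h0]; exact hs.arrow 0)
  have a1 : Arrow X (-κ) (s' 1) (s' 0) := arrow_neg.2 (hs'.arrow 0)
  have k0 : d (s 1) = d (s 0) + 2 := by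
    rw [h0]
    rcases hB.step (s' (C + 1 : ℕ)) a0 with e | e
    · refine absurd (hB.near_line_unique hnear a0 a1 e ?_) h1
      rw [← hd, d0, d1]
    · exact e
  have k : ∀ n : ℕ, d (s (n + 1)) = d (s n) + 2 := by
    intro n
    induction n with
    | zero => simpa using k0
    | succ n ih =>
      push_cast
      have b0 : Arrow X (-κ) (s (n + 1)) (s n) := arrow_neg.2 (hs.arrow n)
      have b1 : Arrow X (-κ) (s (n + 1 + 1)) (s (n + 1)) := arrow_neg.2 (hs.arrow (n + 1))
      rcases hB.step (s' (C + 1 : ℕ)) b1 with e | e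
      · refine absurd (arrow_neg.1 (hB.near_incident b0 b1 ih e)) ?_
        rw [show (n : ℤ) + 1 + 1 = n + 2 by ring]
        exact hs.straight n
      · exact e
  have k' : ∀ n : ℕ, d (s n) = C + 1 + 2 * n := by
    intro n
    induction n with
    | zero => simp only [Nat.cast_zero, h0, d0]
    | succ n ih => push_cast; rw [k, ih]; ring
  have e := h.neg.directedDist_le (s' (C + 1 : ℕ))
    (by rw [SimpleGraph.edist_comm]; exact hC (C + 1))
  have e' := k' (C + 1)
  rw [hd] at e'
  rw [e', directedDist_self] at e
  omega

/-- Singular rays whose edges are oriented forwards and backwards are not parallel: the directed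
distance from the origin of the first one finally grows by one along each edge of the first one, but
by two along each edge of the second one. -/
theorem TypedBuilding.not_parallel (h : TypedBuilding X κ) {s s' : ℤ → V}
    (hs : StraightLine (Arrow X κ) s) (hs' : StraightLine (Arrow X (-κ)) s') {C : ℕ}
    (hC : ∀ n : ℕ, (skeleton X).edist (s n) (s' n) ≤ C) : False := by
  have hA := h.geometry
  set d := directedDist (Arrow X κ) (s 0) with hd
  have ds : ∀ n : ℕ, d (s n) = n := fun n => (hA.dist_of_straight hs n).1
  have st : ∀ n : ℕ, d (s' n) = d (s' (n + 1)) + 1 ∨ d (s' (n + 1)) = d (s' n) + 2 :=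
    fun n => hA.step _ (arrow_neg.1 (hs'.arrow n))
  have ex : ∃ n : ℕ, d (s' (n + 1)) = d (s' n) + 2 := by
    by_contra! hcon
    have : ∀ n : ℕ, d (s' n) + n = d (s' 0) := by
      intro n
      induction n with
      | zero => simp
      | succ n ih =>
        have := (st n).resolve_right (hcon n)
        push_cast
        omega
    have := this (d (s' 0) + 1)
    omega
  obtain ⟨N, hN⟩ := ex
  have grow : ∀ j : ℕ, d (s' ((N + j : ℕ) + 1)) = d (s' (N + j : ℕ)) + 2 := by
    intro j
    induction j with
    | zero => simpa using hN
    | succ j ih =>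
      refine (st (N + (j + 1))).resolve_left fun e => ?_
      have a1 := arrow_neg.1 (hs'.arrow (N + j : ℕ))
      have a2 := arrow_neg.1 (hs'.arrow ((N + j : ℕ) + 1))
      rw [show ((N + (j + 1) : ℕ) : ℤ) = (N + j : ℕ) + 1 by push_cast; ring] at e
      refine hs'.straight (N + j : ℕ) (arrow_neg.2 ?_)
      have := hA.near_incident a1 a2 ih e
      rwa [show ((N + j : ℕ) : ℤ) + 1 + 1 = (N + j : ℕ) + 2 by ring] at this
  have lower : ∀ j : ℕ, 2 * j ≤ d (s' (N + j : ℕ)) := by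
    intro j
    induction j with
    | zero => simp
    | succ j ih =>
      have := grow j
      rw [show ((N + (j + 1) : ℕ) : ℤ) = (N + j : ℕ) + 1 by push_cast; ring]
      omega
  have e1 := lower (N + 2 * C + 1)
  have e2 := h.directedDist_le (s 0) (hC (N + (N + 2 * C + 1)))
  rw [← hd, ds] at e2
  omega

theorem Ray.endpoint_eq_iff {r r' : Ray X} : r.endpoint = r'.endpoint ↔
    ∃ C : ℕ, ∀ n, (skeleton X).edist (r.toFun n) (r'.toFun n) ≤ C :=
  Quotient.eq (r := raySetoid X)

theorem Ray.germ_eq_iff {r r' : Ray X} {v : InfVertex X} {h : r.endpoint = v}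
    {h' : r'.endpoint = v} : r.germ v h = r'.germ v h' ↔
      ∃ a b : ℕ, ∀ n, r.toFun (a + n) = r'.toFun (b + n) :=
  Quotient.eq (r := asymptoticSetoid v)

theorem PanelVertex.exists_ray {v : InfVertex X} (x : PanelVertex v) :
    ∃ (r : Ray X) (h : r.endpoint = v), r.germ v h = x := by
  obtain ⟨⟨r, h⟩, rfl⟩ := Quotient.exists_rep x
  exact ⟨r, h, rfl⟩

/-- A sequence of vertices in which consecutive ones are adjacent moves with speed at most one. -/
theorem edist_add_le {s : ℕ → V} (hs : ∀ n, (skeleton X).edist (s n) (s (n + 1)) ≤ 1) (n k : ℕ) :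
    (skeleton X).edist (s n) (s (n + k)) ≤ k := by
  induction k with
  | zero => simp
  | succ k ih =>
    refine SimpleGraph.edist_triangle.trans ((add_le_add ih (hs (n + k))).trans ?_)
    push_cast
    exact le_rfl

theorem Ray.edist_succ_le (r : Ray X) (n : ℕ) :
    (skeleton X).edist (r.toFun n) (r.toFun (n + 1)) ≤ 1 := by
  obtain ⟨φ, hφ⟩ := r.exists_chart
  rw [hφ, hφ]
  obtain ⟨s, hs, h1, h2, -⟩ := exists_mem_of_map_subset (φ := φ) (p := ((n : ℤ), 0))
    (q := (((n + 1 : ℕ) : ℤ), 0)) (by simp [Hex]) (by simp [Hex]) (hex_refl _)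
  refine (SimpleGraph.edist_eq_one_iff_adj.2 ?_).le
  rw [skeleton, SimpleGraph.fromRel_adj]
  refine ⟨φ.emb.injective.ne (by simp), Or.inl ⟨s, hs, h1, h2⟩⟩

/-- Asymptotic rays have the same endpoint. -/
theorem Ray.endpoint_eq_of_asymptotic {r r' : Ray X} {a b : ℕ}
    (h : ∀ n, r.toFun (a + n) = r'.toFun (b + n)) : r.endpoint = r'.endpoint := by
  rw [Ray.endpoint_eq_iff]
  refine ⟨a + b, fun n => ?_⟩
  refine (SimpleGraph.edist_triangle (v := r.toFun (n + a))).trans ?_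
  push_cast
  refine add_le_add (edist_add_le r.edist_succ_le n a) ?_
  rw [add_comm n a, h, SimpleGraph.edist_comm, add_comm b n]
  exact edist_add_le r'.edist_succ_le n b

/-- A straight line as a singular line. -/
def StraightLine.toLine {l : ℤ → V} (hl : StraightLine (Arrow X κ) l) (h : TypedBuilding X κ) :
    Line X where
  toFun := l
  exists_chart := by
    obtain ⟨φ, -, hφ⟩ := hl.exists_chart h.coloring h.building h.thick
    exact ⟨φ, fun n => (hφ n).symm⟩

theorem Line.exists_typed (hX : IsBuilding X) (hT : IsThick X) (L : Line X) :
    ∃ κ, TypedBuilding X κ ∧ StraightLine (Arrow X κ) L.toFun := by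
  obtain ⟨φ, hφ⟩ := L.exists_chart
  obtain ⟨κ, hκ⟩ := hX.exists_coloring
  have key : ∀ κ, IsColoring X κ → φ.IsOriented κ → TypedBuilding X κ ∧
      StraightLine (Arrow X κ) L.toFun := fun κ hκ ho => ⟨⟨hX, hT, hκ⟩, by
    rw [show L.toFun = fun n => φ.emb (n, 0) from funext hφ]
    exact ho.row_straight hX 0⟩
  rcases hκ.isOriented_or φ with ho | ho
  exacts [⟨κ, key κ hκ ho⟩, ⟨-κ, key _ hκ.neg ho⟩]

/-- The edges of the ray are oriented away from its origin. -/
def Ray.IsPositive (r : Ray X) (κ : V → ZMod 3) : Prop :=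
  ∃ l, StraightLine (Arrow X κ) l ∧ ∀ n : ℕ, r.toFun n = l n

theorem Ray.isPositive_or (hX : IsBuilding X) (hκ : IsColoring X κ) (r : Ray X) :
    r.IsPositive κ ∨ r.IsPositive (-κ) := by
  obtain ⟨φ, hφ⟩ := r.exists_chart
  exact (hκ.isOriented_or φ).imp (fun h => ⟨_, h.row_straight hX 0, hφ⟩)
    fun h => ⟨_, h.row_straight hX 0, hφ⟩

theorem TypedBuilding.endpoint_ne (h : TypedBuilding X κ) {r r' : Ray X} (hr : r.IsPositive κ)
    (hr' : r'.IsPositive (-κ)) : r.endpoint ≠ r'.endpoint := by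
  rw [ne_eq, Ray.endpoint_eq_iff]
  rintro ⟨C, hC⟩
  obtain ⟨l, hl, hrl⟩ := hr
  obtain ⟨l', hl', hrl'⟩ := hr'
  exact h.not_parallel hl hl' fun n => by rw [← hrl, ← hrl']; exact hC n

theorem TypedBuilding.isPositive_of_endpoint_eq (h : TypedBuilding X κ) {r r' : Ray X}
    (hr : r.IsPositive κ) (e : r.endpoint = r'.endpoint) : r'.IsPositive κ :=
  (r'.isPositive_or h.building h.coloring).resolve_right fun h' => h.endpoint_ne hr h' e

theorem StraightLine.forward_isPositive {l : ℤ → V} (hl : StraightLine (Arrow X κ) l)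
    (h : TypedBuilding X κ) : (hl.toLine h).forward.IsPositive κ :=
  ⟨l, hl, fun _ => rfl⟩

theorem StraightLine.backward_isPositive {l : ℤ → V} (hl : StraightLine (Arrow X κ) l)
    (h : TypedBuilding X κ) : (hl.toLine h).backward.IsPositive (-κ) :=
  ⟨_, hl.reverse 0, fun n => by rw [zero_sub]; rfl⟩

/-! ### Opposite vertices at infinity -/

theorem Chart.edist_antidiagonal_le (φ : Chart X) (n : ℕ) :
    (skeleton X).edist (φ.emb ((n : ℤ), 0)) (φ.emb (0, (n : ℤ))) ≤ n := by
  have := edist_add_le (X := X) (s := fun k : ℕ => φ.emb ((n : ℤ) - k, (k : ℤ))) (fun k => ?_) 0 n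
  · simpa using this
  · obtain ⟨s, hs, h1, h2, -⟩ := exists_mem_of_map_subset (φ := φ) (p := ((n : ℤ) - k, (k : ℤ)))
      (q := ((n : ℤ) - (k + 1 : ℕ), ((k + 1 : ℕ) : ℤ))) (by simp [Hex]) (by simp [Hex]) (hex_refl _)
    refine (SimpleGraph.edist_eq_one_iff_adj.2 ?_).le
    rw [skeleton, SimpleGraph.fromRel_adj]
    exact ⟨φ.emb.injective.ne (by simp), Or.inl ⟨s, hs, h1, h2⟩⟩

theorem Chart.IsOriented.rayOne_isPositive {φ : Chart X} (hφ : φ.IsOriented κ)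
    (hX : IsBuilding X) : φ.rayOne.IsPositive κ :=
  ⟨_, hφ.row_straight hX 0, fun _ => rfl⟩

theorem Chart.IsOriented.rayTwo_isPositive {φ : Chart X} (hφ : φ.IsOriented κ)
    (hX : IsBuilding X) : φ.rayTwo.IsPositive (-κ) :=
  (Chart.IsOriented.swap (κ := -κ) (by rwa [neg_neg])).rayOne_isPositive hX

theorem TypedBuilding.adj_endpoint (h : TypedBuilding X κ) (φ : Chart X) :
    (infBuilding X).Adj φ.rayOne.endpoint φ.rayTwo.endpoint := by
  rw [infBuilding, SimpleGraph.fromRel_adj]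
  refine ⟨?_, Or.inl ⟨φ, rfl, rfl⟩⟩
  rcases h.coloring.isOriented_or φ with ho | ho
  · exact h.endpoint_ne (ho.rayOne_isPositive h.building) (ho.rayTwo_isPositive h.building)
  · exact h.neg.endpoint_ne (ho.rayOne_isPositive h.building) (ho.rayTwo_isPositive h.building)

/-- Adjacent vertices of the building at infinity are the endpoints of the two rays bounding a
sector; one of them is a point and the other one a line of the projective plane at infinity. -/
theorem TypedBuilding.exists_of_adj (h : TypedBuilding X κ) {v w : InfVertex X}
    (hvw : (infBuilding X).Adj v w) : ∃ r r' : Ray X, r.endpoint = v ∧ r'.endpoint = w ∧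
      (∀ n : ℕ, (skeleton X).edist (r.toFun n) (r'.toFun n) ≤ n) ∧
      (r.IsPositive κ → r'.IsPositive (-κ)) := by
  rw [infBuilding, SimpleGraph.fromRel_adj] at hvw
  have hpos : ∀ φ : Chart X, (φ.rayOne.IsPositive κ → φ.rayTwo.IsPositive (-κ)) ∧
      (φ.rayTwo.IsPositive κ → φ.rayOne.IsPositive (-κ)) := by
    intro φ
    rcases h.coloring.isOriented_or φ with ho | ho
    · have h1 := ho.rayOne_isPositive h.building
      have h2 := ho.rayTwo_isPositive h.building
      exact ⟨fun _ => h2, fun h3 => absurd rfl (h.endpoint_ne h3 h2)⟩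
    · have h1 := ho.rayOne_isPositive h.building
      exact ⟨fun h3 => absurd rfl (h.endpoint_ne h3 h1), fun _ => h1⟩
  rcases hvw.2 with ⟨φ, rfl, rfl⟩ | ⟨φ, rfl, rfl⟩
  · exact ⟨_, _, rfl, rfl, fun n => φ.edist_antidiagonal_le n, (hpos φ).1⟩
  · exact ⟨_, _, rfl, rfl, fun n => by
      rw [SimpleGraph.edist_comm]; exact φ.edist_antidiagonal_le n, (hpos φ).2⟩

theorem modelArrow_rotate {p q : ℤ × ℤ} (h : ModelArrow p q) :
    ModelArrow (-q.2, q.1 + q.2) (-p.2, p.1 + p.2) := by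
  rcases h with h | h | h
  · exact Or.inr (Or.inr (by constructor <;> simp only <;> omega))
  · exact Or.inl (by constructor <;> simp only <;> omega)
  · exact Or.inr (Or.inl (by constructor <;> simp only <;> omega))

theorem Chart.IsOriented.exists_rotate {φ : Chart X} (hφ : φ.IsOriented κ)
    (h : TypedBuilding X κ) : ∃ ψ : Chart X, ψ.IsOriented (-κ) ∧
      ∀ a b, ψ.emb (a, b) = φ.emb (-b, a + b) := by
  obtain ⟨ψ, hψ, e⟩ := hφ.exists_comp_neg h.coloring h.building h.thick
    (fun p => (-p.2, p.1 + p.2)) (fun p q hpq => modelArrow_rotate hpq) fun p q r e => by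
      have e1 := congrArg Prod.fst e
      have e2 := congrArg Prod.snd e
      simp only [Prod.fst_add, Prod.snd_add] at e1 e2
      simp only [Prod.mk_add_mk, Prod.mk.injEq]
      omega
  exact ⟨ψ, hψ, fun a b => e (a, b)⟩

/-- The two ends of a singular line are opposite vertices of the building at infinity. Three
consecutive sectors on one side of the line give a path of length three. The ends have different
types, so that their distance is odd; it is not one, as the line is a geodesic. -/
theorem Line.isOpposite (hX : IsBuilding X) (hT : IsThick X) (L : Line X) :
    IsOpposite L.backward.endpoint L.forward.endpoint := by
  obtain ⟨κ, h, hl⟩ := L.exists_typed hX hT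
  obtain ⟨φ, hφ, hφL⟩ := hl.exists_chart h.coloring hX hT
  obtain ⟨ψ, hψ, hψφ⟩ := hφ.exists_rotate h
  obtain ⟨χ, hχ, hχψ⟩ := hψ.exists_rotate h.neg
  have e1 : φ.rayOne.endpoint = L.forward.endpoint :=
    Ray.endpoint_eq_of_asymptotic (a := 0) (b := 0) fun n => hφL _
  have e2 : ψ.rayOne.endpoint = φ.rayTwo.endpoint :=
    Ray.endpoint_eq_of_asymptotic (a := 0) (b := 0) fun n => by
      show ψ.emb _ = φ.emb (Prod.swap _)
      rw [hψφ]; simp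
  have e3 : χ.rayOne.endpoint = ψ.rayTwo.endpoint :=
    Ray.endpoint_eq_of_asymptotic (a := 0) (b := 0) fun n => by
      show χ.emb _ = ψ.emb (Prod.swap _)
      rw [hχψ]; simp
  have e4 : χ.rayTwo.endpoint = L.backward.endpoint :=
    Ray.endpoint_eq_of_asymptotic (a := 0) (b := 0) fun n => by
      show χ.emb (Prod.swap _) = L.toFun (-_)
      rw [Prod.swap_prod_mk, hχψ, hψφ, ← hφL]; simp
  have a1 := h.adj_endpoint φ
  have a2 := h.adj_endpoint ψ
  have a3 := h.adj_endpoint χ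
  rw [e1] at a1
  rw [e2] at a2
  rw [e3, e4] at a3
  let p : (infBuilding X).Walk L.forward.endpoint L.backward.endpoint :=
    .cons a1 (.cons a2 (.cons a3 .nil))
  have hle : (infBuilding X).dist L.forward.endpoint L.backward.endpoint ≤ 3 :=
    SimpleGraph.dist_le p
  obtain ⟨p, hp⟩ := (SimpleGraph.Walk.reachable p).exists_walk_length_eq_dist
  have posf := hl.forward_isPositive h
  have posb := hl.backward_isPositive h
  rw [IsOpposite, SimpleGraph.dist_comm]
  rw [← hp] at hle ⊢
  generalize hv : L.backward.endpoint = v at *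
  generalize hw : L.forward.endpoint = w at *
  rcases p with _ | ⟨b1, _ | ⟨b2, _ | ⟨b3, p⟩⟩⟩
  · exact absurd (hw.trans hv.symm) (h.endpoint_ne posf posb)
  · -- the two rays of a sector diverge more slowly than the two ends of a line
    exfalso
    obtain ⟨r, r', hr, hr', hd, -⟩ := h.exists_of_adj b1
    obtain ⟨C, hC⟩ := Ray.endpoint_eq_iff.1 (hw.trans hr.symm)
    obtain ⟨D, hD⟩ := Ray.endpoint_eq_iff.1 (hr'.trans hv.symm)
    have hE : (skeleton X).edist (L.forward.toFun (C + D + 1)) (L.backward.toFun (C + D + 1)) ≤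
        (C + (C + D + 1) + D : ℕ) := by
      push_cast
      refine SimpleGraph.edist_triangle.trans (add_le_add (SimpleGraph.edist_triangle.trans
        (add_le_add (hC _) (hd _))) (hD _)) |>.trans ?_
      push_cast
      exact le_rfl
    have h1 := h.directedDist_le (L.forward.toFun (C + D + 1)) hE
    have h2 := hφ.directedDist_eq h.coloring hX (((C + D + 1 : ℕ) : ℤ), 0)
      (-((C + D + 1 : ℕ) : ℤ), 0)
    rw [hφL, hφL] at h2
    have h3 := modelDist_spec (((C + D + 1 : ℕ) : ℤ), 0) (-((C + D + 1 : ℕ) : ℤ), 0)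
    rw [← h2] at h3
    rw [directedDist_self] at h1
    change directedDist (Arrow X κ) (L.toFun (C + D + 1 : ℕ)) (L.toFun (-(C + D + 1 : ℕ))) ≤ _ at h1
    simp only at h3
    push_cast at *
    omega
  · -- adjacent vertices have different types
    exfalso
    obtain ⟨r, r', hr, hr', -, hpos⟩ := h.exists_of_adj b1
    obtain ⟨t, t', ht, ht', -, hpos'⟩ := h.neg.exists_of_adj b2
    have q1 := hpos (h.isPositive_of_endpoint_eq posf (hw.trans hr.symm))
    have q2 := hpos' (h.neg.isPositive_of_endpoint_eq q1 (hr'.trans ht.symm))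
    rw [neg_neg] at q2
    exact h.endpoint_ne q2 posb (ht'.trans hv.symm)
  · simp only [SimpleGraph.Walk.length_cons] at hle ⊢
    omega

end

/-! ### Connectedness of panel trees -/

section
variable {A : V → V → Prop}

/-- In the link of `x`, there is a line which does not contain the point `y`. -/
theorem ArrowGeometry.exists_opposite (hA : ArrowGeometry A) {x y : V} (h : A x y) :
    ∃ z, A z x ∧ ¬ A y z := by
  obtain ⟨L, h1, h2, -⟩ := hA.thick h x x
  obtain ⟨q, h3, h4, h5, -⟩ := hA.thick h2 y y
  obtain ⟨z, h6, h7, h8, -⟩ := hA.thick h3 L L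
  exact ⟨z, h7, fun h9 => h8 (hA.join_unique h3 h h5 h7 h6 h9 h2 h4 h1)⟩

/-- Straight rays extend to straight lines. -/
theorem ArrowGeometry.exists_straightLine (hA : ArrowGeometry A) {r : ℕ → V}
    (h1 : ∀ n, A (r n) (r (n + 1))) (h2 : ∀ n, ¬ A (r (n + 2)) (r n)) :
    ∃ l, StraightLine A l ∧ ∀ n : ℕ, l n = r n := by
  have hnext : ∀ p : {p : V × V // A p.1 p.2}, ∃ q : {p : V × V // A p.1 p.2},
      q.1.2 = p.1.1 ∧ ¬ A p.1.2 q.1.1 := by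
    rintro ⟨⟨x, y⟩, h⟩
    obtain ⟨z, hz, hz'⟩ := hA.exists_opposite h
    exact ⟨⟨(z, x), hz⟩, rfl, hz'⟩
  choose next hn1 hn2 using hnext
  let b : ℕ → {p : V × V // A p.1 p.2} := fun k => Nat.rec ⟨(r 0, r 1), h1 0⟩ (fun _ => next) k
  let l : ℤ → V := fun n => if 0 ≤ n then r n.toNat else (b (-n).toNat).1.1
  have l1 : ∀ n : ℕ, l n = r n := fun n => by simp [l]
  have l2 : ∀ n : ℕ, l (-n) = (b n).1.1 := fun n => by
    obtain _ | n := n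
    · simp [l, b]
    · have : ¬ (0 : ℤ) ≤ -((n + 1 : ℕ) : ℤ) := by omega
      simp only [l, this, if_false, neg_neg, Int.toNat_natCast]
  have l3 : ∀ n : ℕ, l (-n + 1) = (b n).1.2 := fun n => by
    obtain _ | n := n
    · have := l1 1
      simpa [b] using this
    · rw [show -((n + 1 : ℕ) : ℤ) + 1 = -(n : ℤ) by push_cast; ring, l2]
      exact (hn1 (b n)).symm
  refine ⟨l, ⟨fun n => ?_, fun n => ?_⟩, l1⟩
  · rcases le_or_gt 0 n with hn | hn
    · lift n to ℕ using hn
      have := l1 (n + 1)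
      push_cast at this
      rw [l1, this]
      exact h1 n
    · obtain ⟨k, rfl⟩ : ∃ k : ℕ, n = -k := ⟨(-n).toNat, by omega⟩
      rw [l2, l3]
      exact (b k).2
  · rcases le_or_gt 0 n with hn | hn
    · lift n to ℕ using hn
      have := l1 (n + 2)
      push_cast at this
      rw [l1, this]
      exact h2 n
    · obtain ⟨k, rfl⟩ : ∃ k : ℕ, n = -((k + 1 : ℕ) : ℤ) := ⟨(-n - 1).toNat, by omega⟩
      rw [show -((k + 1 : ℕ) : ℤ) + 2 = -(k : ℤ) + 1 by push_cast; ring, l2, l3]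
      exact hn2 (b k)

theorem Strip.shift {l m : ℤ → V} (h : Strip A l m) (k : ℤ) :
    Strip A (fun n => l (n + k)) fun n => m (n + k) := by
  refine ⟨fun n => h.down _, fun n => ?_, fun n => ?_⟩
  · have := h.up (n + k)
    rwa [add_right_comm] at this
  · have := h.arrow (n + k)
    rwa [add_right_comm] at this

/-- A strip along a line can be carried over to any other line which shares a ray with it. -/
theorem ArrowGeometry.strip_transfer (hA : ArrowGeometry A) {l l' m' : ℤ → V}
    (hl : StraightLine A l) (h' : Strip A l' m') {i j : ℤ}
    (e : ∀ n : ℕ, l' (i + n) = l (j + n)) :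
    ∃ m, Strip A l m ∧ ∀ n : ℕ, m' (i + n) = m (j + n) := by
  have e0 := e 0
  have e1 := e 1
  simp only [Nat.cast_zero, add_zero, Nat.cast_one] at e0 e1
  obtain ⟨m, hm, hmj⟩ := hA.exists_strip hl (N := j) (y := m' i) (by rw [← e0]; exact h'.down i)
    (by rw [← e1]; exact h'.up i)
  refine ⟨m, hm, fun n => ?_⟩
  have := hA.strip_eq_right hl hm (h'.shift (i - j)) (N := j) (fun n hn => ?_) ?_ (j + n) (by omega)
  · rw [this]
    ring_nf
  · have := e (n - j).toNat
    rw [Int.toNat_of_nonneg (by omega)] at this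
    rw [show n + (i - j) = i + (n - j) by ring, this]
    ring_nf
  · rw [hmj]
    ring_nf

end

section
variable {κ : V → ZMod 3} {l l' m : ℤ → V}

theorem strip_endpoint_eq (h : TypedBuilding X κ) (hl : StraightLine (Arrow X κ) l)
    (hm : StraightLine (Arrow X κ) m) (hs : Strip (Arrow X κ) l m) :
    (hm.toLine h).forward.endpoint = (hl.toLine h).forward.endpoint ∧
      (hm.toLine h).backward.endpoint = (hl.toLine h).backward.endpoint := by
  rw [Ray.endpoint_eq_iff, Ray.endpoint_eq_iff]
  refine ⟨⟨1, fun n => ?_⟩, ⟨1, fun n => ?_⟩⟩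
  · exact_mod_cast (hs.down n).edist_le
  · exact_mod_cast (hs.down (-n)).edist_le

theorem strip_adj (h : TypedBuilding X κ) (hl : StraightLine (Arrow X κ) l)
    (hm : StraightLine (Arrow X κ) m) (hs : Strip (Arrow X κ) l m) {v : InfVertex X}
    (hlv : (hl.toLine h).forward.endpoint = v) (hmv : (hm.toLine h).forward.endpoint = v) :
    (panelTree v).Adj ((hl.toLine h).forward.germ v hlv) ((hm.toLine h).forward.germ v hmv) := by
  obtain ⟨φ, hφ, h0, h1⟩ := hs.exists_chart hl h.coloring h.building h.thick
  rw [panelTree, SimpleGraph.fromRel_adj]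
  refine ⟨fun e => ?_, Or.inl ⟨_, _, hlv, hmv, rfl, rfl, φ, fun n => ⟨(h0 _).symm, (h1 _).symm⟩⟩⟩
  obtain ⟨a, b, hab⟩ := Ray.germ_eq_iff.1 e
  have := hab 0
  change l _ = m _ at this
  rw [← h0, ← h1] at this
  simpa using φ.emb.injective this

/-- The neighbours in the panel tree of the end of a line are the ends of the strips along this
line. -/
theorem exists_strip_of_adj (h : TypedBuilding X κ) (hl : StraightLine (Arrow X κ) l)
    {v : InfVertex X} (hlv : (hl.toLine h).forward.endpoint = v) {y : PanelVertex v}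
    (hy : (panelTree v).Adj ((hl.toLine h).forward.germ v hlv) y) :
    ∃ m, ∃ _ : Strip (Arrow X κ) l m, ∃ (hm : StraightLine (Arrow X κ) m)
      (hmv : (hm.toLine h).forward.endpoint = v), (hm.toLine h).forward.germ v hmv = y := by
  have hA := h.geometry
  have orient : ∀ (φ : Chart X) (b : ℤ) (i j : ℕ),
      (∀ n : ℕ, φ.emb ((i + n : ℕ), b) = l (j + n : ℕ)) → φ.IsOriented κ := by
    intro φ b i j e
    refine (h.coloring.isOriented_or φ).resolve_right fun ho => ?_
    have h1 := arrow_neg.1 ((ho.row_straight h.building b).arrow (i : ℕ))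
    have e0 := e 0
    have e1 := e 1
    push_cast at e0 e1
    rw [add_zero] at e0
    rw [e1] at h1
    simp only [add_zero] at e0
    rw [e0] at h1
    exact h1.asymm (hl.arrow j)
  -- a strip along a line asymptotic to `l` gives rise to a strip along `l`
  have main : ∀ (l' m' : ℤ → V) (r : Ray X) (hr : r.endpoint = v) (i j c : ℕ),
      Strip (Arrow X κ) l' m' → (∀ n : ℕ, l' (i + n : ℕ) = l (j + n : ℕ)) →
      (∀ n : ℕ, r.toFun (c + n) = m' (i + n : ℕ)) → r.germ v hr = y →
      ∃ m, ∃ _ : Strip (Arrow X κ) l m, ∃ (hm : StraightLine (Arrow X κ) m)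
        (hmv : (hm.toLine h).forward.endpoint = v), (hm.toLine h).forward.germ v hmv = y := by
    intro l' m' r hr i j c hs e e' hy
    obtain ⟨m, hm, hmm⟩ := hA.strip_transfer hl hs (i := i) (j := j)
      (fun n => by exact_mod_cast e n)
    have hms := hA.strip_straight hl hm
    refine ⟨m, hm, hms, (strip_endpoint_eq h hl hms hm).1.trans hlv, ?_⟩
    rw [← hy, Ray.germ_eq_iff]
    refine ⟨j, c, fun n => ?_⟩
    rw [e' n]
    have := hmm n
    push_cast
    rw [this]
    show m _ = _
    push_cast
    rfl
  rw [panelTree, SimpleGraph.fromRel_adj] at hy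
  rcases hy.2 with ⟨r, r', hr, hr', er, er', φ, hφ⟩ | ⟨r', r, hr', hr, er', er, φ, hφ⟩
  · obtain ⟨i, j, hij⟩ := Ray.germ_eq_iff.1 er
    have hij' : ∀ n : ℕ, φ.emb ((i + n : ℕ), 0) = l (j + n : ℕ) := fun n => by
      rw [← (hφ (i + n)).1]
      exact hij n
    have ho := orient φ 0 i j hij'
    refine main _ _ r' hr' i j i (ho.row_strip h.building 0) hij' (fun n => ?_) er'
    rw [(hφ (i + n)).2, zero_add]
  · obtain ⟨i, j, hij⟩ := Ray.germ_eq_iff.1 er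
    have hij' : ∀ n : ℕ, φ.emb ((i + n : ℕ), 1) = l (j + n : ℕ) := fun n => by
      rw [← (hφ (i + n)).2]
      exact hij n
    have ho := orient φ 1 i j hij'
    refine main _ _ r' hr' i j (i + 1) (ho.row_strip' h.building 1) hij' (fun n => ?_) er'
    rw [(hφ _).1, sub_self]
    congr 2
    push_cast
    ring

/-- Rays with the same origin and the same endpoint are equal. -/
theorem TypedBuilding.eq_of_endpoint_eq (h : TypedBuilding X κ) (hl : StraightLine (Arrow X κ) l)
    (hl' : StraightLine (Arrow X κ) l') (h0 : l 0 = l' 0) {C : ℕ}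
    (hC : ∀ n : ℕ, (skeleton X).edist (l n) (l' n) ≤ C) (n : ℕ) : l n = l' n := by
  induction n with
  | zero => exact h0
  | succ n ih =>
    by_contra hne
    refine h.diverge (hl.shift n) (hl'.shift n) (by simpa using ih) ?_ (C := C) fun k => ?_
    · simpa [add_comm] using hne
    · exact_mod_cast hC (k + n)

/-- Panel trees are connected: starting from a ray towards `v`, rays towards `v` issuing from all
other vertices of the building are found by following oriented edges; in each step, the asymptotic
class of the ray remains the same or is replaced by an adjacent one. -/
theorem panelTree_preconnected (hX : IsBuilding X) (hT : IsThick X) (v : InfVertex X) :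
    (panelTree v).Preconnected := by
  intro x y
  obtain ⟨r, hr, rfl⟩ := x.exists_ray
  obtain ⟨r', hr', rfl⟩ := y.exists_ray
  obtain ⟨κ, h, hpos⟩ : ∃ κ, TypedBuilding X κ ∧ r.IsPositive κ := by
    obtain ⟨κ, hκ⟩ := hX.exists_coloring
    rcases r.isPositive_or hX hκ with hp | hp
    exacts [⟨κ, ⟨hX, hT, hκ⟩, hp⟩, ⟨-κ, ⟨hX, hT, hκ.neg⟩, hp⟩]
  have hA := h.geometry
  obtain ⟨l, hl, hrl⟩ := hpos
  obtain ⟨l', hl', hrl'⟩ := h.isPositive_of_endpoint_eq ⟨l, hl, hrl⟩ (hr.trans hr'.symm)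
  have key : ∀ n z, DirectedPath (Arrow X κ) (l 0) n z → ∃ s, ∃ hs : StraightLine (Arrow X κ) s,
      s 0 = z ∧ ∃ hsv : (hs.toLine h).forward.endpoint = v,
        (panelTree v).Reachable (r.germ v hr) ((hs.toLine h).forward.germ v hsv) := by
    intro n z hz
    induction hz with
    | refl =>
      have hlv : (hl.toLine h).forward.endpoint = v := by
        rw [← hr]
        exact Ray.endpoint_eq_of_asymptotic (a := 0) (b := 0) fun n => (hrl _).symm
      refine ⟨l, hl, rfl, hlv, ?_⟩
      rw [Ray.germ_eq_iff (h := hr) (h' := hlv) |>.2 ⟨0, 0, fun n => hrl _⟩]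
    | @step n y y' _ hyy ih =>
      obtain ⟨s, hs, rfl, hsv, hreach⟩ := ih
      -- the new ray is a subray of the old one if the edge to `y'` is on the old ray; otherwise the
      -- edge is prolonged by the strip along `s` that contains the line through `y'` and `s 1`
      by_cases hy : y' = s 1
      · have hs' := hs.shift 1
        have hs'v : (hs'.toLine h).forward.endpoint = v := by
          rw [← hsv]
          exact Ray.endpoint_eq_of_asymptotic (a := 0) (b := 1) fun n => by
            show s _ = s _
            push_cast
            ring_nf
        refine ⟨_, hs', by simp [hy], hs'v, ?_⟩
        convert hreach using 1
        rw [Ray.germ_eq_iff]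
        exact ⟨0, 1, fun n => by
          show s _ = s _
          push_cast
          ring_nf⟩
      · have h01 := hs.arrow 0
        rw [zero_add] at h01
        obtain ⟨L, hL0, hyL, h1L⟩ := hA.join hyy h01 hy
        obtain ⟨t, ht, rfl⟩ := hA.exists_strip hs (N := 0) hL0 (by simpa using h1L)
        have hts := hA.strip_straight hs ht
        have htv := (strip_endpoint_eq h hs hts ht).1.trans hsv
        have hadj := strip_adj h hs hts ht hsv htv
        -- the vertex `y'` is opposite to `t 1` in the link of `t 0`
        have hopp : ¬ Arrow X κ (t 1) y' := by
          intro hcon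
          have e1 := ht.arrow 0
          have e2 := ht.down 1
          have e3 := ht.up 1
          rw [zero_add] at e1
          rw [one_add_one_eq_two] at e3
          refine hy (hA.join_unique e1 hL0 (fun e => ?_) hyL hcon hyy h1L e2 h01)
          rw [e] at e3
          exact hs.straight 0 (by simpa using e3)
        let q : ℕ → V := fun n => Nat.casesOn n y' fun n => t n
        obtain ⟨s', hs', hq⟩ := hA.exists_straightLine (r := q)
          (by rintro (_ | n); exacts [hyL, by exact_mod_cast hts.arrow n])
          (by rintro (_ | n); exacts [hopp, by exact_mod_cast hts.straight n])
        have hasym : ∀ n : ℕ, (hs'.toLine h).forward.toFun (1 + n) =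
            (hts.toLine h).forward.toFun (0 + n) := fun n => by
          show s' _ = t _
          rw [hq, zero_add, add_comm]
        have hs'v := (Ray.endpoint_eq_of_asymptotic hasym).trans htv
        refine ⟨s', hs', by exact_mod_cast hq 0, hs'v, ?_⟩
        rw [Ray.germ_eq_iff (h := hs'v) (h' := htv) |>.2 ⟨1, 0, hasym⟩]
        exact hreach.trans hadj.reachable
  obtain ⟨n, hn⟩ := hA.connected (l 0) (l' 0)
  obtain ⟨s, hs, hs0, hsv, hreach⟩ := key n _ hn
  convert hreach using 1
  obtain ⟨C, hC⟩ := Ray.endpoint_eq_iff.1 (hr'.trans hsv.symm)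
  rw [Ray.germ_eq_iff]
  refine ⟨0, 0, fun n => ?_⟩
  rw [zero_add, hrl']
  exact h.eq_of_endpoint_eq hl' hs hs0.symm (fun n => by rw [← hrl']; exact hC n) n

/-! ### The canonical isomorphisms of panel trees -/

/-- The vertices at infinity `v` and `w` are the two ends of a singular line. -/
def AreJoined (v w : InfVertex X) : Prop :=
  ∃ L : Line X, L.backward.endpoint = v ∧ L.forward.endpoint = w

theorem AreJoined.symm {v w : InfVertex X} (h : AreJoined v w) : AreJoined w v := by
  obtain ⟨L, rfl, rfl⟩ := h
  exact ⟨L.reverse, by rw [Line.backward, Line.reverse_reverse], rfl⟩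

theorem StraightLine.joined (h : TypedBuilding X κ) (hl : StraightLine (Arrow X κ) l)
    {v w : InfVertex X} (hv : (hl.toLine h).backward.endpoint = v)
    (hw : (hl.toLine h).forward.endpoint = w) :
    Joined ((hl.toLine h).backward.germ v hv) ((hl.toLine h).forward.germ w hw) :=
  ⟨_, hv, hw, rfl, rfl⟩

/-- A singular line is determined by its germ at one end and the other endpoint. -/
theorem Joined.unique (hX : IsBuilding X) (hT : IsThick X) {v w : InfVertex X} {x : PanelVertex v}
    {y y' : PanelVertex w} (h1 : Joined x y) (h2 : Joined x y') : y = y' := by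
  obtain ⟨L, hv, hw, rfl, rfl⟩ := h1
  obtain ⟨L', hv', hw', e, rfl⟩ := h2
  obtain ⟨κ, h, hl⟩ := L.exists_typed hX hT
  obtain ⟨a, b, hab⟩ := Ray.germ_eq_iff.1 e
  have hab' : ∀ n : ℕ, L'.toFun (-(a + n : ℕ)) = L.toFun (-(b + n : ℕ)) := hab
  have hl' : StraightLine (Arrow X κ) L'.toFun := by
    obtain ⟨φ, hφ⟩ := L'.exists_chart
    rw [show L'.toFun = fun n => φ.emb (n, 0) from funext hφ]
    rcases h.coloring.isOriented_or φ with ho | ho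
    · exact ho.row_straight hX 0
    · exfalso
      have h1 := arrow_neg.1 ((ho.row_straight hX 0).arrow (-(a + 1 : ℕ)))
      rw [← hφ, ← hφ, hab', show -((a + 1 : ℕ) : ℤ) + 1 = -(a + 0 : ℕ) by push_cast; ring,
        hab'] at h1
      have h2 := hl.arrow (-(b + 1 : ℕ))
      rw [show -((b + 1 : ℕ) : ℤ) + 1 = -(b + 0 : ℕ) by push_cast; ring] at h2
      exact h1.asymm h2
  obtain ⟨C, hC⟩ := Ray.endpoint_eq_iff.1 (hw.trans hw'.symm)
  have hE : ∀ n : ℕ, (skeleton X).edist (L.toFun (n + -b)) (L'.toFun (n + -a)) ≤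
      (b + C + a : ℕ) := by
    intro n
    have speed : ∀ (s : ℤ → V), StraightLine (Arrow X κ) s → ∀ k : ℕ,
        (skeleton X).edist (s (n + -k)) (s n) ≤ k := by
      intro s hs k
      have := edist_add_le (s := fun i : ℕ => s (n + -k + i))
        (fun i => by
          have := (hs.arrow (n + -k + i)).edist_le
          push_cast
          rwa [← add_assoc]) 0 k
      simpa using this
    push_cast
    refine SimpleGraph.edist_triangle.trans (add_le_add (SimpleGraph.edist_triangle.trans
      (add_le_add (speed _ hl b) (hC n))) ?_)
    rw [SimpleGraph.edist_comm]
    exact speed _ hl' a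
  have key := h.eq_of_endpoint_eq (hl.shift (-b)) (hl'.shift (-a))
    (by simpa using (hab' 0).symm) hE
  rw [Ray.germ_eq_iff]
  refine ⟨a, b, fun n => ?_⟩
  have := key (a + b + n)
  show L.toFun _ = L'.toFun _
  convert this using 2 <;> push_cast <;> ring

/-- As `T_w` is connected, the lines joining `v` to the vertices of `T_w` are found by following
strips. -/
theorem AreJoined.exists_joined (hX : IsBuilding X) (hT : IsThick X) {v w : InfVertex X}
    (hvw : AreJoined v w) (y : PanelVertex w) : ∃ x : PanelVertex v, Joined x y := by
  obtain ⟨L, hv, hw⟩ := hvw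
  obtain ⟨p⟩ := panelTree_preconnected hX hT w (L.forward.germ w hw) y
  have key : ∀ y y' : PanelVertex w, (panelTree w).Walk y y' → (∃ x : PanelVertex v, Joined x y) →
      ∃ x : PanelVertex v, Joined x y' := by
    intro y y' p
    induction p with
    | nil => exact id
    | cons hadj p ih =>
      rintro ⟨x, L, hv, hw, -, rfl⟩
      obtain ⟨κ, h, hl⟩ := L.exists_typed hX hT
      obtain ⟨m, hs, hm, hmw, rfl⟩ := exists_strip_of_adj h hl hw hadj
      exact ih ⟨_, hm.joined h ((strip_endpoint_eq h hl hm hs).2.trans hv) hmw⟩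
  exact key _ _ p ⟨_, L, hv, hw, rfl, rfl⟩

theorem Strip.reverse {A : V → V → Prop} {l m : ℤ → V} (h : Strip A l m) :
    Strip (fun x y => A y x) (fun n => l (0 - n)) fun n => m (-1 - n) := by
  refine ⟨fun n => ?_, fun n => ?_, fun n => ?_⟩
  · have := h.up (-1 - n)
    rwa [show -1 - n + 1 = 0 - n by ring] at this
  · have := h.down (-1 - n)
    rwa [show -1 - n = 0 - (n + 1) by ring] at this ⊢
  · have := h.arrow (-1 - (n + 1))
    rwa [show -1 - (n + 1) + 1 = -1 - n by ring] at this

/-- Lines joining `v` and `w` whose ends at `w` are adjacent are the boundary lines of a strip, so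
their ends at `v` are adjacent too. -/
theorem Joined.adj (hX : IsBuilding X) (hT : IsThick X) {v w : InfVertex X} {x x' : PanelVertex v}
    {y y' : PanelVertex w} (h1 : Joined x y) (h2 : Joined x' y') (hy : (panelTree w).Adj y y') :
    (panelTree v).Adj x x' := by
  obtain ⟨L, hv, hw, rfl, rfl⟩ := h1
  obtain ⟨κ, h, hl⟩ := L.exists_typed hX hT
  obtain ⟨m, hs, hm, hmw, rfl⟩ := exists_strip_of_adj h hl hw hy
  have hmv := (strip_endpoint_eq h hl hm hs).2.trans hv
  obtain rfl := Joined.unique hX hT h2.symm (hm.joined h hmv hmw).symm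
  have hs' : Strip (Arrow X (-κ)) (fun n => L.toFun (0 - n)) fun n => m (-1 - n) := by
    have := hs.reverse
    exact ⟨fun n => arrow_neg.2 (this.down n), fun n => arrow_neg.2 (this.up n),
      fun n => arrow_neg.2 (this.arrow n)⟩
  have e1 : ∀ n : ℕ, ((hl.reverse 0).toLine h.neg).forward.toFun (0 + n) =
      L.backward.toFun (0 + n) := fun n => by
      show L.toFun (0 - _) = L.toFun (- _)
      rw [zero_sub]
  have e2 : ∀ n : ℕ, ((hm.reverse (-1)).toLine h.neg).forward.toFun (0 + n) =
      (hm.toLine h).backward.toFun (1 + n) := fun n => by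
    show m (-1 - _) = m (- _)
    congr 1
    push_cast
    ring
  have hl'v := (Ray.endpoint_eq_of_asymptotic e1).trans hv
  have hm'v := (Ray.endpoint_eq_of_asymptotic e2).trans hmv
  have := strip_adj h.neg (hl.reverse 0) (hm.reverse (-1)) hs' hl'v hm'v
  rwa [Ray.germ_eq_iff (h := hl'v) (h' := hv) |>.2 ⟨0, 0, e1⟩,
    Ray.germ_eq_iff (h := hm'v) (h' := hmv) |>.2 ⟨0, 1, e2⟩] at this

/-- The canonical isomorphism between the panel trees at the two ends of a line. -/
theorem AreJoined.exists_iso (hX : IsBuilding X) (hT : IsThick X) {v w : InfVertex X}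
    (hvw : AreJoined v w) : ∃ g : panelTree v ≃g panelTree w, ∀ x, Joined x (g x) := by
  choose f hf using hvw.exists_joined hX hT
  choose g hg using hvw.symm.exists_joined hX hT
  refine ⟨⟨⟨g, f, fun x => ?_, fun y => ?_⟩, fun {x x'} => ⟨fun hadj => ?_, fun hadj => ?_⟩⟩,
    fun x => (hg x).symm⟩
  · exact Joined.unique hX hT (hf (g x)).symm (hg x)
  · exact Joined.unique hX hT (hg (f y)).symm (hf y)
  · exact Joined.adj hX hT (hg x).symm (hg x').symm hadj
  · exact Joined.adj hX hT (hg x) (hg x') hadj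

end

/-! ### Following a line along four perspectivities -/

section
variable {κ : V → ZMod 3}

theorem AreJoined.isOpposite (hX : IsBuilding X) (hT : IsThick X) {v w : InfVertex X}
    (h : AreJoined v w) : IsOpposite v w := by
  obtain ⟨L, rfl, rfl⟩ := h
  exact L.isOpposite hX hT

theorem StraightLine.areJoined (h : TypedBuilding X κ) {l : ℤ → V}
    (hl : StraightLine (Arrow X κ) l) {v w : InfVertex X}
    (hv : (hl.toLine h).backward.endpoint = v) (hw : (hl.toLine h).forward.endpoint = w) :
    AreJoined v w :=
  ⟨_, hv, hw⟩

section
variable {M M' : ℤ → V} (h : TypedBuilding X κ) (hM : StraightLine (Arrow X κ) M)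
  (hM' : StraightLine (Arrow X κ) M') {c : ℕ}

theorem forward_endpoint_eq (e : ∀ n : ℕ, c ≤ n → M' n = M n) :
    (hM'.toLine h).forward.endpoint = (hM.toLine h).forward.endpoint :=
  Ray.endpoint_eq_of_asymptotic (a := c) (b := c) fun n => e _ (by omega)

theorem backward_endpoint_eq (e : ∀ n : ℕ, c ≤ n → M' (-n) = M (-n)) :
    (hM'.toLine h).backward.endpoint = (hM.toLine h).backward.endpoint :=
  Ray.endpoint_eq_of_asymptotic (a := c) (b := c) fun n => e _ (by omega)

theorem forward_germ_eq {v : InfVertex X} (e : ∀ n : ℕ, c ≤ n → M' n = M n)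
    (hv : (hM.toLine h).forward.endpoint = v) (hv' : (hM'.toLine h).forward.endpoint = v) :
    (hM'.toLine h).forward.germ v hv' = (hM.toLine h).forward.germ v hv :=
  Ray.germ_eq_iff.2 ⟨c, c, fun n => e _ (by omega)⟩

theorem backward_germ_eq {v : InfVertex X} (e : ∀ n : ℕ, c ≤ n → M' (-n) = M (-n))
    (hv : (hM.toLine h).backward.endpoint = v) (hv' : (hM'.toLine h).backward.endpoint = v) :
    (hM'.toLine h).backward.germ v hv' = (hM.toLine h).backward.germ v hv :=
  Ray.germ_eq_iff.2 ⟨c, c, fun n => e _ (by omega)⟩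

end

/-- The image of a vertex of a panel tree under a composite of four canonical isomorphisms is found
by following lines which successively share an end. -/
theorem perspectivity_apply (h : TypedBuilding X κ) {M M' M'' N : ℤ → V}
    (hM : StraightLine (Arrow X κ) M) (hM' : StraightLine (Arrow X κ) M')
    (hM'' : StraightLine (Arrow X κ) M'') (hN : StraightLine (Arrow X κ) N)
    {v w v' w' : InfVertex X} {g₁ : panelTree v ≃g panelTree w} {g₂ : panelTree w ≃g panelTree v'}
    {g₃ : panelTree v' ≃g panelTree w'} {g₄ : panelTree w' ≃g panelTree v}
    (h₁ : ∀ x, Joined x (g₁ x)) (h₂ : ∀ x, Joined x (g₂ x)) (h₃ : ∀ x, Joined x (g₃ x))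
    (h₄ : ∀ x, Joined x (g₄ x)) {c : ℕ} (e₁ : ∀ n : ℕ, c ≤ n → M' (-n) = M (-n))
    (e₂ : ∀ n : ℕ, c ≤ n → M'' n = M' n) (e₃ : ∀ n : ℕ, c ≤ n → N (-n) = M'' (-n))
    (hMv : (hM.toLine h).forward.endpoint = v) (hMw : (hM.toLine h).backward.endpoint = w)
    (hMv' : (hM'.toLine h).forward.endpoint = v') (hMw' : (hM''.toLine h).backward.endpoint = w')
    (hNv : (hN.toLine h).forward.endpoint = v) :
    g₄ (g₃ (g₂ (g₁ ((hM.toLine h).forward.germ v hMv)))) = (hN.toLine h).forward.germ v hNv := by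
  have hX := h.building
  have hT := h.thick
  have q1 := (backward_endpoint_eq h hM hM' e₁).trans hMw
  have q2 := (forward_endpoint_eq h hM' hM'' e₂).trans hMv'
  have q3 := (backward_endpoint_eq h hM'' hN e₃).trans hMw'
  rw [Joined.unique hX hT (h₁ _) (hM.joined h hMw hMv).symm,
    ← backward_germ_eq h hM hM' e₁ hMw q1, Joined.unique hX hT (h₂ _) (hM'.joined h q1 hMv'),
    ← forward_germ_eq h hM' hM'' e₂ hMv' q2,
    Joined.unique hX hT (h₃ _) (hM''.joined h hMw' q2).symm,
    ← backward_germ_eq h hM'' hN e₃ hMw' q3, Joined.unique hX hT (h₄ _) (hN.joined h q3 hNv)]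

/-- Four lines with consecutive common ends, as in `perspectivity_apply`, which all coincide in the
segment from `lo` to `hi`. -/
structure Quad (A : V → V → Prop) (lo hi : ℤ) (M M' M'' N : ℤ → V) : Prop where
  straight : StraightLine A M ∧ StraightLine A M' ∧ StraightLine A M'' ∧ StraightLine A N
  eq₁ : ∀ n ≤ hi, M' n = M n
  eq₂ : ∀ n ≥ lo, M'' n = M' n
  eq₃ : ∀ n ≤ hi, N n = M'' n
  eq₄ : ∀ n ≥ lo, N n = M n

/-- As long as the common segment of four lines is not reduced to a vertex, a strip along the first
line extends to strips along the other lines, whose boundary lines have a common segment too. -/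
theorem Quad.exists_strips {A : V → V → Prop} (hA : ArrowGeometry A) {lo hi : ℤ}
    {M M' M'' N : ℤ → V} (q : Quad A lo (hi + 1) M M' M'' N) (hlt : lo ≤ hi) {m : ℤ → V}
    (hm : Strip A M m) : ∃ m' m'' n, Strip A M' m' ∧ Strip A M'' m'' ∧ Strip A N n ∧
      Quad A lo hi m m' m'' n := by
  obtain ⟨hM, hM', hM'', hN⟩ := q.straight
  obtain ⟨m', hm', e1⟩ := hA.exists_strip hM' (N := hi) (y := m hi)
    (by rw [q.eq₁ _ (by omega)]; exact hm.down _) (by rw [q.eq₁ _ (by omega)]; exact hm.up _)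
  have a1 : ∀ n ≤ hi, m' n = m n :=
    hA.strip_eq_left hM' hm' hm (fun n hn => q.eq₁ n hn) e1
  obtain ⟨m'', hm'', e2⟩ := hA.exists_strip hM'' (N := lo) (y := m' lo)
    (by rw [q.eq₂ _ (by omega)]; exact hm'.down _) (by rw [q.eq₂ _ (by omega)]; exact hm'.up _)
  have a2 : ∀ n ≥ lo, m'' n = m' n :=
    hA.strip_eq_right hM'' hm'' hm' (fun n hn => q.eq₂ n hn) e2
  obtain ⟨k, hk, e4⟩ := hA.exists_strip hN (N := lo) (y := m lo)
    (by rw [q.eq₄ _ (by omega)]; exact hm.down _) (by rw [q.eq₄ _ (by omega)]; exact hm.up _)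
  have a4 : ∀ n ≥ lo, k n = m n :=
    hA.strip_eq_right hN hk hm (fun n hn => q.eq₄ n hn) e4
  have a3 : ∀ n ≤ hi, k n = m'' n :=
    hA.strip_eq_left hN hk hm'' (fun n hn => q.eq₃ n hn)
      (by rw [a4 _ (by omega), a2 _ (by omega), a1 _ le_rfl])
  exact ⟨m', m'', k, hm', hm'', hk, ⟨hA.strip_straight hM hm, hA.strip_straight hM' hm',
    hA.strip_straight hM'' hm'', hA.strip_straight hN hk⟩, a1, a2, a3, a4⟩

/-- A composite of four canonical isomorphisms which is described by four lines with a common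
segment of length `k` fixes the ball of radius `k` around the end of the first line. -/
theorem Quad.apply_eq (h : TypedBuilding X κ) {v w v' w' : InfVertex X}
    {g₁ : panelTree v ≃g panelTree w} {g₂ : panelTree w ≃g panelTree v'}
    {g₃ : panelTree v' ≃g panelTree w'} {g₄ : panelTree w' ≃g panelTree v}
    (h₁ : ∀ x, Joined x (g₁ x)) (h₂ : ∀ x, Joined x (g₂ x)) (h₃ : ∀ x, Joined x (g₃ x))
    (h₄ : ∀ x, Joined x (g₄ x)) {y x : PanelVertex v} (p : (panelTree v).Walk y x) :
    ∀ {lo hi : ℤ} {M M' M'' N : ℤ → V}, Quad (Arrow X κ) lo hi M M' M'' N → lo + p.length ≤ hi →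
      ∀ (hM : StraightLine (Arrow X κ) M) (hM' : StraightLine (Arrow X κ) M')
        (hM'' : StraightLine (Arrow X κ) M'') (hMv : (hM.toLine h).forward.endpoint = v),
        (hM.toLine h).backward.endpoint = w → (hM'.toLine h).forward.endpoint = v' →
        (hM''.toLine h).backward.endpoint = w' → (hM.toLine h).forward.germ v hMv = y →
        g₄ (g₃ (g₂ (g₁ x))) = x := by
  induction p with
  | nil =>
    intro lo hi M M' M'' N q hle hM hM' hM'' hMv hMw hMv' hMw' hy
    have hN := q.straight.2.2.2
    subst hy
    have e : ∀ n : ℕ, lo.natAbs ≤ n → N n = M n := fun n hn => q.eq₄ _ (by omega)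
    have hNv := (forward_endpoint_eq h hM hN e).trans hMv
    rw [perspectivity_apply h hM hM' hM'' hN h₁ h₂ h₃ h₄ (c := lo.natAbs + hi.natAbs)
      (fun n hn => q.eq₁ _ (by omega)) (fun n hn => q.eq₂ _ (by omega))
      (fun n hn => q.eq₃ _ (by omega)) hMv hMw hMv' hMw' hNv]
    exact forward_germ_eq h hM hN e hMv hNv
  | @cons y z x hadj p ih =>
    intro lo hi M M' M'' N q hle hM hM' hM'' hMv hMw hMv' hMw' hy
    subst hy
    rw [SimpleGraph.Walk.length_cons] at hle
    push_cast at hle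
    obtain ⟨m, hm, hms, hmv, rfl⟩ := exists_strip_of_adj h hM hMv hadj
    obtain ⟨hi, rfl⟩ : ∃ k, hi = k + 1 := ⟨hi - 1, by ring⟩
    obtain ⟨m', m'', k, hm', hm'', hk, q'⟩ := q.exists_strips h.geometry (by omega) hm
    have s' := h.geometry.strip_straight hM' hm'
    have s'' := h.geometry.strip_straight hM'' hm''
    exact ih q' (by omega) hms s' s'' hmv ((strip_endpoint_eq h hM hms hm).2.trans hMw)
      ((strip_endpoint_eq h hM' s' hm').1.trans hMv')
      ((strip_endpoint_eq h hM'' s'' hm'').2.trans hMw') rfl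

end

/-! ### The rows of an apartment and their ends -/

section
variable {κ : V → ZMod 3} {φ : Chart X}

theorem Chart.IsOriented.row_endpoint_eq (hφ : φ.IsOriented κ) (h : TypedBuilding X κ) (b : ℤ) :
    ((hφ.row_straight h.building b).toLine h).forward.endpoint =
        ((hφ.row_straight h.building 0).toLine h).forward.endpoint ∧
      ((hφ.row_straight h.building b).toLine h).backward.endpoint =
        ((hφ.row_straight h.building 0).toLine h).backward.endpoint := by
  have key := fun b => strip_endpoint_eq h (hφ.row_straight h.building b)
    (hφ.row_straight h.building (b + 1)) (hφ.row_strip h.building b)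
  induction b using Int.induction_on with
  | zero => exact ⟨rfl, rfl⟩
  | succ k ih => exact ⟨(key k).1.trans ih.1, (key k).2.trans ih.2⟩
  | pred k ih =>
    have := key (-k - 1)
    simp only [sub_add_cancel] at this
    exact ⟨this.1.symm.trans ih.1, this.2.symm.trans ih.2⟩

/-- A walk in the panel tree is followed by a path of oriented edges between corresponding vertices
of lines which represent its ends. -/
theorem exists_directedPath_of_walk (h : TypedBuilding X κ) {v : InfVertex X} {y x : PanelVertex v}
    (p : (panelTree v).Walk y x) : ∀ {M : ℤ → V} (hM : StraightLine (Arrow X κ) M)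
      (hMv : (hM.toLine h).forward.endpoint = v), (hM.toLine h).forward.germ v hMv = y →
      ∃ N, ∃ (hN : StraightLine (Arrow X κ) N) (hNv : (hN.toLine h).forward.endpoint = v),
        (hN.toLine h).forward.germ v hNv = x ∧
        ∀ n, DirectedPath (Arrow X κ) (N n) p.length (M n) := by
  induction p with
  | nil => exact fun {M} hM hMv hy => ⟨M, hM, hMv, hy, fun n => .refl⟩
  | cons hadj p ih =>
    intro M hM hMv hy
    subst hy
    obtain ⟨m, hs, hm, hmv, e⟩ := exists_strip_of_adj h hM hMv hadj
    obtain ⟨N, hN, hNv, e', hd⟩ := ih hm hmv e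
    exact ⟨N, hN, hNv, e', fun n => .step (hd n) (hs.down n)⟩

/-- The ends of the rows of an apartment form a geodesic in the panel tree, as directed distances
inside and outside the apartment agree. -/
theorem Chart.IsOriented.dist_row (hφ : φ.IsOriented κ) (h : TypedBuilding X κ) {v : InfVertex X}
    (hv : ∀ b, ((hφ.row_straight h.building b).toLine h).forward.endpoint = v) (m k : ℕ) :
    (panelTree v).dist (((hφ.row_straight h.building m).toLine h).forward.germ v (hv m))
      (((hφ.row_straight h.building (m + k : ℕ)).toLine h).forward.germ v (hv _)) = k := by
  have hw : ∃ p : (panelTree v).Walk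
      (((hφ.row_straight h.building m).toLine h).forward.germ v (hv m))
      (((hφ.row_straight h.building (m + k : ℕ)).toLine h).forward.germ v (hv _)),
      p.length = k := by
    induction k with
    | zero => exact ⟨.nil, rfl⟩
    | succ k ih =>
      obtain ⟨p, hp⟩ := ih
      exact ⟨p.concat (strip_adj h _ (hφ.row_straight h.building (m + (k + 1) : ℕ))
        (by exact_mod_cast hφ.row_strip h.building (m + k : ℕ)) _ _), by
          rw [SimpleGraph.Walk.length_concat, hp]⟩
  obtain ⟨p, hp⟩ := hw
  refine le_antisymm ((SimpleGraph.dist_le p).trans hp.le) ?_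
  obtain ⟨p', hp'⟩ := p.reachable.exists_walk_length_eq_dist
  rw [← hp']
  obtain ⟨N, hN, hNv, e, hd⟩ := exists_directedPath_of_walk h p' _ (hv m) rfl
  obtain ⟨i, j, hij⟩ := Ray.germ_eq_iff.1 e
  have e0 : N i = φ.emb ((j : ℤ), ((m + k : ℕ) : ℤ)) := hij 0
  have h1 := (hd i).directedDist_le
  have h2 := hφ.directedDist_eq h.coloring h.building ((j : ℤ), ((m + k : ℕ) : ℤ)) (i, m)
  rw [e0] at h1
  have h3 := modelDist_spec ((j : ℤ), ((m + k : ℕ) : ℤ)) (i, m)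
  rw [← h2] at h3
  simp only at h1 h3
  push_cast at *
  omega

/-! ### Branching apartments along the other walls of an alcove -/

/-- An oriented chart precomposed with the rotation of order three of the model at the origin. -/
theorem Chart.IsOriented.exists_rotate_three (hφ : φ.IsOriented κ) (h : TypedBuilding X κ) :
    ∃ ψ : Chart X, ψ.IsOriented κ ∧ ∀ a b, ψ.emb (a, b) = φ.emb (b, -a - b) := by
  have hg : ∀ p q : ℤ × ℤ, ModelArrow p q →
      ModelArrow (p.2, -p.1 - p.2) (q.2, -q.1 - q.2) := by
    rintro p q (hpq | hpq | hpq)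
    · exact Or.inr (Or.inr (by constructor <;> simp only <;> omega))
    · exact Or.inl (by constructor <;> simp only <;> omega)
    · exact Or.inr (Or.inl (by constructor <;> simp only <;> omega))
  obtain ⟨ψ, hψ, e⟩ := hφ.exists_comp h.coloring h.building h.thick
    (fun p => (p.2, -p.1 - p.2)) hg fun p q r e => by
      have e1 := congrArg Prod.fst e
      have e2 := congrArg Prod.snd e
      simp only [Prod.fst_add, Prod.snd_add] at e1 e2
      ext <;> simp only [Prod.fst_add, Prod.snd_add] <;> omega
  exact ⟨ψ, hψ, fun a b => e (a, b)⟩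

/-- Branching along the wall `a = 0`. -/
theorem Chart.IsOriented.exists_branch_right (hφ : φ.IsOriented κ) (h : TypedBuilding X κ) :
    ∃ ψ : Chart X, ψ.IsOriented κ ∧ (∀ a b, a ≤ 0 → ψ.emb (a, b) = φ.emb (a, b)) ∧
      ψ.emb (1, 0) ≠ φ.emb (1, 0) := by
  obtain ⟨φ₁, h₁, e₁⟩ := hφ.exists_rotate_three h
  obtain ⟨φ₂, h₂, e₂, hn⟩ := h₁.exists_branch h.coloring h.building h.thick
  obtain ⟨φ₃, h₃, e₃⟩ := h₂.exists_rotate_three h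
  obtain ⟨ψ, hψ, e⟩ := h₃.exists_rotate_three h
  refine ⟨ψ, hψ, fun a b hab => ?_, ?_⟩
  · rw [e, e₃, e₂ _ _ (by omega), e₁]
    congr 2 <;> ring
  · rw [e, e₃]
    have := hn (-1)
    rw [e₁] at this
    simpa using this

/-- Branching along the wall `a + b = 0`. -/
theorem Chart.IsOriented.exists_branch_left (hφ : φ.IsOriented κ) (h : TypedBuilding X κ) :
    ∃ ψ : Chart X, ψ.IsOriented κ ∧ (∀ a b, 0 ≤ a + b → ψ.emb (a, b) = φ.emb (a, b)) ∧
      ψ.emb (-1, 0) ≠ φ.emb (-1, 0) := by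
  obtain ⟨φ₁, h₁, e₁⟩ := hφ.exists_rotate_three h
  obtain ⟨φ₂, h₂, e₂⟩ := h₁.exists_rotate_three h
  obtain ⟨φ₃, h₃, e₃, hn⟩ := h₂.exists_branch h.coloring h.building h.thick
  obtain ⟨ψ, hψ, e⟩ := h₃.exists_rotate_three h
  refine ⟨ψ, hψ, fun a b hab => ?_, ?_⟩
  · rw [e, e₃ _ _ (by omega), e₂, e₁]
    congr 2 <;> ring
  · rw [e]
    have := hn 0
    rw [e₂, e₁] at this
    simpa using this

end

/-! ### A non-trivial horocyclic perspectivity -/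

section
variable {κ : V → ZMod 3} {φ φ₁ φ₃ : Chart X}

/-- The left half of a row of one chart followed by the right half of a row of another one. -/
def mixedRow (φ₃ φ₁ : Chart X) (b a : ℤ) : V :=
  if 0 ≤ a then φ₁.emb (a, b) else φ₃.emb (a, b)

/-- Charts `φ₁` and `φ₃` which branch off from an oriented chart `φ` on the right of the wall
`a = 0` and on the left of the wall `a + b = 0`. The row `b ≥ 0` is common to all three in the
segment `-b ≤ a ≤ 0`. -/
structure Branches (κ : V → ZMod 3) (φ φ₁ φ₃ : Chart X) : Prop where
  oriented : φ.IsOriented κ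
  oriented₁ : φ₁.IsOriented κ
  oriented₃ : φ₃.IsOriented κ
  eq₁ : ∀ a b, a ≤ 0 → φ₁.emb (a, b) = φ.emb (a, b)
  ne₁ : φ₁.emb (1, 0) ≠ φ.emb (1, 0)
  eq₃ : ∀ a b, 0 ≤ a + b → φ₃.emb (a, b) = φ.emb (a, b)
  ne₃ : φ₃.emb (-1, 0) ≠ φ.emb (-1, 0)

theorem Chart.IsOriented.exists_branches (hφ : φ.IsOriented κ) (h : TypedBuilding X κ) :
    ∃ φ₁ φ₃ : Chart X, Branches κ φ φ₁ φ₃ := by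
  obtain ⟨φ₁, h₁, e₁, n₁⟩ := hφ.exists_branch_right h
  obtain ⟨φ₃, h₃, e₃, n₃⟩ := hφ.exists_branch_left h
  exact ⟨φ₁, φ₃, hφ, h₁, h₃, e₁, n₁, e₃, n₃⟩

theorem Branches.mixedRow_eq_right (d : Branches κ φ φ₁ φ₃) {a b : ℤ} (hab : 0 ≤ a + b) :
    mixedRow φ₃ φ₁ b a = φ₁.emb (a, b) := by
  rw [mixedRow]
  split_ifs with ha
  · rfl
  · rw [d.eq₃ _ _ hab, d.eq₁ _ _ (by omega)]

theorem Branches.mixedRow_eq_left (d : Branches κ φ φ₁ φ₃) {a b : ℤ} (hb : 0 ≤ b) (ha : a ≤ 0) :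
    mixedRow φ₃ φ₁ b a = φ₃.emb (a, b) := by
  rw [mixedRow]
  split_ifs with ha'
  · rw [d.eq₃ _ _ (by omega), d.eq₁ _ _ ha]
  · rfl

/-- A mixed row is a straight line. Only the row `0` has a vertex, the origin, at which it is not a
part of a single chart. -/
theorem Branches.mixedRow_straight (d : Branches κ φ φ₁ φ₃) (h : TypedBuilding X κ) {b : ℤ}
    (hb : 0 ≤ b) : StraightLine (Arrow X κ) (mixedRow φ₃ φ₁ b) := by
  have hX := h.building
  have r₁ := d.oriented₁.row_straight hX b
  have r₃ := d.oriented₃.row_straight hX b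
  refine ⟨fun n => ?_, fun n hn => ?_⟩
  · rcases le_or_gt 0 n with hn | hn
    · rw [d.mixedRow_eq_right (by omega), d.mixedRow_eq_right (by omega)]
      exact r₁.arrow n
    · rw [d.mixedRow_eq_left hb (by omega), d.mixedRow_eq_left hb (by omega)]
      exact r₃.arrow n
  · rcases le_or_gt 0 (n + b) with hn' | hn'
    · rw [d.mixedRow_eq_right (by omega), d.mixedRow_eq_right (by omega)] at hn
      exact r₁.straight n hn
    rcases le_or_gt (n + 2) 0 with hn'' | hn''
    · rw [d.mixedRow_eq_left hb (by omega), d.mixedRow_eq_left hb (by omega)] at hn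
      exact r₃.straight n hn
    obtain ⟨rfl, rfl⟩ : n = -1 ∧ b = 0 := by omega
    rw [d.mixedRow_eq_right (by omega), d.mixedRow_eq_left hb (by omega)] at hn
    -- both `φ (0, 1)` and `φ₃ (-1, 0)` would join `φ₁ (1, 0)` and `φ (-1, 1)`
    have i₁ := fun p q => d.oriented₁.arrow_iff hX (p := p) (q := q)
    have i₃ := fun p q => d.oriented₃.arrow_iff hX (p := p) (q := q)
    have O : φ₃.emb (0, 0) = φ₁.emb (0, 0) := by rw [d.eq₁ _ _ (by omega), d.eq₃ _ _ (by omega)]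
    have u : φ₃.emb (-1, 1) = φ₁.emb (-1, 1) := by
      rw [d.eq₁ _ _ (by omega), d.eq₃ _ _ (by omega)]
    have t : φ₃.emb (0, 1) = φ₁.emb (0, 1) := by rw [d.eq₁ _ _ (by omega), d.eq₃ _ _ (by omega)]
    have := h.geometry.join_unique (x := φ₁.emb (0, 0)) (p := φ₁.emb (1, 0)) (q := φ₁.emb (-1, 1))
      (L := φ₁.emb (0, 1)) (M := φ₃.emb (-1, 0)) ((i₁ _ _).2 (by simp [ModelArrow]))
      ((i₁ _ _).2 (by simp [ModelArrow])) (by simp [φ₁.emb.injective.eq_iff])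
      ((i₁ _ _).2 (by simp [ModelArrow])) ((i₁ _ _).2 (by simp [ModelArrow]))
      ((i₁ _ _).2 (by simp [ModelArrow])) (by rw [← O]; exact (i₃ _ _).2 (by simp [ModelArrow]))
      hn (by rw [← u]; exact (i₃ _ _).2 (by simp [ModelArrow]))
    rw [← t, φ₃.emb.injective.eq_iff] at this
    simp at this

theorem Branches.quad (d : Branches κ φ φ₁ φ₃) (h : TypedBuilding X κ) {b : ℤ} (hb : 0 ≤ b) :
    Quad (Arrow X κ) (-b) 0 (fun a => φ.emb (a, b)) (fun a => φ₁.emb (a, b)) (mixedRow φ₃ φ₁ b)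
      fun a => φ₃.emb (a, b) where
  straight := ⟨d.oriented.row_straight h.building b, d.oriented₁.row_straight h.building b,
    d.mixedRow_straight h hb, d.oriented₃.row_straight h.building b⟩
  eq₁ n hn := d.eq₁ n b hn
  eq₂ n hn := d.mixedRow_eq_right (by omega)
  eq₃ n hn := (d.mixedRow_eq_left hb hn).symm
  eq₄ n hn := d.eq₃ n b (by omega)

/-- The four rows `0` through the origin do not carry the strip below the row `0` of `φ` back to
itself. -/
theorem Branches.strip_ne (d : Branches κ φ φ₁ φ₃) (h : TypedBuilding X κ) {m m' : ℤ → V}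
    (hm : Strip (Arrow X κ) (mixedRow φ₃ φ₁ 0) m) (hm0 : m 0 = φ₁.emb (1, -1))
    (hm' : Strip (Arrow X κ) (fun a => φ₃.emb (a, 0)) m') (e : m' (-1) = m (-1)) :
    m' 0 ≠ φ.emb (1, -1) := by
  intro e0
  have hX := h.building
  have i₀ := fun p q => d.oriented.arrow_iff hX (p := p) (q := q)
  have i₁ := fun p q => d.oriented₁.arrow_iff hX (p := p) (q := q)
  have i₃ := fun p q => d.oriented₃.arrow_iff hX (p := p) (q := q)
  have O₁ := d.eq₁ 0 0 le_rfl
  -- the points `φ (1, 0)` and `φ₁ (1, 0)` are joined by the line `φ (0, 1)` only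
  have hT : φ.emb (1, -1) ≠ φ₁.emb (1, -1) := by
    intro hT
    have := h.geometry.join_unique (x := φ.emb (0, 0)) (p := φ.emb (1, 0)) (q := φ₁.emb (1, 0))
      (L := φ.emb (0, 1)) (M := φ.emb (1, -1)) ((i₀ _ _).2 (by simp [ModelArrow]))
      (by rw [← O₁]; exact (i₁ _ _).2 (by simp [ModelArrow])) d.ne₁.symm
      ((i₀ _ _).2 (by simp [ModelArrow])) ((i₀ _ _).2 (by simp [ModelArrow]))
      (by rw [← d.eq₁ 0 1 le_rfl]; exact (i₁ _ _).2 (by simp [ModelArrow]))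
      ((i₀ _ _).2 (by simp [ModelArrow])) ((i₀ _ _).2 (by simp [ModelArrow]))
      (by rw [hT]; exact (i₁ _ _).2 (by simp [ModelArrow]))
    rw [φ.emb.injective.eq_iff] at this
    simp at this
  have k0 : mixedRow φ₃ φ₁ 0 0 = φ.emb (0, 0) := (d.mixedRow_eq_right (by simp)).trans O₁
  have k1 : mixedRow φ₃ φ₁ 0 (-1) = φ₃.emb (-1, 0) := d.mixedRow_eq_left le_rfl (by simp)
  have a1 := hm.arrow (-1)
  have a2 := hm'.arrow (-1)
  have a3 := hm.up (-1)
  have a4 := hm.down (-1)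
  rw [neg_add_cancel, hm0] at a1
  rw [neg_add_cancel, e0, e] at a2
  rw [neg_add_cancel, k0] at a3
  rw [k1] at a4
  -- hence the lines `φ (1, -1)` and `φ₁ (1, -1)` meet in the point `φ (0, -1)` only
  have hS : φ.emb (0, -1) = m (-1) := by
    by_contra hS
    exact hT (h.geometry.join_unique (x := φ.emb (0, 0)) ((i₀ _ _).2 (by simp [ModelArrow])) a3 hS
      ((i₀ _ _).2 (by simp [ModelArrow])) ((i₀ _ _).2 (by simp [ModelArrow])) a2
      (by rw [← O₁]; exact (i₁ _ _).2 (by simp [ModelArrow]))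
      (by rw [← d.eq₁ 0 (-1) le_rfl]; exact (i₁ _ _).2 (by simp [ModelArrow])) a1)
  rw [← hS] at a4
  exact d.ne₃ (h.geometry.join_unique (x := φ.emb (0, 0)) (p := φ.emb (0, -1))
    (q := φ.emb (-1, 1)) ((i₀ _ _).2 (by simp [ModelArrow]))
    ((i₀ _ _).2 (by simp [ModelArrow])) (by simp [φ.emb.injective.eq_iff])
    (by rw [← d.eq₃ 0 0 le_rfl]; exact (i₃ _ _).2 (by simp [ModelArrow])) a4
    (by rw [← d.eq₃ (-1) 1 le_rfl]; exact (i₃ _ _).2 (by simp [ModelArrow]))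
    ((i₀ _ _).2 (by simp [ModelArrow])) ((i₀ _ _).2 (by simp [ModelArrow]))
    ((i₀ _ _).2 (by simp [ModelArrow])))

/-- The vertices at distance `n` from the end of the row `n` are fixed, because the four rows `n`
have a common segment of length `n`. -/
theorem Branches.apply_eq_of_mem_horosphere (d : Branches κ φ φ₁ φ₃) (h : TypedBuilding X κ)
    {v w v' w' : InfVertex X} {g₁ : panelTree v ≃g panelTree w} {g₂ : panelTree w ≃g panelTree v'}
    {g₃ : panelTree v' ≃g panelTree w'} {g₄ : panelTree w' ≃g panelTree v}
    (h₁ : ∀ x, Joined x (g₁ x)) (h₂ : ∀ x, Joined x (g₂ x)) (h₃ : ∀ x, Joined x (g₃ x))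
    (h₄ : ∀ x, Joined x (g₄ x))
    (hv : ∀ b, ((d.oriented.row_straight h.building b).toLine h).forward.endpoint = v)
    (hw : ∀ b, ((d.oriented.row_straight h.building b).toLine h).backward.endpoint = w)
    (hv' : ∀ b, ((d.oriented₁.row_straight h.building b).toLine h).forward.endpoint = v')
    (hw' : ∀ b, ((d.oriented₃.row_straight h.building b).toLine h).backward.endpoint = w')
    {x : PanelVertex v} (hx : x ∈ horosphere (panelTree v) fun n : ℕ =>
      ((d.oriented.row_straight h.building n).toLine h).forward.germ v (hv n)) :
    g₄ (g₃ (g₂ (g₁ x))) = x := by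
  obtain ⟨N, hN⟩ := hx
  -- a positive `n` excludes the junk value zero of the distance between unconnected vertices
  set n := max N 1
  have hn := hN n (le_max_left _ _)
  have hpos : 0 < (panelTree v).dist x
      (((d.oriented.row_straight h.building n).toLine h).forward.germ v (hv n)) := by
    rw [hn]
    exact lt_of_lt_of_le one_pos (le_max_right _ _)
  obtain ⟨p, hp⟩ := (SimpleGraph.Reachable.of_dist_ne_zero hpos.ne').symm.exists_walk_length_eq_dist
  rw [SimpleGraph.dist_comm, hn] at hp
  have q := d.quad h (Nat.cast_nonneg (α := ℤ) n)
  exact q.apply_eq h h₁ h₂ h₃ h₄ p (by rw [hp]; simp) _ q.straight.2.1 q.straight.2.2.1 (hv n)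
    (hw n) (hv' n) ((backward_endpoint_eq h q.straight.2.2.2 q.straight.2.2.1 (c := 0)
      fun k _ => (q.eq₃ _ (by omega)).symm).trans (hw' n)) rfl

/-- The end of the row `-1` of `φ` is not fixed. -/
theorem Branches.apply_ne (d : Branches κ φ φ₁ φ₃) (h : TypedBuilding X κ)
    {v w v' w' : InfVertex X} {g₁ : panelTree v ≃g panelTree w} {g₂ : panelTree w ≃g panelTree v'}
    {g₃ : panelTree v' ≃g panelTree w'} {g₄ : panelTree w' ≃g panelTree v}
    (h₁ : ∀ x, Joined x (g₁ x)) (h₂ : ∀ x, Joined x (g₂ x)) (h₃ : ∀ x, Joined x (g₃ x))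
    (h₄ : ∀ x, Joined x (g₄ x))
    (hv : ∀ b, ((d.oriented.row_straight h.building b).toLine h).forward.endpoint = v)
    (hw : ∀ b, ((d.oriented.row_straight h.building b).toLine h).backward.endpoint = w)
    (hv' : ∀ b, ((d.oriented₁.row_straight h.building b).toLine h).forward.endpoint = v')
    (hw' : ∀ b, ((d.oriented₃.row_straight h.building b).toLine h).backward.endpoint = w') :
    ∃ x, g₄ (g₃ (g₂ (g₁ x))) ≠ x := by
  have hX := h.building
  have hA := h.geometry
  have q := d.quad h le_rfl
  obtain ⟨hM, hM₁, hK, hN⟩ := q.straight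
  have s := d.oriented.row_strip' hX 0
  have s₁ := d.oriented₁.row_strip' hX 0
  simp only [zero_sub] at s s₁
  obtain ⟨m, hm, hm0⟩ := hA.exists_strip hK (N := 0) (y := φ₁.emb (1, -1))
    (by rw [q.eq₂ _ (by simp)]; exact s₁.down 0) (by rw [q.eq₂ _ (by simp)]; exact s₁.up 0)
  obtain ⟨m', hm', e⟩ := hA.exists_strip hN (N := -1) (y := m (-1))
    (by rw [q.eq₃ _ (by simp)]; exact hm.down (-1)) (by rw [q.eq₃ _ (by simp)]; exact hm.up (-1))
  have a₂ := hA.strip_eq_right hK hm s₁ (fun n hn => q.eq₂ n (by omega)) hm0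
  have a₃ := hA.strip_eq_left hN hm' hm (fun n hn => q.eq₃ n (by omega)) e
  have t := hA.strip_straight hM s
  have t₁ := hA.strip_straight hM₁ s₁
  have tm := hA.strip_straight hK hm
  have tm' := hA.strip_straight hN hm'
  have b₀ := strip_endpoint_eq h hM t s
  have b₁ := strip_endpoint_eq h hM₁ t₁ s₁
  have bm := strip_endpoint_eq h hK tm hm
  have bm' := strip_endpoint_eq h hN tm' hm'
  have bN := forward_endpoint_eq h hM hN (c := 0) fun k _ => q.eq₄ _ (by omega)
  have bK := backward_endpoint_eq h hN hK (c := 0) fun k _ => (q.eq₃ _ (by omega)).symm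
  have hMv := b₀.1.trans (hv 0)
  have hNv := bm'.1.trans (bN.trans (hv 0))
  refine ⟨(t.toLine h).forward.germ v hMv, fun hfix => ?_⟩
  rw [perspectivity_apply h t t₁ tm tm' h₁ h₂ h₃ h₄ (c := 1)
    (fun n hn => d.eq₁ _ _ (by omega)) (fun n hn => a₂ n (by omega)) (fun n hn => a₃ _ (by omega))
    hMv (b₀.2.trans (hw 0)) (b₁.1.trans (hv' 0)) (bm.2.trans (bK.trans (hw' 0))) hNv] at hfix
  obtain ⟨i, j, hij⟩ := Ray.germ_eq_iff.1 hfix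
  have e0 : m' i = φ.emb ((j : ℤ) + 1, -1) := hij 0
  have hi := hm'.down i
  rw [e0, q.eq₄ _ (by omega), d.oriented.arrow_iff hX] at hi
  -- asymptotic lines on the same side of the row `0` are asymptotic without a shift
  obtain rfl : i = j := by
    simp only [ModelArrow] at hi
    omega
  have key : ∀ k : ℕ, m' k = φ.emb ((k : ℤ) + 1, -1) → m' 0 = φ.emb (1, -1) := by
    intro k
    induction k with
    | zero => simp
    | succ k ih =>
      intro hk
      push_cast at hk
      exact ih (hA.strip_eq_pred hN hm' s (q.eq₄ _ (by omega)) (q.eq₄ _ (by omega)) hk)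
  exact d.strip_ne h hm hm0 hm' e (key i e0)

/-- A horocyclic projectivity of the panel tree at the end `v` of the rows of an apartment `φ`: the
composite of the canonical isomorphisms along the rows of `φ`, of `φ₁`, the mixed rows, and the rows
of `φ₃`. -/
theorem Chart.IsOriented.exists_isHorocyclic (hφ : φ.IsOriented κ) (h : TypedBuilding X κ) :
    ∃ g ∈ projectivityGroup ((hφ.row_straight h.building 0).toLine h).forward.endpoint,
      g ≠ 1 ∧ IsHorocyclic (panelTree _) g := by
  have hX := h.building
  have hT := h.thick
  obtain ⟨φ₁, φ₃, d⟩ := hφ.exists_branches h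
  set v := ((hφ.row_straight hX 0).toLine h).forward.endpoint with hv
  set w := ((hφ.row_straight hX 0).toLine h).backward.endpoint with hw
  set v' := ((d.oriented₁.row_straight hX 0).toLine h).forward.endpoint with hv'
  set w' := ((d.oriented₃.row_straight hX 0).toLine h).backward.endpoint with hw'
  have q := d.quad h le_rfl
  obtain ⟨hM, hM₁, hK, hN⟩ := q.straight
  have j₁ : AreJoined v w := (hM.areJoined h rfl rfl).symm
  have j₂ : AreJoined w v' := hM₁.areJoined h
    (backward_endpoint_eq h hM hM₁ (c := 0) fun k _ => q.eq₁ _ (by omega)) rfl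
  have j₃ : AreJoined v' w' := (hK.areJoined h
    (backward_endpoint_eq h hN hK (c := 0) fun k _ => (q.eq₃ _ (by omega)).symm)
    (forward_endpoint_eq h hM₁ hK (c := 0) fun k _ => q.eq₂ _ (by omega))).symm
  have j₄ : AreJoined w' v := hN.areJoined h rfl
    (forward_endpoint_eq h hM hN (c := 0) fun k _ => q.eq₄ _ (by omega))
  obtain ⟨g₁, h₁⟩ := j₁.exists_iso hX hT
  obtain ⟨g₂, h₂⟩ := j₂.exists_iso hX hT
  obtain ⟨g₃, h₃⟩ := j₃.exists_iso hX hT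
  obtain ⟨g₄, h₄⟩ := j₄.exists_iso hX hT
  have ev := fun b => (hφ.row_endpoint_eq h b).1
  have ew := fun b => (hφ.row_endpoint_eq h b).2
  have ev' := fun b => (d.oriented₁.row_endpoint_eq h b).1
  have ew' := fun b => (d.oriented₃.row_endpoint_eq h b).2
  refine ⟨(((SimpleGraph.Iso.refl.trans g₁).trans g₂).trans g₃).trans g₄, ?_, fun e => ?_,
    fun n : ℕ => ((hφ.row_straight hX n).toLine h).forward.germ v (ev n), fun m n hmn => ?_,
    fun x hx => ?_⟩
  · exact IsPerspectivity.step _ _ (.step _ _ (.step _ _ (.step _ _ .refl (j₁.isOpposite hX hT) h₁)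
      (j₂.isOpposite hX hT) h₂) (j₃.isOpposite hX hT) h₃) (j₄.isOpposite hX hT) h₄
  · obtain ⟨x, hx⟩ := d.apply_ne h h₁ h₂ h₃ h₄ ev ew ev' ew'
    exact hx (DFunLike.congr_fun e x)
  · obtain ⟨k, rfl⟩ := Nat.exists_eq_add_of_le hmn
    rw [Nat.add_sub_cancel_left]
    exact hφ.dist_row h ev m k
  · exact d.apply_eq_of_mem_horosphere h h₁ h₂ h₃ h₄ ev ew ev' ew' hx

end

end TriangularBuilding

theorem proposition4p1 {V : Type*} (X : AbstractSimplicialComplex V)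
    (hX : TriangularBuilding.IsBuilding X) (hthick : TriangularBuilding.IsThick X) :
    Nonempty (TriangularBuilding.InfVertex X) ∧
      ∀ v : TriangularBuilding.InfVertex X, ∃ g ∈ TriangularBuilding.projectivityGroup v,
        g ≠ 1 ∧ TriangularBuilding.IsHorocyclic (TriangularBuilding.panelTree v) g := by
  obtain ⟨φ₀⟩ := hX.nonempty_chart
  refine ⟨⟨φ₀.rayOne.endpoint⟩, fun v => ?_⟩
  obtain ⟨r, rfl⟩ := Quotient.exists_rep v
  obtain ⟨φ, hφ⟩ := r.exists_chart
  obtain ⟨κ₀, hκ₀⟩ := hX.exists_coloring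
  obtain ⟨κ, hκ, ho⟩ : ∃ κ, TriangularBuilding.IsColoring X κ ∧ φ.IsOriented κ := by
    rcases hκ₀.isOriented_or φ with ho | ho
    exacts [⟨_, hκ₀, ho⟩, ⟨_, hκ₀.neg, ho⟩]
  have h : TriangularBuilding.TypedBuilding X κ := ⟨hX, hthick, hκ⟩
  have e : ((ho.row_straight hX 0).toLine h).forward.endpoint = r.endpoint :=
    TriangularBuilding.Ray.endpoint_eq_of_asymptotic (a := 0) (b := 0) fun n => (hφ _).symm
  have key := ho.exists_isHorocyclic h
  rw [e] at key
  exact key
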